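/- Theorem 4.5. Let $M\ge 1$, let $(\theta_n)_{n\in\mathbb Z}$ and $(\kappa_t)_{t\in\mathbb Z}$ be sequences of positive integers, let $\ell^{(i)}_j$ ($1\le i\le N$, $1\le j\le M$) be non-negative integers, and put $L^{(i)}=\sum_{j=1}^M \ell^{(i)}_j$. Suppose that $$L^{(1)}\ge L^{(2)}\ge\cdots\ge L^{(N)},\qquad \ell^{(1)}_j\ge \ell^{(2)}_j\ge\cdots\ge \ell^{(N)}_j\quad(1\le j\le M),$$ and let $K^{(i)}_0$ be arbitrary integers. Write $\sum_{k}^{n}X_k$ for $\sum_{k=1}^n X_k$ if $n\ge1$, for $0$ if $n=0$ and for $-\sum_{k=n+1}^0X_k$ if $n\le-1$, and define $\prod_k^nX_k$ in the same way ($\prod_{k=n+1}^0X_k^{-1}$ for $n\le -1$). Extend $\ell^{(i)}_{j+M}=\ell^{(i)}_j$, put $X^{(i)}(j)=\sum_{j'=1}^j\ell^{(i)}_{j'}$ and $$K^{(i)}(t,n,j)=K^{(i)}_0-\sum_{j'=1}^j\ell^{(i)}_{j'}-\sum_{t'}^t\min[\kappa_{t'},L^{(i)}]+\sum_{n'}^n\min[\theta_{n'},L^{(i)}].$$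 For $\vec\mu\in\{0,1\}^N$ with $\{i:\mu_i=1\}=\{i_1<\cdots<i_p\}$ put $$A(\vec\mu;j)=\sum_{k=1}^p(k-1)L^{(i_k)}+\sum_{k=1}^p\bigl(X^{(i_k)}(j+k-1)-X^{(i_k)}(j)\bigr).$$ Then $$Y^{t+1}_{n+1,j+1}=\max_{\vec\mu\in\{0,1\}^N}\Bigl[\sum_{i=1}^N\mu_iK^{(i)}(t,n,j)-A(\vec\mu;j)\Bigr]\qquad(t,n\in\mathbb Z,\ 0\le j\le M)$$ is an $N$-soliton solution of the $A^{(1)}_M$ automaton with box capacities $\theta_n$ and carrier capacities $\kappa_t$, which means the following. (1) $Y$ is an ultradiscrete limit of $M\times N$-soliton solutions of the nonautonomous discrete KP equation. For $\varepsilon>0$ let $a_{t+1}=1+e^{-\kappa_t/\varepsilon}$, $b_{n+1}=1+e^{-\theta_n/\varepsilon}$, $c_1=1$, $c_2=\cdots=c_{M+1}=0$, $c_{j+M+1}=c_j$. For all sufficiently small $\varepsilon>0$ there are real numbers $1>p_1>\cdots>p_N>(1+M^{-1})^{-1}$ and complex numbers $\alpha_{i,m}$ ($1\le i\le N$, $1\le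 m\le M$), depending on $\varepsilon$, with $\lim_{\varepsilon\to+0}\varepsilon\log(1-p_i)=-L^{(i)}$, such that the following holds. For each $i$ the polynomial $\bigl(x^M(1-x)-p_i^M(1-p_i)\bigr)/(x-p_i)$ has $M$ distinct roots $q_{i,1},\dots,q_{i,M}$, all different from $p_i$. Put $$E(p;t,n,j)=\prod_{t'}^t(a_{t'}-p)\prod_{n'}^n(b_{n'}-p)^{-1}\prod_{j'}^j(p-c_{j'})^{-1},$$ $$\tau_\varepsilon(t,n,j)=\sum_{S\subseteq\{1,\dots,N\}\times\{1,\dots,M\}}\ \Bigl(\prod_{(i,m)\in S}\alpha_{i,m}\frac{E(p_i;t,n,j)}{E(q_{i,m};t,n,j)}\Bigr)\det\Bigl(\frac1{p_i-q_{i',m'}}\Bigr)_{(i,m),(i',m')\in S},$$ which is the vacuum expectation value $\langle vac|\prod_{i,m}(1+\alpha_{i,m}\psi(p_i,\mathbf t)\psi^*(q_{i,m},\mathbf t))|vac\rangle$ for the fermionic fields $\psi(p,\mathbf t)=E(p;\mathbf t)\psi(p)$, $\psi^*(q,\mathbf t)=E(q;\mathbf t)^{-1}\psi^*(q)$, $\mathbf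 t=(t,n,j)$. Then for all $t,n,j\in\mathbb Z$ $$(b_{n+1}-c_{j+1})\,\tau_\varepsilon(t,n,j)\,\tau_\varepsilon(t+1,n+1,j+1)+(c_{j+1}-a_{t+1})\,\tau_\varepsilon(t+1,n+1,j)\,\tau_\varepsilon(t,n,j+1)+(a_{t+1}-b_{n+1})\,\tau_\varepsilon(t,n+1,j)\,\tau_\varepsilon(t+1,n,j+1)=0$$ and $\tau_\varepsilon(t,n,j+M+1)=\tau_\varepsilon(t,n,j)$. Moreover, for all $t,n\in\mathbb Z$ and $1\le j\le M+1$, $\tau_\varepsilon(t,n,j)$ is real and positive for all sufficiently small $\varepsilon$, and $\lim_{\varepsilon\to+0}\varepsilon\log\tau_\varepsilon(t,n,j)=Y^t_{n,j}$. (2) $Y$ gives a solution of the automaton. Let $B_k$ be the $U_q'(A^{(1)}_M)$-crystal of the $k$-fold symmetric tensor representation, whose elements are the $(x_1,\dots,x_{M+1})\in\mathbb Z_{\ge0}^{M+1}$ with $\sum_ix_i=k$. For $1\le j\le M$ put $$u^t_{n,j}=Y^t_{n+1,j}+Y^t_{n,j+1}-Y^t_{n,j}-Y^t_{n+1,j+1},\qquad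 v^t_{n,j}=Y^{t+1}_{n,j+1}+Y^t_{n,j}-Y^{t+1}_{n,j}-Y^t_{n,j+1},$$ and let $u^t_{n,M+1}=\theta_n-\sum_{j=1}^Mu^t_{n,j}$, $v^t_{n,M+1}=\kappa_t-\sum_{j=1}^Mv^t_{n,j}$. Then $b^t_n=(u^t_{n,M+1},\dots,u^t_{n,1})\in B_{\theta_n}$ and $v^t_n=(v^t_{n,M+1},\dots,v^t_{n,1})\in B_{\kappa_t}$ for all $t,n$, and the combinatorial $R$ matrix $R:B_{\kappa_t}\otimes B_{\theta_n}\to B_{\theta_n}\otimes B_{\kappa_t}$ (the isomorphism of crystals) maps $v^t_n\otimes b^t_n$ to $b^{t+1}_n\otimes v^t_{n+1}$. For each $t$, $b^t_n=(\theta_n,0,\dots,0)$ for all but finitely many $n$, and for each $n$, $v^t_n=(\kappa_t,0,\dots,0)$ for all but finitely many $t$. -/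

import Mathlib

open Filter Topology

noncomputable section

namespace AMAutomaton

/-! ### Crystals of symmetric tensors and the combinatorial R matrix -/

/-- The set `B_k` of single row semistandard tableaux of length `k` on the letters `1, …, M+1`,
each given by the multiplicities of its contents: `x i` is the multiplicity of the
letter `i + 1`, for `i = 0, …, M`. -/
def Crystal (M k : ℕ) : Type := {x : Fin (M + 1) → ℕ // ∑ i, x i = k}

theorem sum_move {M k : ℕ} (b : Crystal M k) (i j : Fin (M + 1)) (h : 0 < b.1 i) :
    ∑ l, (b.1 l - (Pi.single i 1 : Fin (M + 1) → ℕ) l + (Pi.single j 1 : Fin (M + 1) → ℕ) l)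
      = k := by
  have h1 : ∀ l, b.1 l - (Pi.single i 1 : Fin (M + 1) → ℕ) l
      + (Pi.single i 1 : Fin (M + 1) → ℕ) l = b.1 l := by
    intro l
    by_cases hl : l = i
    · subst hl
      simp only [Pi.single_eq_same]
      omega
    · simp [hl]
  have h2 : ∑ l, (b.1 l - (Pi.single i 1 : Fin (M + 1) → ℕ) l
      + (Pi.single i 1 : Fin (M + 1) → ℕ) l) = k := by
    rw [Finset.sum_congr rfl (fun l _ => h1 l)]
    exact b.2
  rw [Finset.sum_add_distrib] at h2 ⊢
  simpa using h2

/-- Turn one content from the letter with position `i` into the letter with position `j`;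
`none` (the crystal-theoretic `0`) if there is no such content. -/
def move {M k : ℕ} (i j : Fin (M + 1)) (b : Crystal M k) : Option (Crystal M k) :=
  if h : 0 < b.1 i then some ⟨fun l => b.1 l - (Pi.single i 1 : Fin (M + 1) → ℕ) l
    + (Pi.single j 1 : Fin (M + 1) → ℕ) l, sum_move b i j h⟩ else none

/-- The Kashiwara operator `ẽ_i`, `i ∈ {0, …, M}`: one letter `i + 1` becomes a letter `i`
(for `i = 0`, one letter `1` becomes a letter `M + 1`).
In `Fin (M + 1)` the index `i - 1` is cyclic. -/
def eOp {M k : ℕ} (i : Fin (M + 1)) (b : Crystal M k) : Option (Crystal M k) := move i (i - 1) b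

/-- The Kashiwara operator `f̃_i`, `i ∈ {0, …, M}`: one letter `i` becomes a letter `i + 1`
(for `i = 0`, one letter `M + 1` becomes a letter `1`). -/
def fOp {M k : ℕ} (i : Fin (M + 1)) (b : Crystal M k) : Option (Crystal M k) := move (i - 1) i b

/-- `ε_i(b)`: how often `ẽ_i` can be applied to `b`. -/
def epsilon {M k : ℕ} (i : Fin (M + 1)) (b : Crystal M k) : ℕ := b.1 i

/-- `φ_i(b)`: how often `f̃_i` can be applied to `b`. -/
def phi {M k : ℕ} (i : Fin (M + 1)) (b : Crystal M k) : ℕ := b.1 (i - 1)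

/-- `ẽ_i` on the tensor product `B_k ⊗ B_l`. -/
def tensorE {M k l : ℕ} (i : Fin (M + 1)) (x : Crystal M k × Crystal M l) :
    Option (Crystal M k × Crystal M l) :=
  if epsilon i x.2 ≤ phi i x.1 then (eOp i x.1).map (fun y => (y, x.2))
  else (eOp i x.2).map (fun y => (x.1, y))

/-- `f̃_i` on the tensor product `B_k ⊗ B_l`. -/
def tensorF {M k l : ℕ} (i : Fin (M + 1)) (x : Crystal M k × Crystal M l) :
    Option (Crystal M k × Crystal M l) :=
  if epsilon i x.2 < phi i x.1 then (fOp i x.1).map (fun y => (y, x.2))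
  else (fOp i x.2).map (fun y => (x.1, y))

/-- The combinatorial R matrix `B_k ⊗ B_l ≃ B_l ⊗ B_k`: the isomorphism of crystals, that is, the
bijection which commutes with all `ẽ_i` and `f̃_i`. -/
def IsCombinatorialR {M k l : ℕ}
    (R : (Crystal M k × Crystal M l) ≃ (Crystal M l × Crystal M k)) : Prop :=
  ∀ i x, (tensorE i x).map R = tensorE i (R x) ∧ (tensorF i x).map R = tensorF i (R x)

/-- The highest weight element `u_k = (k, 0, …, 0)`. -/
def highest (M k : ℕ) : Crystal M k := ⟨Pi.single 0 k, by simp⟩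

/-! ### The automaton -/

/-- A space-time pattern of the `A_M^{(1)}` automaton with box capacities `θ n` and carrier
capacities `κ t`: boxes `b t n ∈ B_{θ n}` and carriers `v t n ∈ B_{κ t}` with
`R : v t n ⊗ b t n ↦ b (t+1) n ⊗ v t (n+1)`, and with only finitely many nontrivial
boxes at each time and only finitely many nontrivial carriers at each site. -/
structure IsAutomatonSolution {M : ℕ} (θ κ : ℤ → ℕ)
    (b : (t n : ℤ) → Crystal M (θ n)) (v : (t n : ℤ) → Crystal M (κ t)) : Prop where
  evolution : ∀ t n : ℤ,
    ∃ R : (Crystal M (κ t) × Crystal M (θ n)) ≃ (Crystal M (θ n) × Crystal M (κ t)),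
      IsCombinatorialR R ∧ R (v t n, b t n) = (b (t + 1) n, v t (n + 1))
  finite_boxes : ∀ t : ℤ, {n : ℤ | b t n ≠ highest M (θ n)}.Finite
  finite_carriers : ∀ n : ℤ, {t : ℤ | v t n ≠ highest M (κ t)}.Finite

/-! ### Soliton solutions of the nonautonomous discrete KP equation -/

/-- The directed product `∏_{k}^{n} X_k`: `∏_{k=1}^n X_k` for `n ≥ 1`, `1` for `n = 0`, and
`∏_{k=n+1}^0 X_k⁻¹` for `n ≤ -1`. (One of the two factors is always an empty product.) -/
def dirProd (X : ℤ → ℂ) (n : ℤ) : ℂ :=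
  (∏ k ∈ Finset.Icc 1 n, X k) * ∏ k ∈ Finset.Icc (n + 1) 0, (X k)⁻¹

/-- The directed sum `∑_{k}^{n} X_k`: `∑_{k=1}^n X_k` for `n ≥ 1`, `0` for `n = 0`, and
`-∑_{k=n+1}^0 X_k` for `n ≤ -1`. -/
def dirSum (X : ℤ → ℤ) (n : ℤ) : ℤ :=
  (∑ k ∈ Finset.Icc 1 n, X k) - ∑ k ∈ Finset.Icc (n + 1) 0, X k

/-- The nonautonomous discrete KP (Hirota–Miwa) equation with parameters `a`, `b`, `c`. -/
def NdKP (a b c : ℤ → ℂ) (τ : ℤ → ℤ → ℤ → ℂ) : Prop :=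
  ∀ t n j : ℤ,
    (b (n + 1) - c (j + 1)) * τ t n j * τ (t + 1) (n + 1) (j + 1)
      + (c (j + 1) - a (t + 1)) * τ (t + 1) (n + 1) j * τ t n (j + 1)
      + (a (t + 1) - b (n + 1)) * τ t (n + 1) j * τ (t + 1) n (j + 1) = 0

/-- The scalar `E(p)` in `ψ(p, (t,n,j)) = E(p) ψ(p)` and `ψ*(q, (t,n,j)) = E(q)⁻¹ ψ*(q)`. -/
def planeWave (a b c : ℤ → ℂ) (p : ℂ) (t n j : ℤ) : ℂ :=
  dirProd (fun k => a k - p) t * dirProd (fun k => (b k - p)⁻¹) n *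
    dirProd (fun k => (p - c k)⁻¹) j

/-- The soliton τ-function `⟨vac| ∏_k (1 + α_k ψ(p_k, (t,n,j)) ψ*(q_k, (t,n,j))) |vac⟩`, with one
ndKP soliton for each `k : ι`. It is written out by expanding the product over the subsets `S` of
the index set and evaluating
`⟨vac| ∏_{k ∈ S} ψ(p_k) ψ*(q_k) |vac⟩ = det (1 / (p_k - q_l))_{k, l ∈ S}`. -/
def solitonTau {ι : Type} [Fintype ι] [DecidableEq ι] (a b c : ℤ → ℂ) (α p q : ι → ℂ)
    (t n j : ℤ) : ℂ :=
  ∑ S : Finset ι,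
    (∏ k ∈ S, α k * (planeWave a b c (p k) t n j / planeWave a b c (q k) t n j)) *
      Matrix.det (Matrix.of fun k l : {x // x ∈ S} => 1 / (p k - q l))

/-- For `X = θ` or `X = κ`, the parameters `b_n = 1 + γ_{n-1}`, `γ_n = exp(-θ_n / ε)`, respectively
`a_t = 1 + δ_{t-1}`, `δ_t = exp(-κ_t / ε)`. -/
def expParam (X : ℤ → ℕ) (ε : ℝ) (k : ℤ) : ℂ := ((1 + Real.exp (-(X (k - 1) : ℝ) / ε) : ℝ) : ℂ)

/-- `c_1 = 1`, `c_2 = ⋯ = c_{M+1} = 0`, continued with period `M + 1`. -/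
def cParam (M : ℕ) (j : ℤ) : ℂ := if j % ((M : ℤ) + 1) = 1 then 1 else 0

/-- The `M × N`-soliton τ-function of ndKP in which, for each `i`, the `M` solitons indexed by
`(i, m)` share the momentum `p i` and have the dual momenta `q i m`. -/
def familyTau {M N : ℕ} (θ κ : ℤ → ℕ) (ε : ℝ) (α : Fin N → Fin M → ℂ) (p : Fin N → ℝ)
    (q : Fin N → Fin M → ℂ) : ℤ → ℤ → ℤ → ℂ :=
  solitonTau (ι := Fin N × Fin M) (expParam κ ε) (expParam θ ε) (cParam M)
    (fun k => α k.1 k.2) (fun k => (p k.1 : ℂ)) (fun k => q k.1 k.2)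

/-- Admissible momenta: `1 > p_1 > ⋯ > p_N > (1 + M⁻¹)⁻¹`, and for every `i` the `M` numbers
`q_{i,1}, …, q_{i,M}` are the distinct roots of `(x^M (1 - x) - p_i^M (1 - p_i)) / (x - p_i)`. -/
structure AdmissibleMomenta {M N : ℕ} (p : Fin N → ℝ) (q : Fin N → Fin M → ℂ) : Prop where
  lower : ∀ i, (1 + (M : ℝ)⁻¹)⁻¹ < p i
  upper : ∀ i, p i < 1
  strictAnti : StrictAnti p
  q_ne : ∀ i m, q i m ≠ (p i : ℂ)
  q_root : ∀ i m, q i m ^ M * (1 - q i m) = (p i : ℂ) ^ M * (1 - (p i : ℂ))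
  q_injective : ∀ i, Function.Injective (q i)

/-- `Y t n j`, `1 ≤ j ≤ M + 1`, is the ultradiscrete limit `lim_{ε → +0} ε log τ_ε(t, n, j)` of a
one-parameter family of `M × N`-soliton solutions `τ_ε` of ndKP which satisfy the constraint
`τ(t, n, j + M + 1) = τ(t, n, j)`, where the `M` solitons of the `i`-th group merge into a soliton
of amplitude `L i`, i.e. `lim_{ε → +0} ε log (1 - p_i) = -L i`. -/
def IsUltradiscreteSolitonLimit (M N : ℕ) (θ κ : ℤ → ℕ) (L : Fin N → ℕ)
    (Y : ℤ → ℤ → ℤ → ℤ) : Prop :=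
  ∃ (α : ℝ → Fin N → Fin M → ℂ) (p : ℝ → Fin N → ℝ) (q : ℝ → Fin N → Fin M → ℂ),
    (∀ᶠ ε in 𝓝[>] (0 : ℝ),
      AdmissibleMomenta (p ε) (q ε) ∧
      NdKP (expParam κ ε) (expParam θ ε) (cParam M) (familyTau θ κ ε (α ε) (p ε) (q ε)) ∧
      ∀ t n j : ℤ, familyTau θ κ ε (α ε) (p ε) (q ε) t n (j + M + 1) =
        familyTau θ κ ε (α ε) (p ε) (q ε) t n j) ∧
    (∀ i, Tendsto (fun ε : ℝ => ε * Real.log (1 - p ε i)) (𝓝[>] 0) (𝓝 (-(L i : ℝ)))) ∧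
    ∀ t n j : ℤ, 1 ≤ j → j ≤ (M : ℤ) + 1 →
      (∀ᶠ ε in 𝓝[>] (0 : ℝ), 0 < (familyTau θ κ ε (α ε) (p ε) (q ε) t n j).re ∧
        (familyTau θ κ ε (α ε) (p ε) (q ε) t n j).im = 0) ∧
      Tendsto (fun ε : ℝ => ε * Real.log (familyTau θ κ ε (α ε) (p ε) (q ε) t n j).re)
        (𝓝[>] 0) (𝓝 (Y t n j : ℝ))

/-- `u^t_{n,j} = Y^t_{n+1,j} + Y^t_{n,j+1} - Y^t_{n,j} - Y^t_{n+1,j+1}`. -/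
def uOf (Y : ℤ → ℤ → ℤ → ℤ) (t n j : ℤ) : ℤ :=
  Y t (n + 1) j + Y t n (j + 1) - Y t n j - Y t (n + 1) (j + 1)

/-- `v^t_{n,j} = Y^{t+1}_{n,j+1} + Y^t_{n,j} - Y^{t+1}_{n,j} - Y^t_{n,j+1}`. -/
def vOf (Y : ℤ → ℤ → ℤ → ℤ) (t n j : ℤ) : ℤ :=
  Y (t + 1) n (j + 1) + Y t n j - Y (t + 1) n j - Y t n (j + 1)

/-- `Y` is an `N`-soliton solution, with amplitudes `L`, of the `A_M^{(1)}` automaton: it is an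
ultradiscrete limit of `M × N`-soliton solutions of ndKP, and the `u`, `v` that it defines are
the contents of a solution of the automaton, `b^t_n = (u_{M+1}, u_M, …, u_1)` and
`v^t_n = (v_{M+1}, v_M, …, v_1)`. (The first entries, at position `0`, are determined by the
totals `θ n` and `κ t`; position `i + 1` carries the index `j = M - i`.) -/
def IsNSolitonSolution (M N : ℕ) (θ κ : ℤ → ℕ) (L : Fin N → ℕ) (Y : ℤ → ℤ → ℤ → ℤ) : Prop :=
  IsUltradiscreteSolitonLimit M N θ κ L Y ∧
  ∃ (b : (t n : ℤ) → Crystal M (θ n)) (v : (t n : ℤ) → Crystal M (κ t)),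
    IsAutomatonSolution θ κ b v ∧
    ∀ t n : ℤ, ∀ i : Fin M,
      ((b t n).1 i.succ : ℤ) = uOf Y t n ((M : ℤ) - (i : ℤ)) ∧
      ((v t n).1 i.succ : ℤ) = vOf Y t n ((M : ℤ) - (i : ℤ))

/-! ### The explicit solution -/

section Explicit

variable {M N : ℕ} [NeZero M]

/-- `X^{(i)}(j) = ∑_{j'=1}^j ℓ_{j'}^{(i)}` with `ℓ_{j+M} = ℓ_j`. Here `ℓ i k` stands for
`ℓ_{k+1}^{(i)}`, `k = 0, …, M-1`, and `Fin.ofNat M k` is `k` modulo `M`. -/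
def partialContent (ℓ : Fin N → Fin M → ℕ) (i : Fin N) (j : ℕ) : ℕ :=
  ∑ k ∈ Finset.range j, ℓ i (Fin.ofNat M k)

/-- `K^{(i)}(t, n, j)` -/
def phaseK (θ κ : ℤ → ℕ) (K₀ : Fin N → ℤ) (L : Fin N → ℕ) (ℓ : Fin N → Fin M → ℕ)
    (i : Fin N) (t n : ℤ) (j : ℕ) : ℤ :=
  K₀ i - (partialContent ℓ i j : ℤ) - dirSum (fun t' => ((min (κ t') (L i) : ℕ) : ℤ)) t
    + dirSum (fun n' => ((min (θ n') (L i) : ℕ) : ℤ)) n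

/-- The phase factor `A(μ; j)`, where `S = {i | μ_i = 1} = {i_1 < ⋯ < i_p}`; for `i = i_k` the
number of elements of `S` below `i` is `k - 1`. -/
def phaseA (L : Fin N → ℕ) (ℓ : Fin N → Fin M → ℕ) (S : Finset (Fin N)) (j : ℕ) : ℤ :=
  (∑ i ∈ S, ((S.filter (· < i)).card : ℤ) * (L i : ℤ)) +
    ∑ i ∈ S, ((partialContent ℓ i (j + (S.filter (· < i)).card) : ℤ) - (partialContent ℓ i j : ℤ))

/-- `max_μ [∑_i μ_i K^{(i)}(t, n, j) - A(μ; j)]`, the maximum over all `μ ∈ {0, 1}^N`, encoded by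
`S = {i | μ_i = 1}`. -/
def solitonMax (θ κ : ℤ → ℕ) (K₀ : Fin N → ℤ) (L : Fin N → ℕ) (ℓ : Fin N → Fin M → ℕ)
    (t n : ℤ) (j : ℕ) : ℤ :=
  (Finset.univ : Finset (Finset (Fin N))).sup' ⟨∅, Finset.mem_univ ∅⟩
    (fun S => ∑ i ∈ S, phaseK θ κ K₀ L ℓ i t n j - phaseA L ℓ S j)

end Explicit

end AMAutomaton

end

/-! The soliton τ-function is `det (1 + A)` with `A` a weighted Cauchy matrix, and a step in `n` or
`j` (a backward step in `t`) is a Miwa shift of the weights. When the shift factors are moved from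
rows to columns, one shift perturbs `1 + A` by rank one and two shifts perturb it by rank two. The
Hirota–Miwa equation then says that a 3 × 3 determinant with two equal rows vanishes
(`cauchyTau_bilinear`). The equation `q ^ M * (1 - q) = p ^ M * (1 - p)` makes the weights periodic
in `j`.

For the limit, everything is compared with scales `ε ^ w * e ^ (r / ε)`. With `i` counted from 0,
take `1 - p_i = ε ^ (M (N - i)) e ^ (-L_i / ε)`. The dual momenta `q_{i,m}` are complex in general,
but they enter only through moments: as the `M` solitons of a group share `p_i`, the determinant
reduces to size `N`, and each principal minor is a Vandermonde product in the `p_i` times a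
determinant of moments `∑ z_m q_m ^ k` (`cauchyTau_prod_eq_sum`). The weights `α` are chosen so that
their first `M` moments are `ε ^ (v k) e ^ ((K - X(k)) / ε)` with `v = N - i`; the equation for `q`
is a recursion that carries this law to all `k`, because `X(k + M) = X(k) + L`
(`momentFamily_of_initial`). Plane wave factors such as `b - q` leave the leading scale unchanged.
In a moment determinant the identity permutation dominates, by the rearrangement inequality and the
ordering of the contents, and the powers of `ε` break ties (`asym_moment_det`). So every minor is
eventually positive with rate `∑ μ_i K_i - A(μ)`, and their sum tends to the maximum
(`udLimit_familyTau`).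

For the automaton, the ultradiscrete equation with `θ < κ` is the recursion for the load of a
carrier running around the circle of letters, and the map defined by loads commutes with the
Kashiwara operators (`tensorE_crystalR`). For `κ < θ` the inverse map serves; for equal capacities R
is the identity (`exists_R_of_ultradiscreteKP`). Contents are nonnegative because the same equation
with time or position frozen, that is with a vanishing capacity, becomes an inequality. The contents
at nonzero positions are increments of bounded monotone sequences, so all but finitely many vanish.
-/

noncomputable section

set_option linter.unusedSectionVars false

namespace AMAutomaton

/-! ### The bilinear identity for Cauchy determinants -/

section Cauchy

variable {ι : Type} [Fintype ι] [DecidableEq ι]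

/-- The matrix `x_k / (p_k - q_l)`. -/
def cauchyWeighted (x p q : ι → ℂ) : Matrix ι ι ℂ := Matrix.of fun k l => x k / (p k - q l)

/-- The sum of the principal minors of `cauchyWeighted`, in closed form. -/
def cauchyTau (x p q : ι → ℂ) : ℂ := (1 + cauchyWeighted x p q).det

/-- The determinant of `1 + A` is the sum of the principal minors of `A`. -/
theorem det_one_add_eq_sum_minors {R : Type*} [CommRing R] (A : Matrix ι ι R) :
    (1 + A).det = ∑ S : Finset ι, (A.submatrix (fun k : {x // x ∈ S} => k.1) fun k => k.1).det := by
  have h := (Matrix.detRowAlternating (n := ι) (R := R)).toMultilinearMap.map_add_univ A.row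
    (1 : Matrix ι ι R).row
  have h' : (1 + A).det = Matrix.detRowAlternating (A.row + (1 : Matrix ι ι R).row) := by
    rw [add_comm]; rfl
  rw [h']
  refine h.trans (Finset.sum_congr rfl fun S _ => ?_)
  exact Matrix.det_piecewise_one_eq_submatrix_det A S

theorem cauchyTau_eq_sum (x p q : ι → ℂ) :
    cauchyTau x p q = ∑ S : Finset ι, (∏ k ∈ S, x k) *
      Matrix.det (Matrix.of fun k l : {x // x ∈ S} => 1 / (p k - q l)) := by
  rw [cauchyTau, det_one_add_eq_sum_minors]
  refine Finset.sum_congr rfl fun S _ => ?_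
  rw [← Finset.prod_coe_sort S, ← Matrix.det_mul_column]
  congr 1
  ext k l
  simp [cauchyWeighted, div_eq_mul_inv]

/-- Inserting the factors `f_k` into the weights or into the columns gives the same
determinant. -/
theorem det_one_add_of_mul_comm (f : ι → ℂ) (g : ι → ι → ℂ) :
    (1 + Matrix.of fun k l => f k * g k l).det = (1 + Matrix.of fun k l => g k l * f l).det := by
  have h := Matrix.det_one_add_mul_comm (Matrix.diagonal f) (Matrix.of g)
  convert h using 3
  · ext k l; simp [Matrix.diagonal_mul]
  · ext k l; simp [Matrix.mul_diagonal]

/-- One Miwa shift of the weights. -/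
def miwa (p q : ι → ℂ) (a : ℂ) (x : ι → ℂ) : ι → ℂ := fun k => x k * ((a - q k) / (a - p k))

/-- Moving the factor `a - q` from the rows to the columns and writing `a - q_l = (a - p_k) + (p_k -
q_l)` splits off a matrix whose entries do not depend on `l`. -/
theorem cauchyTau_miwa (x p q : ι → ℂ) (a : ℂ) (ha : ∀ k, a - p k ≠ 0)
    (hpq : ∀ k l, p k - q l ≠ 0) :
    cauchyTau (miwa p q a x) p q =
      (1 + cauchyWeighted x p q + Matrix.vecMulVec (fun k => x k / (a - p k)) 1).det := by
  have e1 : cauchyWeighted (miwa p q a x) p q = Matrix.of fun k l =>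
      (a - q k) * (x k / ((a - p k) * (p k - q l))) := by
    ext k l
    have := ha k; have := hpq k l
    simp only [cauchyWeighted, miwa, Matrix.of_apply]
    field_simp
  have e2 : cauchyWeighted x p q + Matrix.vecMulVec (fun k => x k / (a - p k)) 1 =
      Matrix.of fun k l => (x k / ((a - p k) * (p k - q l))) * (a - q l) := by
    ext k l
    have := ha k; have := hpq k l
    simp only [cauchyWeighted, Matrix.of_apply, Matrix.add_apply, Matrix.vecMulVec_apply,
      Pi.one_apply]
    field_simp
    ring
  rw [cauchyTau, add_assoc, e1, e2, det_one_add_of_mul_comm (fun k => a - q k)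
    (fun k l => x k / ((a - p k) * (p k - q l)))]

/-- The same device for two shifts: partial fractions in `p_k` leave the poles at `a` and `b`, each
with a coefficient depending only on `q_l`, hence a correction of rank two. -/
theorem cauchyTau_miwa_miwa (x p q : ι → ℂ) (a b : ℂ) (ha : ∀ k, a - p k ≠ 0)
    (hb : ∀ k, b - p k ≠ 0) (hab : b - a ≠ 0) (hpq : ∀ k l, p k - q l ≠ 0) :
    cauchyTau (miwa p q a (miwa p q b x)) p q =
      (1 + cauchyWeighted x p q +
        (Matrix.of fun k => ![x k / (a - p k), x k / (b - p k)] : Matrix ι (Fin 2) ℂ) *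
        (Matrix.of ![fun l => (b - q l) / (b - a), fun l => -(a - q l) / (b - a)] :
          Matrix (Fin 2) ι ℂ)).det := by
  have e1 : cauchyWeighted (miwa p q a (miwa p q b x)) p q = Matrix.of fun k l =>
      ((a - q k) * (b - q k)) * (x k / ((a - p k) * (b - p k) * (p k - q l))) := by
    ext k l
    have := ha k; have := hb k; have := hpq k l
    simp only [cauchyWeighted, miwa, Matrix.of_apply]
    field_simp
  have e2 : cauchyWeighted x p q +
        (Matrix.of fun k => ![x k / (a - p k), x k / (b - p k)] : Matrix ι (Fin 2) ℂ) *
        (Matrix.of ![fun l => (b - q l) / (b - a), fun l => -(a - q l) / (b - a)] :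
          Matrix (Fin 2) ι ℂ) =
      Matrix.of fun k l =>
        (x k / ((a - p k) * (b - p k) * (p k - q l))) * ((a - q l) * (b - q l)) := by
    ext k l
    have := ha k; have := hb k; have := hpq k l
    simp only [cauchyWeighted, Matrix.of_apply, Matrix.add_apply, Matrix.mul_apply,
      Fin.sum_univ_two, Matrix.cons_val_zero, Matrix.cons_val_one]
    field_simp
    ring
  rw [cauchyTau, add_assoc, e1, e2, det_one_add_of_mul_comm (fun k => (a - q k) * (b - q k))
    (fun k l => x k / ((a - p k) * (b - p k) * (p k - q l)))]

/-- The pairing `∑_l w_l (B⁻¹ u)_l` entering the perturbed determinants. -/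
def invPairing (B : Matrix ι ι ℂ) (w u : ι → ℂ) : ℂ := w ⬝ᵥ (B⁻¹.mulVec u)

theorem det_add_vecMulVec_one (B : Matrix ι ι ℂ) (hB : IsUnit B.det) (u : ι → ℂ) :
    (B + Matrix.vecMulVec u 1).det = B.det * (1 + invPairing B 1 u) := by
  rw [Matrix.vecMulVec_eq Unit, Matrix.det_add_replicateCol_mul_replicateRow hB]
  congr 1
  rw [Matrix.det_unique, Matrix.mul_assoc]
  simp [Matrix.mul_apply, invPairing, dotProduct, Matrix.mulVec]

/-- With `f_a = 1 + ⟨1, B⁻¹ u_a⟩` and `g_a = a + ⟨q, B⁻¹ u_a⟩`, the right side is `det B * (f_a g_b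
- f_b g_a)`. The factor `b - a` clears the denominators and makes the expression antisymmetric in
the two parameters. -/
theorem det_add_rank_two (B : Matrix ι ι ℂ) (hB : IsUnit B.det) (u v q : ι → ℂ) (a b : ℂ)
    (hab : b - a ≠ 0) :
    (b - a) * (B + (Matrix.of fun k => ![u k, v k] : Matrix ι (Fin 2) ℂ) *
        (Matrix.of ![fun l => (b - q l) / (b - a), fun l => -(a - q l) / (b - a)] :
          Matrix (Fin 2) ι ℂ)).det =
      B.det * ((1 + invPairing B 1 u) * (b + invPairing B q v) -
        (1 + invPairing B 1 v) * (a + invPairing B q u)) := by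
  have key : ∀ (c d : ℂ) (w : ι → ℂ),
      ∑ l, ((c - q l) / d) * (B⁻¹.mulVec w) l =
        (c * invPairing B 1 w - invPairing B q w) / d := by
    intro c d w
    simp only [invPairing, dotProduct, Pi.one_apply, one_mul]
    rw [Finset.mul_sum, ← Finset.sum_sub_distrib, Finset.sum_div]
    refine Finset.sum_congr rfl fun l _ => ?_
    ring
  have key2 : ∀ (c d : ℂ) (w : ι → ℂ),
      ∑ l, (-(c - q l) / d) * (B⁻¹.mulVec w) l =
        -(c * invPairing B 1 w - invPairing B q w) / d := by
    intro c d w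
    rw [neg_div, ← key, ← Finset.sum_neg_distrib]
    refine Finset.sum_congr rfl fun l _ => ?_
    ring
  rw [Matrix.det_add_mul _ _ hB, Matrix.det_fin_two]
  have e : ∀ (r : Fin 2) (s : Fin 2) (V : Matrix (Fin 2) ι ℂ) (U : Matrix ι (Fin 2) ℂ),
      ((1 + V * B⁻¹ * U : Matrix (Fin 2) (Fin 2) ℂ)) r s = (1 : Matrix (Fin 2) (Fin 2) ℂ) r s +
        ∑ l, V r l * (B⁻¹.mulVec (fun k => U k s)) l := by
    intro r s V U
    rw [Matrix.mul_assoc]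
    simp only [Matrix.add_apply, Matrix.mul_apply, Matrix.mulVec, dotProduct]
  rw [e, e, e, e]
  simp only [Matrix.of_apply, Matrix.cons_val_zero, Matrix.cons_val_one, key, key2,
    Matrix.one_apply_eq, Matrix.one_apply_ne (zero_ne_one : (0 : Fin 2) ≠ 1),
    Matrix.one_apply_ne (one_ne_zero : (1 : Fin 2) ≠ 0)]
  field_simp
  ring

/-- A single shift gives `det B * f_a`, a double shift `det B * (f_a g_b - f_b g_a)`. The cyclic sum
of `f_a (f_b g_c - f_c g_b)` is a determinant with the row `f` repeated. -/
theorem cauchyTau_bilinear_of_isUnit (x p q : ι → ℂ) (a b c : ℂ) (ha : ∀ k, a - p k ≠ 0)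
    (hb : ∀ k, b - p k ≠ 0) (hc : ∀ k, c - p k ≠ 0) (hpq : ∀ k l, p k - q l ≠ 0)
    (hab : b - a ≠ 0) (hbc : c - b ≠ 0) (hca : a - c ≠ 0)
    (hB : IsUnit (1 + cauchyWeighted x p q).det) :
    (b - c) * cauchyTau (miwa p q a x) p q * cauchyTau (miwa p q b (miwa p q c x)) p q +
      (c - a) * cauchyTau (miwa p q b x) p q * cauchyTau (miwa p q c (miwa p q a x)) p q +
      (a - b) * cauchyTau (miwa p q c x) p q * cauchyTau (miwa p q a (miwa p q b x)) p q = 0 := by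
  have h1 := fun a ha => (cauchyTau_miwa x p q a ha hpq).trans (det_add_vecMulVec_one _ hB _)
  have h2 : ∀ a b (_ : ∀ k, a - p k ≠ 0) (_ : ∀ k, b - p k ≠ 0) (_ : b - a ≠ 0), _ :=
    fun a b ha hb hab => (congrArg ((b - a) * ·) (cauchyTau_miwa_miwa x p q a b ha hb hab hpq)).trans
      (det_add_rank_two _ hB _ _ q a b hab)
  have hA := h2 a b ha hb hab
  have hB' := h2 b c hb hc hbc
  have hC := h2 c a hc ha hca
  rw [h1 a ha, h1 b hb, h1 c hc]
  linear_combination (-(1 + cauchyWeighted x p q).det *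
      (1 + invPairing (1 + cauchyWeighted x p q) 1 fun k => x k / (a - p k))) * hB' +
    (-(1 + cauchyWeighted x p q).det *
      (1 + invPairing (1 + cauchyWeighted x p q) 1 fun k => x k / (b - p k))) * hC +
    (-(1 + cauchyWeighted x p q).det *
      (1 + invPairing (1 + cauchyWeighted x p q) 1 fun k => x k / (c - p k))) * hA

theorem continuous_cauchyTau_smul (x p q : ι → ℂ) :
    Continuous fun z : ℂ => cauchyTau (fun k => z * x k) p q := by
  unfold cauchyTau cauchyWeighted
  refine Continuous.matrix_det ?_
  refine continuous_const.add (continuous_matrix fun k l => ?_)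
  simp only [Matrix.of_apply]
  fun_prop

theorem finite_det_one_add_smul_eq_zero (A : Matrix ι ι ℂ) :
    {z : ℂ | (1 + z • A).det = 0}.Finite := by
  have e : ∀ z, (1 + (Polynomial.X : Polynomial ℂ) • A.map Polynomial.C).det.eval z
      = (1 + z • A).det := by
    intro z
    rw [← Polynomial.coe_evalRingHom, RingHom.map_det]
    congr 1
    ext k l
    rcases eq_or_ne k l with rfl | h
    · simp only [RingHom.mapMatrix_apply, Matrix.map_apply, Matrix.add_apply, Matrix.smul_apply,
        smul_eq_mul, Matrix.one_apply_eq, Polynomial.coe_evalRingHom, Polynomial.eval_add,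
        Polynomial.eval_mul, Polynomial.eval_X, Polynomial.eval_C, Polynomial.eval_one]
    · simp only [RingHom.mapMatrix_apply, Matrix.map_apply, Matrix.add_apply, Matrix.smul_apply,
        smul_eq_mul, Matrix.one_apply_ne h, Polynomial.coe_evalRingHom, Polynomial.eval_add,
        Polynomial.eval_mul, Polynomial.eval_X, Polynomial.eval_C, Polynomial.eval_zero]
  have h0 : (1 + (Polynomial.X : Polynomial ℂ) • A.map Polynomial.C).det ≠ 0 := by
    intro h
    have := e 0
    rw [h] at this
    simp at this
  refine (Polynomial.rootSet_finite (1 + (Polynomial.X : Polynomial ℂ) • A.map Polynomial.C).det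
    ℂ).subset fun z hz => ?_
  rw [Polynomial.mem_rootSet]
  exact ⟨h0, by rw [Polynomial.coe_aeval_eq_eval, e]; exact hz⟩

/-- The Hirota-Miwa equation for the Cauchy determinants. -/
theorem cauchyTau_bilinear (x p q : ι → ℂ) (a b c : ℂ) (ha : ∀ k, a - p k ≠ 0)
    (hb : ∀ k, b - p k ≠ 0) (hc : ∀ k, c - p k ≠ 0) (hpq : ∀ k l, p k - q l ≠ 0)
    (hbc : c - b ≠ 0) (hca : a - c ≠ 0) :
    (b - c) * cauchyTau (miwa p q a x) p q * cauchyTau (miwa p q b (miwa p q c x)) p q +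
      (c - a) * cauchyTau (miwa p q b x) p q * cauchyTau (miwa p q c (miwa p q a x)) p q +
      (a - b) * cauchyTau (miwa p q c x) p q * cauchyTau (miwa p q a (miwa p q b x)) p q = 0 := by
  -- The parameters `a` and `b` coincide whenever `κ t = θ n`, so this case has to be covered; the
  -- third term then drops out and the other two cancel.
  by_cases hab : b - a = 0
  · obtain rfl : b = a := sub_eq_zero.mp hab
    have : miwa p q b (miwa p q c x) = miwa p q c (miwa p q b x) := by
      ext k; simp only [miwa]; ring
    rw [this]; ring
  -- Invertibility is removed by density: after scaling the weights by `z`, both sides are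
  -- continuous in `z`, and `det (1 + z A)` is a polynomial with value 1 at 0, so it vanishes only
  -- at finitely many `z`. The claim is the value at `z = 1`.
  · have hsm : ∀ (z : ℂ) (a : ℂ) (y : ι → ℂ), miwa p q a (fun k => z * y k) =
        fun k => z * miwa p q a y k := by
      intro z a y; ext k; simp only [miwa]; ring
    have hd := Set.Countable.dense_compl ℂ
      (finite_det_one_add_smul_eq_zero (cauchyWeighted x p q)).countable
    have h := Continuous.ext_on hd
      (f := fun z : ℂ => (b - c) * cauchyTau (fun k => z * miwa p q a x k) p q *
          cauchyTau (fun k => z * miwa p q b (miwa p q c x) k) p q +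
        (c - a) * cauchyTau (fun k => z * miwa p q b x k) p q *
          cauchyTau (fun k => z * miwa p q c (miwa p q a x) k) p q +
        (a - b) * cauchyTau (fun k => z * miwa p q c x k) p q *
          cauchyTau (fun k => z * miwa p q a (miwa p q b x) k) p q) (g := fun _ => 0)
      (by
        have := continuous_cauchyTau_smul (ι := ι)
        fun_prop) continuous_const (by
        intro z hz
        simp only
        have := cauchyTau_bilinear_of_isUnit (fun k => z * x k) p q a b c ha hb hc hpq hab hbc hca
          (by
            have e : cauchyWeighted (fun k => z * x k) p q = z • cauchyWeighted x p q := by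
              ext k l; simp [cauchyWeighted, mul_div_assoc]
            rw [e]; exact isUnit_iff_ne_zero.mpr hz)
        simpa only [hsm] using this)
    have := congrFun h 1
    simpa using this

end Cauchy

/-! ### Soliton τ-functions solve the nonautonomous discrete KP equation -/

theorem Icc_one_succ_of_nonneg {n : ℤ} (h : 0 ≤ n) :
    Finset.Icc 1 (n + 1) = insert (n + 1) (Finset.Icc 1 n) := by
  ext x; simp only [Finset.mem_insert, Finset.mem_Icc]; omega

theorem Icc_succ_zero_of_neg {n : ℤ} (h : n < 0) :
    Finset.Icc (n + 1) 0 = insert (n + 1) (Finset.Icc (n + 1 + 1) 0) := by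
  ext x; simp only [Finset.mem_insert, Finset.mem_Icc]; omega

theorem dirProd_succ (X : ℤ → ℂ) (hX : ∀ k, X k ≠ 0) (n : ℤ) :
    dirProd X (n + 1) = dirProd X n * X (n + 1) := by
  rcases lt_or_ge n 0 with h | h
  · rw [dirProd, dirProd, Icc_succ_zero_of_neg h, Finset.prod_insert (by simp),
      Finset.Icc_eq_empty (by omega : ¬ (1 : ℤ) ≤ n), Finset.Icc_eq_empty
        (by omega : ¬ (1 : ℤ) ≤ n + 1)]
    have := hX (n + 1)
    field_simp
  · rw [dirProd, dirProd, Icc_one_succ_of_nonneg h, Finset.prod_insert (by simp),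
      Finset.Icc_eq_empty (by omega : ¬ n + 1 ≤ (0 : ℤ)), Finset.Icc_eq_empty
        (by omega : ¬ n + 1 + 1 ≤ (0 : ℤ))]
    ring

theorem dirSum_succ (X : ℤ → ℤ) (n : ℤ) : dirSum X (n + 1) = dirSum X n + X (n + 1) := by
  rcases lt_or_ge n 0 with h | h
  · rw [dirSum, dirSum, Icc_succ_zero_of_neg h, Finset.sum_insert (by simp),
      Finset.Icc_eq_empty (by omega : ¬ (1 : ℤ) ≤ n), Finset.Icc_eq_empty
        (by omega : ¬ (1 : ℤ) ≤ n + 1)]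
    ring
  · rw [dirSum, dirSum, Icc_one_succ_of_nonneg h, Finset.sum_insert (by simp),
      Finset.Icc_eq_empty (by omega : ¬ n + 1 ≤ (0 : ℤ)), Finset.Icc_eq_empty
        (by omega : ¬ n + 1 + 1 ≤ (0 : ℤ))]
    ring

theorem dirProd_ne_zero (X : ℤ → ℂ) (hX : ∀ k, X k ≠ 0) (n : ℤ) : dirProd X n ≠ 0 :=
  mul_ne_zero (Finset.prod_ne_zero_iff.mpr fun k _ => hX k)
    (Finset.prod_ne_zero_iff.mpr fun k _ => inv_ne_zero (hX k))

/-- `p` is none of the parameters of the evolution. -/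
structure OffParams (a b c : ℤ → ℂ) (p : ℂ) : Prop where
  ha : ∀ k, a k - p ≠ 0
  hb : ∀ k, b k - p ≠ 0
  hc : ∀ k, c k - p ≠ 0

section planeWave

variable {a b c : ℤ → ℂ} {p : ℂ}

theorem OffParams.hc' (h : OffParams a b c p) (k : ℤ) : p - c k ≠ 0 := by
  rw [← neg_sub]; exact neg_ne_zero.mpr (h.hc k)

theorem OffParams.planeWave_ne_zero (h : OffParams a b c p) (t n j : ℤ) :
    planeWave a b c p t n j ≠ 0 :=
  mul_ne_zero (mul_ne_zero (dirProd_ne_zero _ h.ha t)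
    (dirProd_ne_zero _ (fun k => inv_ne_zero (h.hb k)) n))
    (dirProd_ne_zero _ (fun k => inv_ne_zero (h.hc' k)) j)

theorem OffParams.planeWave_succ_t (h : OffParams a b c p) (t n j : ℤ) :
    planeWave a b c p (t + 1) n j = planeWave a b c p t n j * (a (t + 1) - p) := by
  rw [planeWave, planeWave, dirProd_succ _ h.ha]; ring

theorem OffParams.planeWave_succ_n (h : OffParams a b c p) (t n j : ℤ) :
    planeWave a b c p t (n + 1) j = planeWave a b c p t n j * (b (n + 1) - p)⁻¹ := by
  rw [planeWave, planeWave, dirProd_succ _ (fun k => inv_ne_zero (h.hb k))]; ring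

theorem OffParams.planeWave_succ_j (h : OffParams a b c p) (t n j : ℤ) :
    planeWave a b c p t n (j + 1) = planeWave a b c p t n j * (p - c (j + 1))⁻¹ := by
  rw [planeWave, planeWave, dirProd_succ _ (fun k => inv_ne_zero (h.hc' k))]; ring

end planeWave

section soliton

variable {ι : Type} [Fintype ι] [DecidableEq ι]

/-- The weight `α_k E(p_k) / E(q_k)`. -/
def solitonWeight (a b c : ℤ → ℂ) (α p q : ι → ℂ) (t n j : ℤ) : ι → ℂ :=
  fun k => α k * (planeWave a b c (p k) t n j / planeWave a b c (q k) t n j)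

theorem solitonTau_eq_cauchyTau (a b c : ℤ → ℂ) (α p q : ι → ℂ) (t n j : ℤ) :
    solitonTau a b c α p q t n j = cauchyTau (solitonWeight a b c α p q t n j) p q :=
  (cauchyTau_eq_sum _ p q).symm

variable {a b c : ℤ → ℂ} {α p q : ι → ℂ}

theorem solitonWeight_of_succ_t (hp : ∀ k, OffParams a b c (p k)) (hq : ∀ k, OffParams a b c (q k))
    (t n j : ℤ) : solitonWeight a b c α p q t n j =
      miwa p q (a (t + 1)) (solitonWeight a b c α p q (t + 1) n j) := by
  ext k
  simp only [solitonWeight, miwa, (hp k).planeWave_succ_t, (hq k).planeWave_succ_t]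
  have := (hp k).ha (t + 1); have := (hq k).ha (t + 1); have := (hq k).planeWave_ne_zero t n j
  field_simp

theorem solitonWeight_succ_n (hp : ∀ k, OffParams a b c (p k)) (hq : ∀ k, OffParams a b c (q k))
    (t n j : ℤ) : solitonWeight a b c α p q t (n + 1) j =
      miwa p q (b (n + 1)) (solitonWeight a b c α p q t n j) := by
  ext k
  simp only [solitonWeight, miwa, (hp k).planeWave_succ_n, (hq k).planeWave_succ_n]
  have := (hp k).hb (n + 1); have := (hq k).hb (n + 1); have := (hq k).planeWave_ne_zero t n j
  field_simp

theorem solitonWeight_succ_j (hp : ∀ k, OffParams a b c (p k)) (hq : ∀ k, OffParams a b c (q k))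
    (t n j : ℤ) : solitonWeight a b c α p q t n (j + 1) =
      miwa p q (c (j + 1)) (solitonWeight a b c α p q t n j) := by
  ext k
  simp only [solitonWeight, miwa, (hp k).planeWave_succ_j, (hq k).planeWave_succ_j]
  have := (hp k).hc (j + 1); have := (hq k).hc (j + 1); have := (hq k).planeWave_ne_zero t n j
  have := (hp k).hc' (j + 1); have := (hq k).hc' (j + 1)
  field_simp
  rw [← neg_sub (q k), ← neg_sub (p k)]; ring

/-- The base point is `(t + 1, n, j)`: `E(p)` has `a - p` in the numerator but `b - p` and `p - c`
in the denominator, so from there the three Miwa shifts lower `t`, raise `n` and raise `j`. -/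
theorem ndKP_solitonTau (hp : ∀ k, OffParams a b c (p k)) (hq : ∀ k, OffParams a b c (q k))
    (hpq : ∀ k l, p k - q l ≠ 0) (hac : ∀ t j, a t - c j ≠ 0) (hbc : ∀ n j, c j - b n ≠ 0) :
    NdKP a b c (solitonTau a b c α p q) := by
  intro t n j
  simp only [solitonTau_eq_cauchyTau]
  have h := cauchyTau_bilinear (solitonWeight a b c α p q (t + 1) n j) p q (a (t + 1)) (b (n + 1))
    (c (j + 1)) (fun k => (hp k).ha _) (fun k => (hp k).hb _) (fun k => (hp k).hc _) hpq
    (hbc _ _) (hac _ _)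
  have e : ∀ a b x, miwa p q a (miwa p q b x) = miwa p q b (miwa p q a x) := by
    intro a b x; ext k; simp only [miwa]; ring
  rw [solitonWeight_of_succ_t hp hq t n j, solitonWeight_succ_n hp hq (t + 1) n (j + 1),
    solitonWeight_succ_j hp hq (t + 1) n j, solitonWeight_succ_n hp hq (t + 1) n j,
    solitonWeight_of_succ_t hp hq t n (j + 1), solitonWeight_succ_j hp hq (t + 1) n j,
    solitonWeight_of_succ_t hp hq t (n + 1) j, solitonWeight_succ_n hp hq (t + 1) n j]
  rw [e (c (j + 1))] at h
  linear_combination h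

end soliton

/-! ### The periodic parameters `c` -/

theorem cParam_of_mod_eq {M : ℕ} {j : ℤ} (h : j % ((M : ℤ) + 1) = 1) : cParam M j = 1 := by
  simp [cParam, h]

theorem cParam_of_mod_ne {M : ℕ} {j : ℤ} (h : j % ((M : ℤ) + 1) ≠ 1) : cParam M j = 0 := by
  simp [cParam, h]

theorem cParam_eq_zero_or_one (M : ℕ) (j : ℤ) : cParam M j = 0 ∨ cParam M j = 1 := by
  unfold cParam; split_ifs <;> simp

theorem cParam_one {M : ℕ} [NeZero M] : cParam M 1 = 1 := by
  refine cParam_of_mod_eq (Int.emod_eq_of_lt (by norm_num) ?_)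
  have := NeZero.pos M; omega

theorem cParam_eq_zero {M : ℕ} {j : ℤ} (h : 2 ≤ j) (h' : j ≤ M + 1) : cParam M j = 0 := by
  refine cParam_of_mod_ne ?_
  rcases eq_or_lt_of_le h' with rfl | h'
  · simp
  · rw [Int.emod_eq_of_lt (by omega) h']; omega

theorem cParam_add_period (M : ℕ) (j : ℤ) : cParam M (j + (M + 1)) = cParam M j := by
  simp [cParam]

/-- A function with the recursion `g (j + 1) = g j * h (j + 1)`, where `h` has the period `M + 1`
and product `1` over one period, has the period `M + 1`. -/
theorem periodic_of_prod_eq_one {g h : ℤ → ℂ} {M : ℕ} (hg : ∀ j, g (j + 1) = g j * h (j + 1))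
    (hh : ∀ j, h (j + (M + 1)) = h j)
    (h1 : ∏ k ∈ Finset.range (M + 1), h (k + 1) = 1) (j : ℤ) : g (j + M + 1) = g j := by
  have step : ∀ j (m : ℕ), g (j + m) = g j * ∏ k ∈ Finset.range m, h (j + (k + 1)) := by
    intro j m
    induction m with
    | zero => simp
    | succ m ih =>
      rw [Finset.prod_range_succ, ← mul_assoc, ← ih]
      have := hg (j + m)
      push_cast
      rw [← add_assoc, this, add_assoc]
  -- The product over a window of one full period does not depend on where the window starts: a unit
  -- translation replaces one factor by its periodic copy.
  have key : ∀ j : ℤ, ∏ k ∈ Finset.range (M + 1), h (j + (k + 1)) = 1 := by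
    have succ : ∀ j : ℤ, ∏ k ∈ Finset.range (M + 1), h (j + 1 + (k + 1)) =
        ∏ k ∈ Finset.range (M + 1), h (j + (k + 1)) := by
      intro j
      rw [Finset.prod_range_succ, Finset.prod_range_succ']
      congr 1
      · refine Finset.prod_congr rfl fun k _ => ?_
        congr 1; push_cast; ring
      · rw [← hh (j + ((0 : ℕ) + 1))]; congr 1
    intro j
    induction j using Int.induction_on with
    | zero => simpa using h1
    | succ i ih => rw [succ, ih]
    | pred i ih => rw [← succ]; simpa using ih
  have := step j (M + 1)
  rw [key, mul_one] at this
  rw [← this]; congr 1; push_cast; ring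

/-! ### Reduction of the family τ-function to moment determinants -/

/-- For weights on a product index set with `p` depending only on the first index, the Cauchy
determinant reduces to the first index set. -/
theorem cauchyTau_prod {N M : ℕ} (x q : Fin N → Fin M → ℂ) (p : Fin N → ℂ) :
    cauchyTau (fun k : Fin N × Fin M => x k.1 k.2) (fun k => p k.1) (fun k => q k.1 k.2) =
      (1 + Matrix.of fun i i' : Fin N => ∑ m, x i' m / (p i - q i' m)).det := by
  -- The Cauchy matrix factors through `Fin N`, because its row `(i, m)` depends on `m` only through
  -- the weight; exchanging the two factors gives a matrix of size `N`.
  have h := Matrix.det_one_add_mul_comm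
    (Matrix.of fun (k : Fin N × Fin M) (i : Fin N) => if k.1 = i then x k.1 k.2 else 0)
    (Matrix.of fun (i : Fin N) (k : Fin N × Fin M) => 1 / (p i - q k.1 k.2))
  have e1 : (Matrix.of fun (k : Fin N × Fin M) (i : Fin N) => if k.1 = i then x k.1 k.2 else 0) *
      (Matrix.of fun (i : Fin N) (k : Fin N × Fin M) => 1 / (p i - q k.1 k.2)) =
      cauchyWeighted (fun k : Fin N × Fin M => x k.1 k.2) (fun k => p k.1)
        (fun k => q k.1 k.2) := by
    ext k l
    simp [Matrix.mul_apply, cauchyWeighted, div_eq_mul_inv]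
  have e2 : (Matrix.of fun (i : Fin N) (k : Fin N × Fin M) => 1 / (p i - q k.1 k.2)) *
      (Matrix.of fun (k : Fin N × Fin M) (i : Fin N) => if k.1 = i then x k.1 k.2 else 0) =
      Matrix.of fun i i' : Fin N => ∑ m, x i' m / (p i - q i' m) := by
    ext i i'
    simp only [Matrix.mul_apply, Matrix.of_apply, Fintype.sum_prod_type]
    rw [Finset.sum_eq_single i' (fun b _ hb => by simp [hb]) (by simp)]
    refine Finset.sum_congr rfl fun m _ => ?_
    simp [div_eq_mul_inv, mul_comm]
  rw [e1, e2] at h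
  exact h

/-- The determinant of sums of simple fractions is a Vandermonde factor times a determinant of
moments. -/
theorem det_sum_div_sub {r M : ℕ} (P : Fin r → ℂ) (hP : Function.Injective P)
    (x q : Fin r → Fin M → ℂ) (hq : ∀ i l m, P i - q l m ≠ 0) :
    (Matrix.of fun k l : Fin r => ∑ m, x l m / (P k - q l m)).det =
      (∏ k, ∏ l ∈ Finset.Ioi k, (P k - P l)) *
        (Matrix.of fun k l : Fin r => ∑ m, x l m / (∏ i, (P i - q l m)) * q l m ^ (k : ℕ)).det := by
  -- Over the common denominator `∏ i, (P i - q)` the fraction `1 / (P k - q)` has the unnormalized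
  -- Lagrange polynomial `c k` as numerator. Its coefficients form the matrix `C`, which separates
  -- off the moments.
  let c : Fin r → Polynomial ℂ := fun k =>
    ∏ i ∈ ({k}ᶜ : Finset (Fin r)), (Polynomial.C (P i) - Polynomial.X)
  have hdeg : ∀ k, (c k).natDegree < r := by
    intro k
    have h1 : (c k).natDegree ≤ ∑ i ∈ ({k}ᶜ : Finset (Fin r)), 1 := by
      refine (Polynomial.natDegree_prod_le _ _).trans (Finset.sum_le_sum fun i _ => ?_)
      refine (Polynomial.natDegree_sub_le _ _).trans ?_
      simp
    have h2 : ∑ i ∈ ({k}ᶜ : Finset (Fin r)), 1 = r - 1 := by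
      rw [Finset.sum_const, smul_eq_mul, mul_one, Finset.card_compl]; simp
    have := k.pos
    omega
  have heval : ∀ k z, (c k).eval z = ∏ i ∈ ({k}ᶜ : Finset (Fin r)), (P i - z) := by
    intro k z; simp [c, Polynomial.eval_prod]
  have hsum : ∀ k z, (c k).eval z = ∑ j : Fin r, (c k).coeff j * z ^ (j : ℕ) := by
    intro k z
    rw [Polynomial.eval_eq_sum_range' (hdeg k), Finset.sum_range]
  let C : Matrix (Fin r) (Fin r) ℂ := Matrix.of fun k j => (c k).coeff j
  have hfac : (Matrix.of fun k l : Fin r => ∑ m, x l m / (P k - q l m)) =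
      C * Matrix.of fun k l : Fin r => ∑ m, x l m / (∏ i, (P i - q l m)) * q l m ^ (k : ℕ) := by
    ext k l
    simp only [Matrix.mul_apply, Matrix.of_apply, C, Finset.mul_sum]
    rw [Finset.sum_comm]
    refine Finset.sum_congr rfl fun m _ => ?_
    have e : ∑ j : Fin r, (c k).coeff j * (x l m / (∏ i, (P i - q l m)) * q l m ^ (j : ℕ)) =
        x l m / (∏ i, (P i - q l m)) * (c k).eval (q l m) := by
      rw [hsum, Finset.mul_sum]
      exact Finset.sum_congr rfl fun j _ => by ring
    rw [e, heval, ← Finset.prod_mul_prod_compl {k} fun i => P i - q l m, Finset.prod_singleton]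
    have h1 := hq k l m
    have h2 : ∏ i ∈ ({k}ᶜ : Finset (Fin r)), (P i - q l m) ≠ 0 :=
      Finset.prod_ne_zero_iff.mpr fun i _ => hq i l m
    field_simp
  -- Since `c k` vanishes at every `P l` with `l ≠ k`, multiplying `C` by the transposed Vandermonde
  -- matrix gives a diagonal matrix. Its determinant runs over all ordered pairs of distinct
  -- indices, and the Vandermonde determinant accounts for one half of them.
  have hC : C.det = ∏ k, ∏ l ∈ Finset.Ioi k, (P k - P l) := by
    have h1 : C * (Matrix.vandermonde P).transpose =
        Matrix.diagonal fun k => ∏ i ∈ ({k}ᶜ : Finset (Fin r)), (P i - P k) := by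
      ext k l
      have h2 : (C * (Matrix.vandermonde P).transpose) k l = (c k).eval (P l) := by
        rw [hsum]
        simp [Matrix.mul_apply, C, Matrix.vandermonde]
      rw [h2, heval]
      rcases eq_or_ne k l with rfl | h
      · rw [Matrix.diagonal_apply_eq]
      · rw [Matrix.diagonal_apply_ne _ h]
        exact Finset.prod_eq_zero (i := l) (by simp [h.symm]) (sub_self _)
    have h2 := congrArg Matrix.det h1
    rw [Matrix.det_mul, Matrix.det_transpose, Matrix.det_diagonal, Matrix.det_vandermonde,
      ← Finset.prod_prod_Ioi_mul_eq_prod_prod_off_diag (fun j i => P j - P i)] at h2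
    have h3 : ∏ i, ∏ j ∈ Finset.Ioi i, (P j - P i) ≠ 0 :=
      Finset.prod_ne_zero_iff.mpr fun i _ => Finset.prod_ne_zero_iff.mpr fun j hj =>
        sub_ne_zero.mpr fun h => (Finset.mem_Ioi.mp hj).ne' (hP h)
    refine mul_right_cancel₀ h3 (h2.trans ?_)
    rw [← Finset.prod_mul_distrib]
    refine Finset.prod_congr rfl fun i _ => ?_
    rw [← Finset.prod_mul_distrib]
    exact Finset.prod_congr rfl fun j _ => mul_comm _ _
  rw [hfac, Matrix.det_mul, hC]

/-- The family τ-function as a sum over the subsets of the first index set. -/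
theorem cauchyTau_prod_eq_sum {N M : ℕ} (x q : Fin N → Fin M → ℂ) (p : Fin N → ℂ)
    (hp : Function.Injective p) (hq : ∀ i l m, p i - q l m ≠ 0) :
    cauchyTau (fun k : Fin N × Fin M => x k.1 k.2) (fun k => p k.1) (fun k => q k.1 k.2) =
      ∑ S : Finset (Fin N),
        (∏ k : Fin S.card, ∏ l ∈ Finset.Ioi k,
          (p (S.orderEmbOfFin rfl k) - p (S.orderEmbOfFin rfl l))) *
        (Matrix.of fun k l : Fin S.card => ∑ m, x (S.orderEmbOfFin rfl l) m /
          (∏ i, (p (S.orderEmbOfFin rfl i) - q (S.orderEmbOfFin rfl l) m)) *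
            q (S.orderEmbOfFin rfl l) m ^ (k : ℕ)).det := by
  rw [cauchyTau_prod, det_one_add_eq_sum_minors]
  refine Finset.sum_congr rfl fun S _ => ?_
  rw [← det_sum_div_sub (fun k => p (S.orderEmbOfFin rfl k))
    (hp.comp (S.orderEmbOfFin rfl).injective) (fun l => x (S.orderEmbOfFin rfl l))
    (fun l => q (S.orderEmbOfFin rfl l)) (fun i l m => hq _ _ _),
    ← Matrix.det_submatrix_equiv_self (S.orderIsoOfFin rfl).toEquiv]
  rfl

/-! ### Asymptotic scales -/

/-- The scale `ε ^ w * e ^ (r / ε)`. -/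
def scale (r w ε : ℝ) : ℝ := Real.exp (r / ε + w * Real.log ε)

theorem scale_pos (r w ε : ℝ) : 0 < scale r w ε := Real.exp_pos _

theorem scale_ne_zero (r w ε : ℝ) : scale r w ε ≠ 0 := (scale_pos r w ε).ne'

theorem scale_zero (ε : ℝ) : scale 0 0 ε = 1 := by simp [scale]

theorem scale_add (r r' w w' ε : ℝ) :
    scale (r + r') (w + w') ε = scale r w ε * scale r' w' ε := by
  rw [scale, scale, scale, ← Real.exp_add]; congr 1; ring

theorem scale_neg (r w ε : ℝ) : scale (-r) (-w) ε = (scale r w ε)⁻¹ := by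
  rw [scale, scale, ← Real.exp_neg]; congr 1; ring

theorem scale_sub (r r' w w' ε : ℝ) :
    scale (r - r') (w - w') ε = scale r w ε / scale r' w' ε := by
  rw [sub_eq_add_neg, sub_eq_add_neg, scale_add, scale_neg, div_eq_mul_inv]

/-- Equality `r = 0` is allowed: the power of `ε` alone then forces decay. This is how terms of
equal exponential rate are separated. -/
theorem tendsto_scale_zero {r w : ℝ} (hr : r ≤ 0) (hw : 0 < w) :
    Tendsto (scale r w) (𝓝[>] 0) (𝓝 0) := by
  refine Real.tendsto_exp_atBot.comp ?_
  have h1 : Tendsto (fun ε : ℝ => w * Real.log ε) (𝓝[>] 0) atBot :=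
    Real.tendsto_log_nhdsGT_zero.const_mul_atBot hw
  refine tendsto_atBot_mono' _ ?_ h1
  filter_upwards [self_mem_nhdsWithin] with ε hε
  have : r / ε ≤ 0 := div_nonpos_of_nonpos_of_nonneg hr (le_of_lt hε)
  linarith

theorem tendsto_scale_zero_of_neg {r w : ℝ} (hr : r < 0) :
    Tendsto (scale r w) (𝓝[>] 0) (𝓝 0) := by
  refine Real.tendsto_exp_atBot.comp ?_
  have h1 : Tendsto (fun ε : ℝ => r + w * (Real.log ε * ε)) (𝓝[>] 0) (𝓝 r) := by
    have := (tendsto_log_mul_rpow_nhdsGT_zero one_pos).const_mul w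
    simpa using this.const_add r
  have h2 : Tendsto (fun ε : ℝ => (r + w * (Real.log ε * ε)) * ε⁻¹) (𝓝[>] 0) atBot :=
    h1.neg_mul_atTop hr tendsto_inv_nhdsGT_zero
  refine h2.congr' ?_
  filter_upwards [self_mem_nhdsWithin] with ε hε
  have : ε ≠ 0 := ne_of_gt hε
  field_simp

theorem tendsto_mul_log_scale (r w : ℝ) :
    Tendsto (fun ε => ε * Real.log (scale r w ε)) (𝓝[>] 0) (𝓝 r) := by
  have h1 : Tendsto (fun ε : ℝ => r + w * (Real.log ε * ε)) (𝓝[>] 0) (𝓝 r) := by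
    have := (tendsto_log_mul_rpow_nhdsGT_zero one_pos).const_mul w
    simpa using this.const_add r
  refine h1.congr' ?_
  filter_upwards [self_mem_nhdsWithin] with ε hε
  have : ε ≠ 0 := ne_of_gt hε
  rw [scale, Real.log_exp]
  field_simp

/-- `f` is asymptotically a positive multiple of a scale. -/
def Asym (f : ℝ → ℝ) (r w : ℝ) : Prop :=
  ∃ c, 0 < c ∧ Tendsto (fun ε => f ε / scale r w ε) (𝓝[>] 0) (𝓝 c)

namespace Asym

variable {f g : ℝ → ℝ} {r r' w w' : ℝ}

theorem congr' (hf : Asym f r w) (h : f =ᶠ[𝓝[>] 0] g) : Asym g r w := by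
  obtain ⟨c, hc, hf⟩ := hf
  exact ⟨c, hc, hf.congr' (h.mono fun ε hε => by simp only [hε])⟩

theorem cast (hf : Asym f r w) (hr : r = r') (hw : w = w') : Asym f r' w' := by
  subst hr hw; exact hf

theorem scale (r w : ℝ) : Asym (scale r w) r w :=
  ⟨1, one_pos, by simp [div_self (scale_ne_zero r w _)]⟩

theorem of_tendsto {c : ℝ} (hc : 0 < c) (hf : Tendsto f (𝓝[>] 0) (𝓝 c)) : Asym f 0 0 :=
  ⟨c, hc, by simpa [scale_zero] using hf⟩

theorem mul (hf : Asym f r w) (hg : Asym g r' w') :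
    Asym (fun ε => f ε * g ε) (r + r') (w + w') := by
  obtain ⟨c, hc, hf⟩ := hf
  obtain ⟨d, hd, hg⟩ := hg
  refine ⟨c * d, mul_pos hc hd, (hf.mul hg).congr fun ε => ?_⟩
  rw [scale_add, mul_div_mul_comm]

theorem inv (hf : Asym f r w) : Asym (fun ε => (f ε)⁻¹) (-r) (-w) := by
  obtain ⟨c, hc, hf⟩ := hf
  refine ⟨c⁻¹, inv_pos.mpr hc, (hf.inv₀ hc.ne').congr fun ε => ?_⟩
  rw [scale_neg, inv_div, inv_div_inv]

theorem prod {ι : Type*} (s : Finset ι) {f : ι → ℝ → ℝ} {r w : ι → ℝ}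
    (h : ∀ i ∈ s, Asym (f i) (r i) (w i)) :
    Asym (fun ε => ∏ i ∈ s, f i ε) (∑ i ∈ s, r i) (∑ i ∈ s, w i) := by
  classical
  induction s using Finset.induction_on with
  | empty => simpa using of_tendsto one_pos tendsto_const_nhds
  | insert i s hi ih =>
    simp only [Finset.prod_insert hi, Finset.sum_insert hi]
    exact (h i (Finset.mem_insert_self i s)).mul
      (ih fun j hj => h j (Finset.mem_insert_of_mem hj))

theorem mul_ratio (hf : Asym f r w) {c : ℝ} (hc : 0 < c)
    (h : Tendsto (fun ε => g ε / f ε) (𝓝[>] 0) (𝓝 c)) (h0 : ∀ᶠ ε in 𝓝[>] 0, f ε ≠ 0) :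
    Asym g r w := by
  refine ((hf.mul (of_tendsto hc h)).congr' ?_).cast (add_zero r) (add_zero w)
  filter_upwards [h0] with ε hε
  exact mul_div_cancel₀ _ hε

theorem eventually_pos (hf : Asym f r w) : ∀ᶠ ε in 𝓝[>] 0, 0 < f ε := by
  obtain ⟨c, hc, hf⟩ := hf
  filter_upwards [hf.eventually (lt_mem_nhds hc)] with ε hε
  exact (div_pos_iff_of_pos_right (scale_pos _ _ _)).mp hε

theorem tendsto_div_scale_zero (hf : Asym f r w)
    (h : Tendsto (AMAutomaton.scale (r - r') (w - w')) (𝓝[>] 0) (𝓝 0)) :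
    Tendsto (fun ε => f ε / AMAutomaton.scale r' w' ε) (𝓝[>] 0) (𝓝 0) := by
  obtain ⟨c, hc, hf⟩ := hf
  have := hf.mul h
  rw [mul_zero] at this
  refine this.congr fun ε => ?_
  have := scale_ne_zero r w ε
  have := scale_ne_zero r' w' ε
  rw [scale_sub]
  field_simp

theorem add_of_isSmall (hf : Asym f r w)
    (hg : Tendsto (fun ε => g ε / AMAutomaton.scale r w ε) (𝓝[>] 0) (𝓝 0)) :
    Asym (fun ε => f ε + g ε) r w := by
  obtain ⟨c, hc, hf⟩ := hf
  refine ⟨c, hc, ?_⟩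
  have := hf.add hg
  rw [add_zero] at this
  exact this.congr fun ε => (add_div _ _ _).symm

theorem tendsto_mul_log (hf : Asym f r w) :
    Tendsto (fun ε => ε * Real.log (f ε)) (𝓝[>] 0) (𝓝 r) := by
  have hpos := hf.eventually_pos
  obtain ⟨c, hc, hf⟩ := hf
  have h0 : Tendsto (fun ε : ℝ => ε) (𝓝[>] 0) (𝓝 0) := tendsto_nhdsWithin_of_tendsto_nhds tendsto_id
  have h1 := (h0.mul (hf.log hc.ne')).add (tendsto_mul_log_scale r w)
  rw [zero_mul, zero_add] at h1
  refine h1.congr' ?_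
  filter_upwards [hpos] with ε hε
  rw [Real.log_div hε.ne' (scale_ne_zero _ _ _)]
  ring

end Asym

/-! ### Ultradiscrete limits -/

/-- `f` is eventually positive with `ε log f → x`. -/
def UdLimit (f : ℝ → ℝ) (x : ℝ) : Prop :=
  (∀ᶠ ε in 𝓝[>] (0 : ℝ), 0 < f ε) ∧ Tendsto (fun ε => ε * Real.log (f ε)) (𝓝[>] 0) (𝓝 x)

theorem Asym.udLimit {f : ℝ → ℝ} {r w : ℝ} (hf : Asym f r w) : UdLimit f r :=
  ⟨hf.eventually_pos, hf.tendsto_mul_log⟩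

namespace UdLimit

variable {f g : ℝ → ℝ} {x y : ℝ}

theorem congr' (hf : UdLimit f x) (h : f =ᶠ[𝓝[>] 0] g) : UdLimit g x :=
  ⟨by filter_upwards [hf.1, h] with ε h1 h2; rwa [← h2],
    hf.2.congr' (h.mono fun ε hε => by simp only [hε])⟩

theorem unique (hf : UdLimit f x) (hg : UdLimit f y) : x = y := tendsto_nhds_unique hf.2 hg.2

theorem mul (hf : UdLimit f x) (hg : UdLimit g y) : UdLimit (fun ε => f ε * g ε) (x + y) := by
  refine ⟨by filter_upwards [hf.1, hg.1] with ε h1 h2; exact mul_pos h1 h2,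
    (hf.2.add hg.2).congr' ?_⟩
  filter_upwards [hf.1, hg.1] with ε h1 h2
  rw [Real.log_mul h1.ne' h2.ne']; ring

/-- Positivity gives `max f g ≤ f + g ≤ 2 * max f g`, and `ε * log 2` tends to 0. -/
theorem add (hf : UdLimit f x) (hg : UdLimit g y) : UdLimit (fun ε => f ε + g ε) (max x y) := by
  have h0 : Tendsto (fun ε : ℝ => ε * Real.log 2) (𝓝[>] 0) (𝓝 0) := by
    have : Tendsto (fun ε : ℝ => ε) (𝓝[>] 0) (𝓝 0) := tendsto_nhdsWithin_of_tendsto_nhds tendsto_id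
    simpa using this.mul_const (Real.log 2)
  have hmax := hf.2.max hg.2
  refine ⟨by filter_upwards [hf.1, hg.1] with ε h1 h2; exact add_pos h1 h2, ?_⟩
  refine tendsto_of_tendsto_of_tendsto_of_le_of_le' hmax
    (by simpa using h0.add hmax) ?_ ?_
  · filter_upwards [hf.1, hg.1, self_mem_nhdsWithin] with ε h1 h2 hε
    have hε' : (0 : ℝ) < ε := hε
    refine max_le ?_ ?_
    · exact mul_le_mul_of_nonneg_left (Real.log_le_log h1 (by linarith)) hε'.le
    · exact mul_le_mul_of_nonneg_left (Real.log_le_log h2 (by linarith)) hε'.le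
  · filter_upwards [hf.1, hg.1, self_mem_nhdsWithin] with ε h1 h2 hε
    have hε' : (0 : ℝ) < ε := hε
    rw [← mul_max_of_nonneg _ _ hε'.le, ← mul_add]
    refine mul_le_mul_of_nonneg_left ?_ hε'.le
    rcases le_total (f ε) (g ε) with h | h
    · refine le_trans ?_ (add_le_add_right (le_max_right _ _) _)
      rw [← Real.log_mul two_ne_zero h2.ne']
      exact Real.log_le_log (add_pos h1 h2) (by linarith)
    · refine le_trans ?_ (add_le_add_right (le_max_left _ _) _)
      rw [← Real.log_mul two_ne_zero h1.ne']
      exact Real.log_le_log (add_pos h1 h2) (by linarith)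

theorem sum {ι : Type*} (s : Finset ι) (hs : s.Nonempty) {f : ι → ℝ → ℝ} {x : ι → ℝ}
    (h : ∀ i ∈ s, UdLimit (f i) (x i)) :
    UdLimit (fun ε => ∑ i ∈ s, f i ε) (s.sup' hs x) := by
  classical
  induction hs using Finset.Nonempty.cons_induction with
  | singleton a => simpa using h a (by simp)
  | cons a s ha hs ih =>
    simp only [Finset.sum_cons, Finset.sup'_cons hs]
    exact (h a (by simp)).add (ih fun j hj => h j (by simp [hj]))

end UdLimit

/-! ### Families of moment sequences -/

/-- The moments `∑ z_m q_m ^ j` are positive, decay at a rate tending to `0`, and are asymptotic to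
the scales `(r j, w j)`. -/
def MomentFamily {M : ℕ} (q z : ℝ → Fin M → ℂ) (r w : ℕ → ℝ) : Prop :=
  ∃ (s : ℝ → ℕ → ℝ) (δ : ℝ → ℝ), Tendsto δ (𝓝[>] 0) (𝓝 0) ∧
    (∀ᶠ ε in 𝓝[>] 0, (∀ j, ∑ m, z ε m * q ε m ^ j = (s ε j : ℂ)) ∧
      ∀ j, 0 < s ε j ∧ s ε (j + 1) ≤ δ ε * s ε j) ∧
    ∀ j, Asym (fun ε => s ε j) (r j) (w j)

namespace MomentFamily

variable {M : ℕ} {q z z' : ℝ → Fin M → ℂ} {r w : ℕ → ℝ}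

theorem congr' (h : MomentFamily q z r w) (hz : ∀ᶠ ε in 𝓝[>] 0, z ε = z' ε) :
    MomentFamily q z' r w := by
  obtain ⟨s, δ, hδ, hs, ha⟩ := h
  refine ⟨s, δ, hδ, ?_, ha⟩
  filter_upwards [hs, hz] with ε h1 h2
  rwa [← h2]

theorem const_mul (h : MomentFamily q z r w) {c : ℝ → ℝ} {ρ ω : ℝ} (hc : Asym c ρ ω) :
    MomentFamily q (fun ε m => c ε * z ε m) (fun j => ρ + r j) (fun j => ω + w j) := by
  obtain ⟨s, δ, hδ, hs, ha⟩ := h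
  refine ⟨fun ε j => c ε * s ε j, δ, hδ, ?_, fun j => hc.mul (ha j)⟩
  filter_upwards [hs, hc.eventually_pos] with ε h1 h2
  refine ⟨fun j => ?_, fun j => ⟨mul_pos h2 (h1.2 j).1, ?_⟩⟩
  · rw [Complex.ofReal_mul, ← h1.1 j, Finset.mul_sum]
    exact Finset.sum_congr rfl fun m _ => by ring
  · have := mul_le_mul_of_nonneg_left (h1.2 j).2 h2.le
    linarith

/-- The new moments are `b s_j - s_{j+1}`. As `s_{j+1} / s_j ≤ δ → 0`, they equal `b s_j` to leading
order. -/
theorem mul_sub (h : MomentFamily q z r w) {b : ℝ → ℝ} {b₀ : ℝ} (hb₀ : 0 < b₀)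
    (hb : Tendsto b (𝓝[>] 0) (𝓝 b₀)) :
    MomentFamily q (fun ε m => z ε m * (b ε - q ε m)) r w := by
  obtain ⟨s, δ, hδ, hs, ha⟩ := h
  have hev : ∀ᶠ ε in 𝓝[>] 0, 0 < b ε ∧ δ ε < b ε / 2 := by
    have h1 := (hb.div_const 2).eventually (lt_mem_nhds (show b₀ / 4 < b₀ / 2 by linarith))
    have h2 := hδ.eventually (gt_mem_nhds (show 0 < b₀ / 4 by linarith))
    filter_upwards [h1, h2] with ε h1 h2
    constructor <;> linarith
  -- The rate doubles: the new moment of index `j + 1` is at most `b δ s_j`, whereas that of index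
  -- `j` exceeds `b s_j / 2`.
  refine ⟨fun ε j => b ε * s ε j - s ε (j + 1), fun ε => 2 * δ ε, by simpa using hδ.const_mul 2,
    ?_, fun j => (ha j).mul_ratio hb₀ ?_ ?_⟩
  · filter_upwards [hs, hev] with ε h1 h2
    obtain ⟨hb0, hbd⟩ := h2
    have lower : ∀ j, b ε / 2 * s ε j < b ε * s ε j - s ε (j + 1) := by
      intro j
      have := (h1.2 j).2
      nlinarith [(h1.2 j).1]
    refine ⟨fun j => ?_, fun j => ⟨?_, ?_⟩⟩
    · push_cast
      rw [← h1.1 j, ← h1.1 (j + 1), Finset.mul_sum, ← Finset.sum_sub_distrib]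
      exact Finset.sum_congr rfl fun m _ => by ring
    · exact lt_trans (mul_pos (by linarith) (h1.2 j).1) (lower j)
    · have h3 := (h1.2 (j + 1)).1
      have h4 := (h1.2 j).2
      have h5 := lower j
      have hδ0 : 0 < δ ε := by
        by_contra hcon
        have := mul_nonpos_of_nonpos_of_nonneg (not_lt.mp hcon) (h1.2 j).1.le
        linarith
      have h6 := (h1.2 (j + 1 + 1)).1
      have h7 := mul_lt_mul_of_pos_left h5 hδ0
      have h8 := mul_le_mul_of_nonneg_left h4 hb0.le
      linarith
  · have hlow : Tendsto (fun ε => b ε - δ ε) (𝓝[>] 0) (𝓝 b₀) := by simpa using hb.sub hδ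
    refine tendsto_of_tendsto_of_tendsto_of_le_of_le' hlow hb ?_ ?_
    · filter_upwards [hs] with ε h1
      rw [le_div_iff₀ (h1.2 j).1]
      have := (h1.2 j).2
      linarith
    · filter_upwards [hs] with ε h1
      rw [div_le_iff₀ (h1.2 j).1]
      have := (h1.2 (j + 1)).1
      linarith
  · filter_upwards [hs] with ε h1 using (h1.2 j).1.ne'

/-- The expansion of the moments of `z / (a - q)`. -/
theorem hasSum_moments {z q : Fin M → ℂ} {s : ℕ → ℝ} {a : ℝ} (ha : ∀ m, ‖q m‖ < a)
    (hs : ∀ j, ∑ m, z m * q m ^ j = (s j : ℂ)) (ha0 : 0 < a) (j : ℕ) :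
    ∃ u : ℝ, ∑ m, z m / (a - q m) * q m ^ j = (u : ℂ) ∧
      HasSum (fun i : ℕ => s (j + i) / a ^ (i + 1)) u := by
  have haC : (a : ℂ) ≠ 0 := by exact_mod_cast ha0.ne'
  have h1 : HasSum (fun i : ℕ => ((s (j + i) / a ^ (i + 1) : ℝ) : ℂ))
      (∑ m, z m / (a - q m) * q m ^ j) := by
    have h2 : ∀ m ∈ (Finset.univ : Finset (Fin M)),
        HasSum (fun i : ℕ => z m * q m ^ j / a * (q m / a) ^ i)
          (z m * q m ^ j / a * (1 - q m / a)⁻¹) := by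
      intro m _
      have h3 : ‖q m / a‖ < 1 := by
        rw [norm_div, Complex.norm_real, Real.norm_of_nonneg ha0.le, div_lt_one ha0]
        exact ha m
      have h4 := hasSum_geometric_of_norm_lt_one h3
      exact h4.mul_left (z m * q m ^ j / a)
    have e1 : (fun i : ℕ => ((s (j + i) / a ^ (i + 1) : ℝ) : ℂ)) =
        fun i : ℕ => ∑ m, z m * q m ^ j / a * (q m / a) ^ i := by
      ext i
      rw [Complex.ofReal_div, ← hs, Finset.sum_div, Complex.ofReal_pow]
      refine Finset.sum_congr rfl fun m _ => ?_
      rw [div_pow, pow_add, pow_succ (a : ℂ), div_mul_div_comm, mul_assoc, mul_comm (a : ℂ)]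
    have e2 : ∑ m, z m / (a - q m) * q m ^ j =
        ∑ m, z m * q m ^ j / a * (1 - q m / a)⁻¹ := by
      refine Finset.sum_congr rfl fun m _ => ?_
      have h3 : (a : ℂ) - q m ≠ 0 := by
        intro h
        have := ha m
        rw [← sub_eq_zero.mp h, Complex.norm_real, Real.norm_of_nonneg ha0.le] at this
        exact lt_irrefl _ this
      rw [one_sub_div haC]
      field_simp
    rw [e1, e2]
    exact hasSum_sum h2
  have h5 : HasSum (fun i : ℕ => s (j + i) / a ^ (i + 1))
      (∑ m, z m / (a - q m) * q m ^ j).re := by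
    have := Complex.hasSum_re h1
    simpa only [Complex.ofReal_re] using this
  exact ⟨_, h1.unique (Complex.hasSum_ofReal.mpr h5), h5⟩

/-- The geometric series in `q / a` expresses the new moments `u_j` as series in the old ones with
positive coefficients, so positivity and the decay rate pass over term by term. With `a u_j = s_j +
u_{j+1}` this squeezes `u_j / s_j` between `1 / a` and `1 / (a - δ)`. -/
theorem div_sub (h : MomentFamily q z r w) {a : ℝ → ℝ} {a₀ : ℝ} (ha₀ : 0 < a₀)
    (ha : Tendsto a (𝓝[>] 0) (𝓝 a₀)) (hq : ∀ᶠ ε in 𝓝[>] 0, ∀ m, ‖q ε m‖ < a ε) :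
    MomentFamily q (fun ε m => z ε m / (a ε - q ε m)) r w := by
  obtain ⟨s, δ, hδ, hs, has⟩ := h
  have hev : ∀ᶠ ε in 𝓝[>] 0, 0 < a ε ∧ δ ε < a ε := by
    have h1 := ha.eventually (lt_mem_nhds (show a₀ / 2 < a₀ by linarith))
    have h2 := hδ.eventually (gt_mem_nhds (show 0 < a₀ / 2 by linarith))
    filter_upwards [h1, h2] with ε h1 h2
    constructor <;> linarith
  let u : ℝ → ℕ → ℝ := fun ε j => (∑ m, z ε m / (a ε - q ε m) * q ε m ^ j).re
  have hu : ∀ᶠ ε in 𝓝[>] 0, ∀ j, ∑ m, z ε m / (a ε - q ε m) * q ε m ^ j = (u ε j : ℂ) ∧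
      s ε j / a ε ≤ u ε j ∧ u ε (j + 1) ≤ δ ε * u ε j ∧ a ε * u ε j = s ε j + u ε (j + 1) := by
    filter_upwards [hs, hev, hq] with ε h1 h2 h3 j
    have hsum : ∀ j, ∑ m, z ε m / (a ε - q ε m) * q ε m ^ j = (u ε j : ℂ) ∧
        HasSum (fun i : ℕ => s ε (j + i) / a ε ^ (i + 1)) (u ε j) := by
      intro j
      obtain ⟨v, hv, hv'⟩ := hasSum_moments h3 h1.1 h2.1 j
      have : u ε j = v := by simp only [u, hv, Complex.ofReal_re]
      rw [this]; exact ⟨hv, hv'⟩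
    refine ⟨(hsum j).1, ?_, ?_, ?_⟩
    · have := le_hasSum (hsum j).2 0 fun i _ =>
        div_nonneg (h1.2 _).1.le (pow_pos h2.1 _).le
      simpa using this
    · refine hasSum_le (fun i => ?_) (hsum (j + 1)).2 ((hsum j).2.mul_left (δ ε))
      rw [← mul_div_assoc]
      refine div_le_div_of_nonneg_right ?_ (pow_pos h2.1 _).le
      rw [add_right_comm]
      exact (h1.2 (j + i)).2
    · have : ((a ε * u ε j : ℝ) : ℂ) = ((s ε j + u ε (j + 1) : ℝ) : ℂ) := by
        push_cast
        rw [← (hsum j).1, ← (hsum (j + 1)).1, ← h1.1 j, Finset.mul_sum, ← Finset.sum_add_distrib]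
        refine Finset.sum_congr rfl fun m _ => ?_
        have h4 : (a ε : ℂ) - q ε m ≠ 0 := by
          intro h
          have := h3 m
          rw [← sub_eq_zero.mp h, Complex.norm_real, Real.norm_of_nonneg h2.1.le] at this
          exact lt_irrefl _ this
        field_simp
        ring
      exact_mod_cast this
  refine ⟨u, δ, hδ, ?_, fun j => (has j).mul_ratio (inv_pos.mpr ha₀) ?_ ?_⟩
  · filter_upwards [hs, hev, hu] with ε h1 h2 h3
    exact ⟨fun j => (h3 j).1, fun j => ⟨(div_pos (h1.2 j).1 h2.1).trans_le (h3 j).2.1,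
      (h3 j).2.2.1⟩⟩
  · have hup : Tendsto (fun ε => (a ε - δ ε)⁻¹) (𝓝[>] 0) (𝓝 a₀⁻¹) := by
      have : Tendsto (fun ε => a ε - δ ε) (𝓝[>] 0) (𝓝 a₀) := by simpa using ha.sub hδ
      exact this.inv₀ ha₀.ne'
    refine tendsto_of_tendsto_of_tendsto_of_le_of_le' (ha.inv₀ ha₀.ne') hup ?_ ?_
    · filter_upwards [hs, hu] with ε h1 h3
      rw [le_div_iff₀ (h1.2 j).1, inv_mul_eq_div]
      exact (h3 j).2.1
    · filter_upwards [hs, hev, hu] with ε h1 h2 h3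
      rw [div_le_iff₀ (h1.2 j).1, inv_mul_eq_div, le_div_iff₀ (by linarith)]
      obtain ⟨-, -, h4, h5⟩ := h3 j
      linarith
  · filter_upwards [hs] with ε h1 using (h1.2 j).1.ne'

theorem prod_mul_sub (h : MomentFamily q z r w) {ι : Type*} (T : Finset ι) {b : ι → ℝ → ℝ}
    {b₀ : ι → ℝ} (hb₀ : ∀ i, 0 < b₀ i) (hb : ∀ i, Tendsto (b i) (𝓝[>] 0) (𝓝 (b₀ i))) :
    MomentFamily q (fun ε m => z ε m * ∏ i ∈ T, ((b i ε : ℂ) - q ε m)) r w := by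
  classical
  induction T using Finset.induction_on with
  | empty => simpa using h
  | insert i T hi ih =>
    refine (ih.mul_sub (hb₀ i) (hb i)).congr' (Eventually.of_forall fun ε => ?_)
    ext m
    rw [Finset.prod_insert hi]; ring

theorem prod_div_sub (h : MomentFamily q z r w) {ι : Type*} (T : Finset ι) {b : ι → ℝ → ℝ}
    {b₀ : ι → ℝ} (hb₀ : ∀ i, 0 < b₀ i) (hb : ∀ i, Tendsto (b i) (𝓝[>] 0) (𝓝 (b₀ i)))
    (hq : ∀ i, ∀ᶠ ε in 𝓝[>] 0, ∀ m, ‖q ε m‖ < b i ε) :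
    MomentFamily q (fun ε m => z ε m * ∏ i ∈ T, ((b i ε : ℂ) - q ε m)⁻¹) r w := by
  classical
  induction T using Finset.induction_on with
  | empty => simpa using h
  | insert i T hi ih =>
    refine (ih.div_sub (hb₀ i) (hb i) (hq i)).congr' (Eventually.of_forall fun ε => ?_)
    ext m
    rw [Finset.prod_insert hi]; ring

theorem shift (h : MomentFamily q z r w) (n : ℕ) :
    MomentFamily q (fun ε m => z ε m * q ε m ^ n) (fun j => r (n + j)) (fun j => w (n + j)) := by
  obtain ⟨s, δ, hδ, hs, ha⟩ := h
  refine ⟨fun ε j => s ε (n + j), δ, hδ, ?_, fun j => ha _⟩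
  filter_upwards [hs] with ε h1
  refine ⟨fun j => ?_, fun j => h1.2 (n + j)⟩
  rw [← h1.1]
  exact Finset.sum_congr rfl fun m _ => by rw [pow_add]; ring

end MomentFamily

/-! ### The dual momenta -/

/-- This is the equation left after the root `p` is divided out. Multiplied by powers of `x`, it
becomes a recursion of order `M` for the moments, with the small factor `1 - p`. -/
theorem pow_eq_of_root {M : ℕ} {p x : ℂ} (hx : x ≠ p) (h : x ^ M * (1 - x) = p ^ M * (1 - p)) :
    x ^ M = (1 - p) * ∑ k ∈ Finset.range M, x ^ k * p ^ (M - 1 - k) := by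
  have h1 := (Commute.all x p).geom_sum₂_mul M
  refine mul_right_cancel₀ (sub_ne_zero.mpr hx) ?_
  rw [mul_assoc, h1]
  linear_combination (-1 : ℂ) * h

/-- The sum in `pow_eq_of_root` has norm at most `M * max 1 (‖x‖ ^ M)`. If `‖x‖ ≥ 1`, then `(1 - p)
* M < 1` contradicts the equation; otherwise `‖x‖ ^ M < (1 / 2) ^ M`. -/
theorem norm_lt_half_of_root {M : ℕ} {p : ℝ} (hp0 : 0 < p) (hp1 : p < 1)
    (hp : (1 - p) * M < (1 / 2) ^ M) {x : ℂ} (hx : x ≠ p)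
    (h : x ^ M * (1 - x) = (p : ℂ) ^ M * (1 - p)) : ‖x‖ < 1 / 2 := by
  have h1 := congrArg norm (pow_eq_of_root hx h)
  rw [norm_pow, norm_mul] at h1
  have h2 : ‖(1 - p : ℂ)‖ = 1 - p := by
    rw [← Complex.ofReal_one, ← Complex.ofReal_sub, Complex.norm_real,
      Real.norm_of_nonneg (by linarith)]
  rw [h2] at h1
  have h3 : ‖∑ k ∈ Finset.range M, x ^ k * (p : ℂ) ^ (M - 1 - k)‖ ≤
      ∑ k ∈ Finset.range M, ‖x‖ ^ k := by
    refine norm_sum_le_of_le _ fun k _ => ?_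
    rw [norm_mul, norm_pow, norm_pow, Complex.norm_real, Real.norm_of_nonneg hp0.le]
    exact mul_le_of_le_one_right (by positivity) (pow_le_one₀ hp0.le hp1.le)
  have h4 : ‖x‖ ^ M ≤ (1 - p) * ∑ k ∈ Finset.range M, ‖x‖ ^ k := by
    rw [h1]; exact mul_le_mul_of_nonneg_left h3 (by linarith)
  have h5 : (1 - p) * M < 1 := hp.trans_le (pow_le_one₀ (by norm_num) (by norm_num))
  rcases lt_or_ge ‖x‖ 1 with h6 | h6
  · have h7 : ∑ k ∈ Finset.range M, ‖x‖ ^ k ≤ M := by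
      refine (Finset.sum_le_sum fun k _ => pow_le_one₀ (norm_nonneg x) h6.le).trans ?_
      simp
    have h8 : ‖x‖ ^ M < (1 / 2) ^ M :=
      (h4.trans (mul_le_mul_of_nonneg_left h7 (by linarith))).trans_lt hp
    exact lt_of_pow_lt_pow_left₀ M (by norm_num) h8
  · exfalso
    have h7 : ∑ k ∈ Finset.range M, ‖x‖ ^ k ≤ M * ‖x‖ ^ M := by
      refine (Finset.sum_le_sum fun k hk =>
        pow_le_pow_right₀ h6 (Finset.mem_range.mp hk).le).trans ?_
      simp
    have h8 := h4.trans (mul_le_mul_of_nonneg_left h7 (by linarith))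
    have h9 : 0 < ‖x‖ ^ M := pow_pos (by linarith) M
    nlinarith

/-- The polynomial `x ^ M (1 - x) - p ^ M (1 - p)` has `M` distinct roots besides `p`. -/
theorem exists_dual_momenta {M : ℕ} [NeZero M] {p : ℝ} (hp0 : (1 + (M : ℝ)⁻¹)⁻¹ < p) (hp1 : p < 1)
    (hp : (1 - p) * M < (1 / 2) ^ M) :
    ∃ q : Fin M → ℂ, Function.Injective q ∧ ∀ m, q m ≠ (p : ℂ) ∧
      q m ^ M * (1 - q m) = (p : ℂ) ^ M * (1 - p) := by
  classical
  have hM : 0 < M := NeZero.pos M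
  have hMR : (1 : ℝ) ≤ M := by exact_mod_cast hM
  have hρ : (1 + (M : ℝ)⁻¹)⁻¹ = M / (M + 1) := by field_simp
  have hρ2 : (1 : ℝ) / 2 ≤ M / (M + 1) := by
    rw [div_le_div_iff₀ (by norm_num) (by linarith)]; linarith
  have hp0' : 0 < p := by rw [hρ] at hp0; linarith
  let s : ℂ := (p : ℂ) ^ M * (1 - p)
  have hs : s ≠ 0 := by
    refine mul_ne_zero (pow_ne_zero _ (by exact_mod_cast hp0'.ne')) ?_
    rw [sub_ne_zero]; exact_mod_cast hp1.ne'
  let P : Polynomial ℂ := Polynomial.X ^ (M + 1) + (Polynomial.C s - Polynomial.X ^ M)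
  have hdeg : (Polynomial.C s - Polynomial.X ^ M : Polynomial ℂ).natDegree < M + 1 := by
    refine Nat.lt_succ_of_le ((Polynomial.natDegree_sub_le _ _).trans ?_)
    simp
  have hPdeg : P.natDegree = M + 1 := by
    simp only [P]
    rw [Polynomial.natDegree_add_eq_left_of_natDegree_lt (by simpa using hdeg)]
    simp
  have hP0 : P ≠ 0 := by
    intro h; rw [h] at hPdeg; simp at hPdeg
  have heval : ∀ x, P.eval x = 0 ↔ x ^ M * (1 - x) = s := by
    intro x
    simp only [P, Polynomial.eval_add, Polynomial.eval_sub, Polynomial.eval_pow,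
      Polynomial.eval_X, Polynomial.eval_C]
    constructor
    · intro h; linear_combination -h
    · intro h; linear_combination -h
  -- A multiple root is a zero of the derivative, hence 0 or `M / (M + 1)`. The first is no root
  -- because `s ≠ 0`; the second differs from `p` and is at least `1 / 2`, too large for a root
  -- other than `p`.
  have hnodup : P.roots.Nodup := by
    rw [Multiset.nodup_iff_count_le_one]
    intro x
    rw [Polynomial.count_roots]
    by_contra hcon
    rw [not_le, Polynomial.one_lt_rootMultiplicity_iff_isRoot hP0] at hcon
    obtain ⟨hx, hx'⟩ := hcon
    have hx := (heval x).mp hx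
    have h1 : x ^ (M - 1) * ((M + 1) * x - M) = 0 := by
      have : (M + 1 : ℂ) * x ^ M - M * x ^ (M - 1) = 0 := by
        have := hx'
        simp only [Polynomial.IsRoot, P, Polynomial.derivative_add, Polynomial.derivative_sub,
          Polynomial.derivative_C, Polynomial.derivative_X_pow] at this
        simpa [sub_eq_add_neg] using this
      have e : x ^ M = x ^ (M - 1) * x := by rw [← pow_succ, Nat.sub_add_cancel hM]
      rw [e] at this
      linear_combination this
    rcases mul_eq_zero.mp h1 with h2 | h2
    · have h3 : x = 0 := by
        by_contra h3; exact pow_ne_zero _ h3 h2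
      rw [h3, zero_pow hM.ne', zero_mul] at hx
      exact hs hx.symm
    · have h3 : x = ((M / (M + 1) : ℝ) : ℂ) := by
        have : (M + 1 : ℂ) ≠ 0 := by exact_mod_cast (Nat.succ_ne_zero M)
        push_cast
        field_simp
        linear_combination h2
      have h4 : x ≠ p := by
        rw [h3]; rw [hρ] at hp0; exact_mod_cast hp0.ne
      have h5 := norm_lt_half_of_root hp0' hp1 hp h4 hx
      rw [h3, Complex.norm_real, Real.norm_of_nonneg (by positivity)] at h5
      linarith
  have hcard : P.roots.toFinset.card = M + 1 := by
    rw [Multiset.toFinset_card_of_nodup hnodup, IsAlgClosed.card_roots_eq_natDegree, hPdeg]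
  have hmem : (p : ℂ) ∈ P.roots.toFinset := by
    rw [Multiset.mem_toFinset, Polynomial.mem_roots hP0]
    exact (heval _).mpr rfl
  have hcard' : (P.roots.toFinset.erase p).card = M := by
    rw [Finset.card_erase_of_mem hmem, hcard]; rfl
  let e := (P.roots.toFinset.erase p).equivFinOfCardEq hcard'
  refine ⟨fun m => (e.symm m).1, fun m m' h => e.symm.injective (Subtype.ext h), fun m => ?_⟩
  have h := (e.symm m).2
  rw [Finset.mem_erase, Multiset.mem_toFinset, Polynomial.mem_roots hP0] at h
  exact ⟨h.1, (heval _).mp h.2⟩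

/-- This gives the freedom to choose the `α`: the first `M` moments can be prescribed arbitrarily,
by inverting a Vandermonde matrix. -/
theorem exists_weights_of_moments {M : ℕ} {q : Fin M → ℂ} (hq : Function.Injective q)
    (y : Fin M → ℂ) : ∃ α : Fin M → ℂ, ∀ k : Fin M, ∑ m, α m * q m ^ (k : ℕ) = y k := by
  have hdet : IsUnit (Matrix.vandermonde q).det :=
    isUnit_iff_ne_zero.mpr (Matrix.det_vandermonde_ne_zero_iff.mpr hq)
  refine ⟨Matrix.vecMul y (Matrix.vandermonde q)⁻¹, fun k => ?_⟩
  have h : Matrix.vecMul (Matrix.vecMul y (Matrix.vandermonde q)⁻¹) (Matrix.vandermonde q) = y := by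
    rw [Matrix.vecMul_vecMul, Matrix.nonsing_inv_mul _ hdet, Matrix.vecMul_one]
  have := congrFun h k
  simpa [Matrix.vecMul, dotProduct, Matrix.vandermonde] using this

/-! ### The contents -/

section contents

variable {M N : ℕ} [NeZero M] (ℓ : Fin N → Fin M → ℕ) (i : Fin N)

theorem partialContent_succ (j : ℕ) :
    partialContent ℓ i (j + 1) = partialContent ℓ i j + ℓ i (Fin.ofNat M j) :=
  Finset.sum_range_succ _ _

theorem partialContent_self : partialContent ℓ i M = ∑ m, ℓ i m := by
  rw [partialContent, Finset.sum_range]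
  refine Finset.sum_congr rfl fun m _ => ?_
  congr 1
  exact Fin.ext (Nat.mod_eq_of_lt m.2)

theorem partialContent_add_period (j : ℕ) :
    partialContent ℓ i (j + M) = partialContent ℓ i j + ∑ m, ℓ i m := by
  induction j with
  | zero => rw [zero_add, partialContent_self]; simp [partialContent]
  | succ j ih =>
    rw [add_right_comm, partialContent_succ, ih, partialContent_succ]
    have : Fin.ofNat M (j + M) = Fin.ofNat M j := Fin.ext (by simp)
    rw [this]; ring

theorem partialContent_mono : Monotone (partialContent ℓ i) :=
  monotone_nat_of_le_succ fun j => by rw [partialContent_succ]; exact Nat.le_add_right _ _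

end contents

/-! ### The moments of the initial weights -/

/-- Decay of a sequence given by `M` initial values and a recursion with positive coefficients. -/
theorem decay_of_recursion {M : ℕ} (hM : 0 < M) {s : ℕ → ℝ} {d p : ℝ} (hd0 : 0 < d)
    (hd : d ≤ 1 / 2) (hp0 : 0 < p) (hp1 : p < 1) (h0 : ∀ k < M, 0 < s k)
    (h1 : ∀ k, k + 1 < M → s (k + 1) ≤ d * s k) (h2 : (1 - p) * s 0 ≤ d * s (M - 1))
    (hs : ∀ j, s (j + M) = (1 - p) * ∑ k ∈ Finset.range M, p ^ (M - 1 - k) * s (j + k)) (j : ℕ) :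
    0 < s j ∧ s (j + 1) ≤ 2 * d * s j := by
  have hpos : ∀ j, 0 < s j := by
    intro j
    induction j using Nat.strong_induction_on with
    | _ j ih =>
      rcases lt_or_ge j M with h | h
      · exact h0 j h
      · obtain ⟨j, rfl⟩ := Nat.exists_eq_add_of_le' h
        rw [hs]
        refine mul_pos (by linarith) (Finset.sum_pos (fun k hk => ?_) ⟨0, by simpa using hM⟩)
        exact mul_pos (pow_pos hp0 _) (ih _ (by have := Finset.mem_range.mp hk; omega))
  refine ⟨hpos j, ?_⟩
  induction j using Nat.strong_induction_on with
  | _ j ih =>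
    -- Below `M` the decay is assumed. At the seam the recursion gives `s M ≤ (1 - p) * 2 * s 0`,
    -- the 2 being a bound for the geometric sum of ratio `1 / 2`, and `h2` compares `(1 - p) * s 0`
    -- with `s (M - 1)`. Beyond it, the recursions for `s (j + 1)` and `s j` are compared term by
    -- term.
    rcases lt_trichotomy (j + 1) M with h | h | h
    · have := h1 j h
      have := mul_pos hd0 (hpos j)
      linarith
    · have h3 : ∀ k < M, s k ≤ (1 / 2) ^ k * s 0 := by
        intro k hk
        induction k with
        | zero => simp
        | succ k ihk =>
          have h4 := h1 k hk
          have h5 := ihk (by omega)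
          have h6 := mul_le_mul_of_nonneg_right hd (hpos k).le
          rw [pow_succ]
          linarith
      have h4 : ∑ k ∈ Finset.range M, p ^ (M - 1 - k) * s (0 + k) ≤ 2 * s 0 := by
        calc ∑ k ∈ Finset.range M, p ^ (M - 1 - k) * s (0 + k)
            ≤ ∑ k ∈ Finset.range M, (1 / 2 : ℝ) ^ k * s 0 := by
              refine Finset.sum_le_sum fun k hk => ?_
              rw [zero_add]
              exact (mul_le_of_le_one_left (hpos k).le (pow_le_one₀ hp0.le hp1.le)).trans
                (h3 k (Finset.mem_range.mp hk))
          _ = (∑ k ∈ Finset.range M, (1 / 2 : ℝ) ^ k) * s 0 := (Finset.sum_mul _ _ _).symm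
          _ ≤ 2 * s 0 := by
              refine mul_le_mul_of_nonneg_right ?_ (hpos 0).le
              exact sum_geometric_two_le M
      have h5 := hs 0
      have h6 := mul_le_mul_of_nonneg_left h4 (show 0 ≤ 1 - p by linarith)
      have h7 : M - 1 = j := by omega
      rw [h7] at h2
      rw [zero_add] at h5
      rw [h, h5]
      linarith
    · obtain ⟨j, rfl⟩ : ∃ i, j = i + M := Nat.exists_eq_add_of_le' (by omega)
      rw [add_right_comm, hs, hs, mul_left_comm, Finset.mul_sum _ _ (2 * d)]
      refine mul_le_mul_of_nonneg_left (Finset.sum_le_sum fun k hk => ?_) (by linarith)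
      have hk := Finset.mem_range.mp hk
      have h3 := ih (j + k) (by omega)
      rw [mul_left_comm, add_right_comm]
      exact mul_le_mul_of_nonneg_left h3 (pow_pos hp0 _).le

/-- The moments of weights with prescribed first moments. -/
theorem momentFamily_of_initial {M N : ℕ} [NeZero M] (ℓ : Fin N → Fin M → ℕ) (i : Fin N)
    {v K : ℝ} (hv : 0 < v) {p : ℝ → ℝ} {q α : ℝ → Fin M → ℂ}
    (hp : ∀ ε, 1 - p ε = scale (-(∑ m, ℓ i m : ℕ)) (M * v) ε)
    (hq : ∀ᶠ ε in 𝓝[>] 0, ∀ m, q ε m ^ M =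
      (1 - p ε) * ∑ k ∈ Finset.range M, q ε m ^ k * (p ε : ℂ) ^ (M - 1 - k))
    (hα : ∀ᶠ ε in 𝓝[>] 0, ∀ k < M,
      ∑ m, α ε m * q ε m ^ k = (scale (K - partialContent ℓ i k) (v * k) ε : ℂ)) :
    MomentFamily q α (fun j => K - partialContent ℓ i j) (fun j => v * j) := by
  have hM : 0 < M := NeZero.pos M
  have hMv : 0 < M * v := mul_pos (by exact_mod_cast hM) hv
  have hp1 : ∀ ε, p ε < 1 := fun ε => by
    have := scale_pos (-(∑ m, ℓ i m : ℕ)) (M * v) ε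
    rw [← hp] at this; linarith
  have hplim : Tendsto p (𝓝[>] 0) (𝓝 1) := by
    have h1 := tendsto_scale_zero (r := -(∑ m, ℓ i m : ℕ))
      (neg_nonpos.mpr (Nat.cast_nonneg _)) hMv
    have h2 : Tendsto (fun ε => 1 - (1 - p ε)) (𝓝[>] 0) (𝓝 (1 - 0)) := by
      simp only [hp]; exact tendsto_const_nhds.sub h1
    simpa using h2
  have hp0 : ∀ᶠ ε in 𝓝[>] 0, 0 < p ε := hplim.eventually (lt_mem_nhds one_pos)
  let s : ℝ → ℕ → ℝ := fun ε j => (∑ m, α ε m * q ε m ^ j).re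
  have hs : ∀ᶠ ε in 𝓝[>] 0, (∀ j, ∑ m, α ε m * q ε m ^ j = (s ε j : ℂ)) ∧
      (∀ k < M, s ε k = scale (K - partialContent ℓ i k) (v * k) ε) ∧
      ∀ j, s ε (j + M) = (1 - p ε) * ∑ k ∈ Finset.range M, p ε ^ (M - 1 - k) * s ε (j + k) := by
    filter_upwards [hq, hα] with ε h1 h2
    have hrec : ∀ j, ∑ m, α ε m * q ε m ^ (j + M) =
        (1 - p ε) * ∑ k ∈ Finset.range M, (p ε : ℂ) ^ (M - 1 - k) *
          ∑ m, α ε m * q ε m ^ (j + k) := by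
      intro j
      simp only [Finset.mul_sum]
      rw [Finset.sum_comm]
      refine Finset.sum_congr rfl fun m _ => ?_
      rw [pow_add, h1 m, Finset.mul_sum, Finset.mul_sum, Finset.mul_sum]
      refine Finset.sum_congr rfl fun k _ => ?_
      rw [pow_add]; ring
    -- The moments are real although `q` and `α` need not be: the first `M` are prescribed real
    -- numbers, and the recursion has real coefficients.
    have hreal : ∀ j, ∃ x : ℝ, ∑ m, α ε m * q ε m ^ j = (x : ℂ) := by
      intro j
      induction j using Nat.strong_induction_on with
      | _ j ih =>
        rcases lt_or_ge j M with h | h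
        · exact ⟨_, h2 j h⟩
        · obtain ⟨j, rfl⟩ := Nat.exists_eq_add_of_le' h
          have : ∀ k, ∃ x : ℝ, k < M → ∑ m, α ε m * q ε m ^ (j + k) = (x : ℂ) := by
            intro k
            by_cases hk : k < M
            · obtain ⟨x, hx⟩ := ih (j + k) (by omega)
              exact ⟨x, fun _ => hx⟩
            · exact ⟨0, fun h => absurd h hk⟩
          choose x hx using this
          refine ⟨(1 - p ε) * ∑ k ∈ Finset.range M, p ε ^ (M - 1 - k) * x k, ?_⟩
          rw [hrec]
          push_cast
          congr 1
          refine Finset.sum_congr rfl fun k hk => ?_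
          rw [hx k (Finset.mem_range.mp hk)]
    have hre : ∀ j, ∑ m, α ε m * q ε m ^ j = (s ε j : ℂ) := by
      intro j
      obtain ⟨x, hx⟩ := hreal j
      simp only [s, hx, Complex.ofReal_re]
    refine ⟨hre, fun k hk => ?_, fun j => ?_⟩
    · exact_mod_cast (hre k).symm.trans (h2 k hk)
    · have := hrec j
      simp only [hre] at this
      exact_mod_cast this
  have hdlim : Tendsto (scale 0 v) (𝓝[>] 0) (𝓝 0) := tendsto_scale_zero le_rfl hv
  refine ⟨s, fun ε => 2 * scale 0 v ε, by simpa using hdlim.const_mul 2, ?_, ?_⟩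
  · have hdlt := hdlim.eventually (gt_mem_nhds (show (0 : ℝ) < 1 / 2 by norm_num))
    filter_upwards [hs, hp0, hdlt, self_mem_nhdsWithin] with ε h1 h2 h3 hε
    obtain ⟨h4, h5, h6⟩ := h1
    refine ⟨h4, decay_of_recursion hM (scale_pos 0 v ε) h3.le h2 (hp1 ε)
      (fun k hk => by rw [h5 k hk]; exact scale_pos _ _ _) (fun k hk => ?_) ?_ h6⟩
    · rw [h5 _ hk, h5 k (by omega), ← scale_add, scale, scale]
      have h7 : (partialContent ℓ i k : ℝ) ≤ partialContent ℓ i (k + 1) := by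
        exact_mod_cast partialContent_mono ℓ i (Nat.le_succ k)
      refine Real.exp_le_exp.mpr ?_
      push_cast
      have h8 := div_le_div_of_nonneg_right
        (show K - partialContent ℓ i (k + 1) ≤ 0 + (K - partialContent ℓ i k) by linarith)
        (le_of_lt hε)
      linarith
    -- At the seam both sides carry the same power of `ε`, since `M v = v + v (M - 1)`. The
    -- exponential rates are ordered because `X(M - 1) ≤ X(M) = L`.
    · rw [h5 0 hM, h5 (M - 1) (by omega), hp, ← scale_add, ← scale_add, scale, scale]
      have h7 : (partialContent ℓ i (M - 1) : ℝ) ≤ (∑ m, ℓ i m : ℕ) := by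
        rw [← partialContent_self]
        exact_mod_cast partialContent_mono ℓ i (Nat.sub_le M 1)
      have h8 : partialContent ℓ i 0 = 0 := by simp [partialContent]
      refine Real.exp_le_exp.mpr ?_
      rw [h8, Nat.cast_sub hM]
      have h9 := div_le_div_of_nonneg_right
        (show -((∑ m, ℓ i m : ℕ) : ℝ) + (K - (0 : ℕ)) ≤ 0 + (K - partialContent ℓ i (M - 1)) by
          push_cast; push_cast at h7; linarith)
        (le_of_lt hε)
      push_cast at h9 ⊢
      linarith
  · intro j
    induction j using Nat.strong_induction_on with
    | _ j ih =>
      rcases lt_or_ge j M with h | h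
      · refine (Asym.scale _ _).congr' ?_
        filter_upwards [hs] with ε h1
        exact (h1.2.1 j h).symm
      · obtain ⟨j, rfl⟩ := Nat.exists_eq_add_of_le' h
        have hη : Asym (fun ε => 1 - p ε) (-(∑ m, ℓ i m : ℕ)) (M * v) := by
          simp only [hp]; exact Asym.scale _ _
        have hpow : ∀ n : ℕ, Tendsto (fun ε => p ε ^ n) (𝓝[>] 0) (𝓝 1) := by
          intro n; simpa using hplim.pow n
        have hterm : ∀ k < M, Asym (fun ε => p ε ^ (M - 1 - k) * s ε (j + k))
            (K - partialContent ℓ i (j + k)) (v * (j + k : ℕ)) := fun k hk =>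
          ((Asym.of_tendsto one_pos (hpow _)).mul (ih (j + k) (by omega))).cast
            (zero_add _) (zero_add _)
        -- Only the term `k = 0` of the recursion matters: the later ones have no larger exponential
        -- rate and a higher power of `ε`. Hence the rate at `j + M` is that at `j` minus `L`, which
        -- matches the quasi-periodicity of `partialContent`.
        have hsmall : Tendsto (fun ε => (∑ k ∈ Finset.range (M - 1),
            p ε ^ (M - 1 - (k + 1)) * s ε (j + (k + 1))) /
              scale (K - partialContent ℓ i (j + 0)) (v * (j + 0 : ℕ)) ε) (𝓝[>] 0) (𝓝 0) := by
          simp only [Finset.sum_div]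
          rw [show 𝓝 (0 : ℝ) = 𝓝 (∑ k ∈ Finset.range (M - 1), (0 : ℝ)) by simp]
          refine tendsto_finsetSum _ fun k hk => ?_
          have hk := Finset.mem_range.mp hk
          refine (hterm (k + 1) (by omega)).tendsto_div_scale_zero (tendsto_scale_zero ?_ ?_)
          · have : (partialContent ℓ i (j + 0) : ℝ) ≤ partialContent ℓ i (j + (k + 1)) := by
              exact_mod_cast partialContent_mono ℓ i (by omega)
            linarith
          · push_cast
            have : 0 < v * (k + 1) := by positivity
            linarith
        have hsum := hη.mul ((hterm 0 hM).add_of_isSmall hsmall)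
        refine (hsum.congr' ?_).cast ?_ ?_
        · filter_upwards [hs] with ε h1
          rw [h1.2.2 j]
          congr 1
          obtain ⟨M', rfl⟩ : ∃ M', M = M' + 1 := ⟨M - 1, by omega⟩
          rw [Finset.sum_range_succ', add_comm]
          simp
        · simp only [partialContent_add_period, add_zero]
          push_cast; ring
        · push_cast; ring

/-! ### Asymptotics of the moment determinants -/

/-- This is the equality case of the rearrangement inequality: as `v` is strictly decreasing, `σ`
must preserve the order, and an order-preserving permutation of `Fin r` is trivial. -/
theorem perm_eq_one_of_antivary {r : ℕ} {v : Fin r → ℝ} (hv : StrictAnti v)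
    {σ : Equiv.Perm (Fin r)} (h : Antivary v (fun l => ((σ l : ℕ) : ℝ))) : σ = 1 := by
  have hmono : StrictMono σ.symm := by
    intro i j hij
    by_contra hcon
    rw [not_lt] at hcon
    have h1 := @h (σ.symm i) (σ.symm j) (by simpa using hij)
    have h2 := hv.le_iff_ge.mp h1
    have h3 := σ.symm.injective (le_antisymm h2 hcon)
    exact hij.ne h3
  have hmono' : StrictMono σ := by
    intro i j hij
    have := hmono.lt_iff_lt (a := σ i) (b := σ j)
    simp only [Equiv.symm_apply_apply] at this
    exact this.mp hij
  ext l
  have h1 := hmono'.le_apply (x := l)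
  have h2 := hmono.le_apply (x := σ l)
  rw [Equiv.symm_apply_apply] at h2
  rw [le_antisymm h2 h1]; rfl

theorem sum_mul_lt_sum_mul_perm {r : ℕ} {v : Fin r → ℝ} (hv : StrictAnti v)
    {σ : Equiv.Perm (Fin r)} (hσ : σ ≠ 1) :
    ∑ l, v l * ((l : ℕ) : ℝ) < ∑ l, v l * ((σ l : ℕ) : ℝ) := by
  have h : Antivary v (fun l : Fin r => ((l : ℕ) : ℝ)) := by
    intro i j hij
    exact hv.antitone (by exact_mod_cast (Nat.cast_lt.mp hij).le)
  exact (h.sum_mul_lt_sum_mul_comp_perm_iff (σ := σ)).mpr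
    fun h' => hσ (perm_eq_one_of_antivary hv h')

/-- Among the ways to distribute partial sums of rows that decrease with the row index, the
identity gives the least total. -/
theorem sum_partialSum_le_perm {r : ℕ} (lam : Fin r → ℕ → ℝ) (h : ∀ m, Antitone fun l => lam l m)
    (σ : Equiv.Perm (Fin r)) :
    ∑ l : Fin r, ∑ m ∈ Finset.range l, lam l m ≤ ∑ l, ∑ m ∈ Finset.range (σ l), lam l m := by
  -- Layer by layer: each partial sum becomes a sum over all `m` against the indicator of `m < τ l`.
  -- For fixed `m` the row entries decrease in `l` while the indicator increases, and the
  -- rearrangement inequality applies.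
  have e : ∀ τ : Equiv.Perm (Fin r), ∑ l, ∑ m ∈ Finset.range (τ l), lam l m =
      ∑ m ∈ Finset.range r, ∑ l : Fin r, lam l m * (if m < (τ l : ℕ) then 1 else 0) := by
    intro τ
    rw [Finset.sum_comm]
    refine Finset.sum_congr rfl fun l _ => ?_
    simp only [mul_ite, mul_one, mul_zero]
    rw [← Finset.sum_filter]
    congr 1
    ext m
    simp only [Finset.mem_range, Finset.mem_filter]
    have := (τ l).2
    omega
  have e1 := e 1
  simp only [Equiv.Perm.coe_one, id_eq] at e1
  rw [e1, e σ]
  refine Finset.sum_le_sum fun m _ => ?_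
  have hav : Antivary (fun l => lam l m) (fun l : Fin r => if m < (l : ℕ) then (1 : ℝ) else 0) := by
    intro i j hij
    refine h m ?_
    by_contra hcon
    rw [not_le] at hcon
    have : (j : ℕ) < i := hcon
    simp only at hij
    split_ifs at hij <;> first | omega | norm_num at hij
  exact hav.sum_mul_le_sum_mul_comp_perm (σ := σ)

/-- In the Leibniz expansion every nontrivial permutation has at most the exponential rate of the
identity and strictly more powers of `ε`. It is therefore negligible, whatever its sign, even when
the exponential rates agree. -/
theorem asym_det {r : ℕ} {F : Fin r → Fin r → ℝ → ℝ} {x ω : Fin r → Fin r → ℝ}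
    (hF : ∀ k l, Asym (F k l) (x k l) (ω k l))
    (hx : ∀ σ : Equiv.Perm (Fin r), ∑ l, x (σ l) l ≤ ∑ l, x l l)
    (hω : ∀ σ : Equiv.Perm (Fin r), σ ≠ 1 → ∑ l, ω l l < ∑ l, ω (σ l) l) :
    Asym (fun ε => (Matrix.of fun k l => F k l ε).det) (∑ l, x l l) (∑ l, ω l l) := by
  have hdet : ∀ ε, (Matrix.of fun k l => F k l ε).det = ∏ l, F l l ε +
      ∑ σ ∈ Finset.univ.erase (1 : Equiv.Perm (Fin r)),
        ((Equiv.Perm.sign σ : ℤ) : ℝ) * ∏ l, F (σ l) l ε := by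
    intro ε
    rw [Matrix.det_apply', ← Finset.add_sum_erase _ _ (Finset.mem_univ 1)]
    simp
  simp only [hdet]
  refine (Asym.prod _ fun l _ => hF l l).add_of_isSmall ?_
  simp only [Finset.sum_div]
  rw [show 𝓝 (0 : ℝ) = 𝓝 (∑ σ ∈ Finset.univ.erase (1 : Equiv.Perm (Fin r)), (0 : ℝ)) by simp]
  refine tendsto_finsetSum _ fun σ hσ => ?_
  have h1 := (Asym.prod Finset.univ fun l _ => hF (σ l) l).tendsto_div_scale_zero
    (r' := ∑ l, x l l) (w' := ∑ l, ω l l)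
    (tendsto_scale_zero (sub_nonpos.mpr (hx σ)) (sub_pos.mpr (hω σ (Finset.ne_of_mem_erase hσ))))
  have h2 := h1.const_mul ((Equiv.Perm.sign σ : ℤ) : ℝ)
  rw [mul_zero] at h2
  exact h2.congr fun ε => (mul_div_assoc _ _ _).symm

/-- The asymptotics of the determinant of the moments of a group of weights. -/
theorem asym_moment_det {M N r : ℕ} [NeZero M] (ℓ : Fin N → Fin M → ℕ)
    (hℓ : ∀ m, Antitone fun i => ℓ i m) {e : Fin r → Fin N} (he : StrictMono e) (j : ℕ)
    {wt : Fin N → ℝ} (hwt : StrictAnti wt) {C Ω : Fin r → ℝ} {F : Fin r → Fin r → ℝ → ℝ}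
    (hF : ∀ k l, Asym (F k l) (C l - partialContent ℓ (e l) (j + k))
      (Ω l + wt (e l) * (j + k : ℕ))) :
    Asym (fun ε => (Matrix.of fun k l => F k l ε).det)
      (∑ l, (C l - partialContent ℓ (e l) (j + l))) (∑ l, (Ω l + wt (e l) * (j + l : ℕ))) := by
  refine asym_det (x := fun k l => C l - partialContent ℓ (e l) (j + k))
    (ω := fun k l => Ω l + wt (e l) * (j + k : ℕ)) hF (fun σ => ?_) (fun σ hσ => ?_)
  · have hX : ∀ (l : Fin r) (k : ℕ), (partialContent ℓ (e l) (j + k) : ℝ) =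
        partialContent ℓ (e l) j +
          ∑ m ∈ Finset.range k, (ℓ (e l) (Fin.ofNat M (j + m)) : ℝ) := by
      intro l k
      rw [partialContent, partialContent, Finset.sum_range_add]
      push_cast; rfl
    have hanti : ∀ m, Antitone fun l => (ℓ (e l) (Fin.ofNat M (j + m)) : ℝ) :=
      fun m l l' hll => Nat.cast_le.mpr (hℓ _ (he.monotone hll))
    have h := sum_partialSum_le_perm (fun l m => (ℓ (e l) (Fin.ofNat M (j + m)) : ℝ)) hanti σ
    simp only [Finset.sum_sub_distrib, hX, Finset.sum_add_distrib]
    linarith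
  · have h := sum_mul_lt_sum_mul_perm (v := fun l => wt (e l)) (fun l l' hll => hwt (he hll)) hσ
    simp only [Finset.sum_add_distrib, Nat.cast_add, mul_add]
    linarith

/-! ### Sums over the elements of a finite set in increasing order -/

theorem sum_orderEmbOfFin {N : ℕ} {A : Type*} [AddCommMonoid A] (S : Finset (Fin N))
    (f : Fin N → A) : ∑ i ∈ S, f i = ∑ l, f (S.orderEmbOfFin rfl l) := by
  rw [← Finset.sum_coe_sort S f]
  exact (Fintype.sum_equiv (S.orderIsoOfFin rfl).toEquiv _ _ fun l => rfl).symm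

theorem card_filter_lt_orderEmbOfFin {N : ℕ} (S : Finset (Fin N)) (l : Fin S.card) :
    (S.filter (· < S.orderEmbOfFin rfl l)).card = l := by
  have h : S.filter (· < S.orderEmbOfFin rfl l) =
      (Finset.Iio l).map (S.orderEmbOfFin rfl).toEmbedding := by
    ext i
    simp only [Finset.mem_filter, Finset.mem_map, Finset.mem_Iio, RelEmbedding.coe_toEmbedding]
    constructor
    · rintro ⟨hi, hlt⟩
      have : i ∈ Set.range (S.orderEmbOfFin rfl) := by
        rw [Finset.range_orderEmbOfFin]; exact hi
      obtain ⟨k, rfl⟩ := this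
      exact ⟨k, (S.orderEmbOfFin rfl).lt_iff_lt.mp hlt, rfl⟩
    · rintro ⟨k, hk, rfl⟩
      exact ⟨S.orderEmbOfFin_mem rfl k, (S.orderEmbOfFin rfl).lt_iff_lt.mpr hk⟩
  rw [h, Finset.card_map, Fin.card_Iio]

/-- Applied to the rates of the Vandermonde factors, this produces the term `∑ (k - 1) L^{(i_k)}` of
the phase factor. -/
theorem sum_sum_Ioi {r : ℕ} (f : Fin r → ℝ) :
    ∑ k : Fin r, ∑ l ∈ Finset.Ioi k, f l = ∑ l : Fin r, ((l : ℕ) : ℝ) * f l := by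
  rw [Finset.sum_comm' (s' := fun l => Finset.Iio l) (t' := Finset.univ) (by simp)]
  refine Finset.sum_congr rfl fun l _ => ?_
  rw [Finset.sum_const, Fin.card_Iio, nsmul_eq_mul]

/-- The parameters at index `k` carry the capacity at `k - 1`, whereas the phases sum the capacities
themselves. The boundary term `f 0` is absorbed into the initial phase. -/
theorem dirSum_pred (f : ℤ → ℤ) (n : ℤ) :
    dirSum (fun k => f (k - 1)) n = dirSum f (n - 1) + f 0 := by
  have h0 : dirSum (fun k => f (k - 1)) 0 = dirSum f (0 - 1) + f 0 := by simp [dirSum]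
  induction n using Int.induction_on with
  | zero => exact h0
  | succ i ih =>
    have := dirSum_succ f (i - 1)
    rw [sub_add_cancel] at this
    rw [dirSum_succ, ih, add_sub_cancel_right, this]; ring
  | pred i ih =>
    have h1 := dirSum_succ (fun k => f (k - 1)) (-(i : ℤ) - 1)
    have h2 := dirSum_succ f (-(i : ℤ) - 1 - 1)
    simp only [sub_add_cancel] at h1 h2
    linarith

/-! ### The ultradiscrete limit of the soliton τ-functions -/

/-- The exponents of `ε` which separate the solitons of equal amplitude. -/
def solitonExponent (N : ℕ) (i : Fin N) : ℝ := N - (i : ℕ)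

theorem solitonExponent_pos {N : ℕ} (i : Fin N) : 0 < solitonExponent N i :=
  sub_pos.mpr (Nat.cast_lt.mpr i.2)

theorem solitonExponent_strictAnti (N : ℕ) : StrictAnti (solitonExponent N) :=
  fun _ _ h => sub_lt_sub_left (Nat.cast_lt.mpr h) _

/-- The momenta `p_i = 1 - ε ^ (M (N - i)) e ^ (-L_i / ε)`. -/
def momentum (M : ℕ) {N : ℕ} (L : Fin N → ℕ) (ε : ℝ) (i : Fin N) : ℝ :=
  1 - scale (-(L i : ℝ)) (M * solitonExponent N i) ε

/-! ### Momenta near 1 and their differences. -/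

section momentum

variable {M N : ℕ} [NeZero M] (L : Fin N → ℕ)

theorem mul_solitonExponent_pos (i : Fin N) : 0 < M * solitonExponent N i :=
  mul_pos (Nat.cast_pos.mpr (NeZero.pos M)) (solitonExponent_pos i)

theorem one_sub_momentum (ε : ℝ) (i : Fin N) :
    1 - momentum M L ε i = scale (-(L i : ℝ)) (M * solitonExponent N i) ε := by
  simp [momentum]

theorem asym_one_sub_momentum (i : Fin N) :
    Asym (fun ε => 1 - momentum M L ε i) (-(L i : ℝ)) (M * solitonExponent N i) := by
  simp only [one_sub_momentum]; exact Asym.scale _ _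

theorem momentum_lt_one (ε : ℝ) (i : Fin N) : momentum M L ε i < 1 :=
  sub_lt_self _ (scale_pos _ _ _)

theorem tendsto_one_sub_momentum (i : Fin N) :
    Tendsto (fun ε => 1 - momentum M L ε i) (𝓝[>] 0) (𝓝 0) := by
  simp only [one_sub_momentum]
  exact tendsto_scale_zero (neg_nonpos.mpr (Nat.cast_nonneg _)) (mul_solitonExponent_pos i)

theorem tendsto_momentum (i : Fin N) :
    Tendsto (fun ε => momentum M L ε i) (𝓝[>] 0) (𝓝 1) := by
  simpa using (tendsto_one_sub_momentum (M := M) L i).const_sub 1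

theorem eventually_strictAnti_momentum {L : Fin N → ℕ} (hL : Antitone L) :
    ∀ᶠ ε in 𝓝[>] 0, StrictAnti (momentum M L ε) := by
  have h1 : ∀ᶠ ε : ℝ in 𝓝[>] 0, ε < 1 :=
    eventually_nhdsWithin_of_eventually_nhds (gt_mem_nhds one_pos)
  filter_upwards [h1, self_mem_nhdsWithin] with ε h1 h0 i j hij
  have h0 : 0 < ε := h0
  refine sub_lt_sub_left (Real.exp_lt_exp.mpr ?_) _
  have h2 : -(L i : ℝ) / ε ≤ -(L j : ℝ) / ε :=
    div_le_div_of_nonneg_right (neg_le_neg (Nat.cast_le.mpr (hL hij.le))) h0.le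
  have h3 : M * solitonExponent N j < M * solitonExponent N i :=
    mul_lt_mul_of_pos_left (solitonExponent_strictAnti N hij) (Nat.cast_pos.mpr (NeZero.pos M))
  have h4 := mul_lt_mul_of_neg_right h3 (Real.log_neg h0 h1)
  linarith

/-- The difference is `(1 - p_j) - (1 - p_i)`, and the first term dominates because `L j ≤ L i` and
it has the smaller power of `ε`. The positivity of these differences makes the Vandermonde factors
harmless. -/
theorem asym_momentum_sub {L : Fin N → ℕ} (hL : Antitone L) {i j : Fin N} (hij : i < j) :
    Asym (fun ε => momentum M L ε i - momentum M L ε j) (-(L j : ℝ))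
      (M * solitonExponent N j) := by
  have h1 := (asym_one_sub_momentum (M := M) L i).tendsto_div_scale_zero (r' := -(L j : ℝ))
    (w' := M * solitonExponent N j) (tendsto_scale_zero
      (by have : (L j : ℝ) ≤ L i := Nat.cast_le.mpr (hL hij.le)
          linarith)
      (sub_pos.mpr (mul_lt_mul_of_pos_left (solitonExponent_strictAnti N hij)
        (Nat.cast_pos.mpr (NeZero.pos M)))))
  have h2 : Tendsto (fun ε => -(1 - momentum M L ε i) /
      scale (-(L j : ℝ)) (M * solitonExponent N j) ε) (𝓝[>] 0) (𝓝 0) := by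
    have := h1.neg
    rw [neg_zero] at this
    exact this.congr fun ε => (neg_div _ _).symm
  refine ((asym_one_sub_momentum L j).add_of_isSmall h2).congr' (Eventually.of_forall fun ε => ?_)
  simp only; ring

end momentum

/-- The parameter `1 + e ^ (-X / ε)` as a real number. -/
def capParam (X : ℕ) (ε : ℝ) : ℝ := 1 + Real.exp (-(X : ℝ) / ε)

theorem expParam_eq (X : ℤ → ℕ) (ε : ℝ) (k : ℤ) :
    expParam X ε k = (capParam (X (k - 1)) ε : ℂ) := rfl

theorem one_lt_capParam (X : ℕ) (ε : ℝ) : 1 < capParam X ε :=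
  lt_add_of_pos_right _ (Real.exp_pos _)

/-- The limit is 1 for positive capacity and 2 for capacity 0. The latter case is needed when time
or position is frozen. -/
theorem exists_tendsto_capParam (X : ℕ) :
    ∃ c, 0 < c ∧ Tendsto (capParam X) (𝓝[>] 0) (𝓝 c) := by
  rcases Nat.eq_zero_or_pos X with rfl | h
  · refine ⟨2, two_pos, ?_⟩
    have : capParam 0 = fun _ => 2 := by ext ε; simp [capParam]; norm_num
    rw [this]; exact tendsto_const_nhds
  · refine ⟨1, one_pos, ?_⟩
    have h1 := (tendsto_scale_zero_of_neg (r := -(X : ℝ)) (w := 0)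
      (neg_neg_of_pos (Nat.cast_pos.mpr h))).const_add 1
    rw [add_zero] at h1
    refine h1.congr fun ε => ?_
    simp [scale, capParam]

/-- The difference is a sum of two positive scales with rates `-X` and `-L i`; the larger rate
prevails, and this is the source of `min (X, L)` in the phases. If `X = L i`, the term without a
power of `ε` wins. -/
theorem asym_capParam_sub_momentum {M N : ℕ} [NeZero M] (L : Fin N → ℕ) (X : ℕ) (i : Fin N) :
    ∃ w, Asym (fun ε => capParam X ε - momentum M L ε i) (-((min X (L i) : ℕ) : ℝ)) w := by
  have e : ∀ ε, capParam X ε - momentum M L ε i =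
      scale (-(X : ℝ)) 0 ε + scale (-(L i : ℝ)) (M * solitonExponent N i) ε := by
    intro ε; simp [capParam, momentum, scale]
  simp only [e]
  rcases le_or_gt X (L i) with h | h
  · refine ⟨0, ?_⟩
    rw [min_eq_left h]
    refine (Asym.scale _ _).add_of_isSmall ((Asym.scale _ _).tendsto_div_scale_zero ?_)
    refine tendsto_scale_zero ?_ ?_
    · have : (X : ℝ) ≤ L i := Nat.cast_le.mpr h
      linarith
    · simpa using mul_solitonExponent_pos (M := M) i
  · refine ⟨M * solitonExponent N i, ?_⟩
    rw [min_eq_right h.le]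
    simp only [add_comm (scale (-(X : ℝ)) 0 _)]
    refine (Asym.scale _ _).add_of_isSmall ((Asym.scale _ _).tendsto_div_scale_zero ?_)
    refine tendsto_scale_zero_of_neg ?_
    have : (L i : ℝ) < X := Nat.cast_lt.mpr h
    linarith

/-- The real factor `E(p)` up to the sign, as a function of the momentum. -/
def realWave (θ κ : ℤ → ℕ) (ε p : ℝ) (t n : ℤ) (j : ℕ) : ℝ :=
  (1 - p)⁻¹ * (p ^ j)⁻¹ *
    ((∏ k ∈ Finset.Icc 1 t, (capParam (κ (k - 1)) ε - p)) *
      ∏ k ∈ Finset.Icc (t + 1) 0, (capParam (κ (k - 1)) ε - p)⁻¹) *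
    ((∏ k ∈ Finset.Icc 1 n, (capParam (θ (k - 1)) ε - p)⁻¹) *
      ∏ k ∈ Finset.Icc (n + 1) 0, (capParam (θ (k - 1)) ε - p))

/-- The power `w` may remain unspecified: the factor multiplies a whole column of the moment
determinant, so it cannot affect which permutation dominates. -/
theorem asym_realWave {M N : ℕ} [NeZero M] (L : Fin N → ℕ) (θ κ : ℤ → ℕ) (i : Fin N) (t n : ℤ)
    (j : ℕ) : ∃ w, Asym (fun ε => realWave θ κ ε (momentum M L ε i) t n j)
      ((L i - dirSum (fun k => ((min (κ (k - 1)) (L i) : ℕ) : ℤ)) t +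
        dirSum (fun k => ((min (θ (k - 1)) (L i) : ℕ) : ℤ)) n : ℤ) : ℝ) w := by
  choose wκ hκ using fun k : ℤ => asym_capParam_sub_momentum (M := M) L (κ (k - 1)) i
  choose wθ hθ using fun k : ℤ => asym_capParam_sub_momentum (M := M) L (θ (k - 1)) i
  have hp : Asym (fun ε => (momentum M L ε i ^ j)⁻¹) 0 0 :=
    ((Asym.of_tendsto one_pos (by simpa using (tendsto_momentum (M := M) L i).pow j)).inv).cast
      neg_zero neg_zero
  have h := (((asym_one_sub_momentum (M := M) L i).inv.mul hp).mul
    ((Asym.prod (Finset.Icc 1 t) fun k _ => hκ k).mul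
      (Asym.prod (Finset.Icc (t + 1) 0) fun k _ => (hκ k).inv))).mul
    ((Asym.prod (Finset.Icc 1 n) fun k _ => (hθ k).inv).mul
      (Asym.prod (Finset.Icc (n + 1) 0) fun k _ => hθ k))
  refine ⟨_, h.cast ?_ rfl⟩
  simp only [dirSum, Finset.sum_neg_distrib]
  push_cast
  ring

/-- The complementary factor `E(q)⁻¹` up to the sign. -/
def dualWave (θ κ : ℤ → ℕ) (ε : ℝ) (q : ℂ) (t n : ℤ) (j : ℕ) : ℂ :=
  q ^ j * ((1 : ℝ) - q) * (∏ k ∈ Finset.Icc 1 t, ((capParam (κ (k - 1)) ε : ℂ) - q)⁻¹) *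
    (∏ k ∈ Finset.Icc (t + 1) 0, ((capParam (κ (k - 1)) ε : ℂ) - q)) *
    (∏ k ∈ Finset.Icc 1 n, ((capParam (θ (k - 1)) ε : ℂ) - q)) *
    (∏ k ∈ Finset.Icc (n + 1) 0, ((capParam (θ (k - 1)) ε : ℂ) - q)⁻¹)

theorem dirProd_cParam {M : ℕ} [NeZero M] (x : ℂ) {j : ℕ} (hj : j ≤ M) :
    dirProd (fun k => (x - cParam M k)⁻¹) (j + 1) = ((x - 1) * x ^ j)⁻¹ := by
  have h0 : ∀ m : ℤ, 0 ≤ m → dirProd (fun k => (x - cParam M k)⁻¹) m =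
      ∏ k ∈ Finset.Icc 1 m, (x - cParam M k)⁻¹ := by
    intro m hm
    rw [dirProd, Finset.Icc_eq_empty (by omega : ¬ m + 1 ≤ (0 : ℤ)), Finset.prod_empty, mul_one]
  rw [h0 _ (by positivity)]
  induction j with
  | zero => simp [cParam_one]
  | succ j ih =>
    rw [Icc_one_succ_of_nonneg (by positivity), Finset.prod_insert (by simp)]
    push_cast
    rw [ih (by omega), cParam_eq_zero (by omega) (by omega), sub_zero, pow_succ]
    simp only [mul_inv]; ring

theorem planeWave_div_planeWave {M : ℕ} [NeZero M] (θ κ : ℤ → ℕ) (ε p : ℝ) (q : ℂ) (t n : ℤ) {j : ℕ}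
    (hj : j ≤ M) :
    planeWave (expParam κ ε) (expParam θ ε) (cParam M) p t n (j + 1) /
      planeWave (expParam κ ε) (expParam θ ε) (cParam M) q t n (j + 1) =
      (realWave θ κ ε p t n j : ℂ) * dualWave θ κ ε q t n j := by
  have h : ((p : ℂ) - 1)⁻¹ * (q - 1) = (1 - (p : ℂ))⁻¹ * (1 - q) := by
    rw [← neg_sub 1 (p : ℂ), ← neg_sub 1 q, inv_neg, neg_mul_neg]
  simp only [planeWave, dirProd_cParam _ hj]
  simp only [dirProd, expParam_eq, realWave, dualWave, div_eq_mul_inv, mul_inv, inv_inv,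
    Finset.prod_inv_distrib]
  push_cast
  linear_combination ((∏ k ∈ Finset.Icc 1 t, ((capParam (κ (k - 1)) ε : ℂ) - p)) *
    (∏ k ∈ Finset.Icc (t + 1) 0, ((capParam (κ (k - 1)) ε : ℂ) - p))⁻¹ *
    (∏ k ∈ Finset.Icc 1 n, ((capParam (θ (k - 1)) ε : ℂ) - p))⁻¹ *
    (∏ k ∈ Finset.Icc (n + 1) 0, ((capParam (θ (k - 1)) ε : ℂ) - p)) *
    (∏ k ∈ Finset.Icc 1 t, ((capParam (κ (k - 1)) ε : ℂ) - q))⁻¹ *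
    (∏ k ∈ Finset.Icc (t + 1) 0, ((capParam (κ (k - 1)) ε : ℂ) - q)) *
    (∏ k ∈ Finset.Icc 1 n, ((capParam (θ (k - 1)) ε : ℂ) - q)) *
    (∏ k ∈ Finset.Icc (n + 1) 0, ((capParam (θ (k - 1)) ε : ℂ) - q))⁻¹ *
    ((p : ℂ) ^ j)⁻¹ * q ^ j) * h

/-- The moments of the weights of a group of solitons, divided by the Cauchy denominators. -/
theorem momentFamily_wave {M : ℕ} {q α : ℝ → Fin M → ℂ} {r w : ℕ → ℝ}
    (h : MomentFamily q α r w) (hq : ∀ᶠ ε in 𝓝[>] 0, ∀ m, ‖q ε m‖ < 1 / 2) (θ κ : ℤ → ℕ)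
    (t n : ℤ) (j : ℕ) {s : ℕ} {P : ℝ → Fin s → ℝ} (hP : ∀ k, Tendsto (fun ε => P ε k) (𝓝[>] 0) (𝓝 1))
    {A : ℝ → ℝ} {ρ ω : ℝ} (hA : Asym A ρ ω) :
    MomentFamily q (fun ε m => α ε m * (A ε * dualWave θ κ ε (q ε m) t n j) /
      ∏ k, (P ε k - q ε m)) (fun k => ρ + r (j + k)) (fun k => ω + w (j + k)) := by
  choose cκ hcκ hκ using fun k : ℤ => exists_tendsto_capParam (κ (k - 1))
  choose cθ hcθ hθ using fun k : ℤ => exists_tendsto_capParam (θ (k - 1))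
  have hcap : ∀ X : ℕ, ∀ᶠ ε in 𝓝[>] 0, ∀ m, ‖q ε m‖ < capParam X ε := by
    intro X
    filter_upwards [hq] with ε h m
    linarith [h m, one_lt_capParam X ε]
  have hPq : ∀ k, ∀ᶠ ε in 𝓝[>] 0, ∀ m, ‖q ε m‖ < P ε k := by
    intro k
    filter_upwards [hq, (hP k).eventually (lt_mem_nhds (show (1 : ℝ) / 2 < 1 by norm_num))]
      with ε h1 h2 m
    exact (h1 m).trans h2
  -- Only the factor `q ^ j` changes the scales, by shifting the index of the moments. All other
  -- factors, `1 - q` and the powers of `b - q` and `P - q`, tend to act as positive constants.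
  have h1 := ((((((h.shift j).mul_sub (b := fun _ => 1) one_pos tendsto_const_nhds).prod_div_sub
    (Finset.Icc 1 t) hcκ hκ fun k => hcap _).prod_mul_sub (Finset.Icc (t + 1) 0) hcκ hκ).prod_mul_sub
    (Finset.Icc 1 n) hcθ hθ).prod_div_sub (Finset.Icc (n + 1) 0) hcθ hθ fun k => hcap _)
  have h2 := (h1.prod_div_sub Finset.univ (fun _ => one_pos) hP hPq).const_mul hA
  refine h2.congr' (Eventually.of_forall fun ε => ?_)
  ext m
  rw [Finset.prod_inv_distrib (s := (Finset.univ : Finset (Fin s)))]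
  simp only [dualWave, div_eq_mul_inv]
  ring

/-! ### The constructed family: its ndKP equation, its periodicity and its limit. -/

section family

variable {M N : ℕ} [NeZero M]

theorem eventually_momentum_bounds (L : Fin N → ℕ) : ∀ᶠ ε in 𝓝[>] 0, ∀ i,
    1 / 2 < momentum M L ε i ∧ (1 + (M : ℝ)⁻¹)⁻¹ < momentum M L ε i ∧
      (1 - momentum M L ε i) * M < (1 / 2) ^ M := by
  rw [eventually_all]
  intro i
  have hM : (0 : ℝ) < (M : ℝ)⁻¹ := inv_pos.mpr (Nat.cast_pos.mpr (NeZero.pos M))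
  have h1 := (tendsto_momentum (M := M) L i).eventually
    (lt_mem_nhds (show (1 : ℝ) / 2 < 1 by norm_num))
  have h2 := (tendsto_momentum (M := M) L i).eventually
    (lt_mem_nhds (show (1 + (M : ℝ)⁻¹)⁻¹ < 1 from inv_lt_one_of_one_lt₀ (by linarith)))
  have h3 := ((tendsto_one_sub_momentum (M := M) L i).mul_const (M : ℝ)).eventually
    (gt_mem_nhds (show 0 * (M : ℝ) < (1 / 2) ^ M by rw [zero_mul]; positivity))
  filter_upwards [h1, h2, h3] with ε h1 h2 h3 using ⟨h1, h2, h3⟩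

/-- Dual momenta and weights whose moments realize the given contents. -/
theorem exists_dual_family (L : Fin N → ℕ) (ℓ : Fin N → Fin M → ℕ) (hL : ∀ i, L i = ∑ m, ℓ i m)
    (K : Fin N → ℝ) : ∃ q α : ℝ → Fin N → Fin M → ℂ,
      (∀ᶠ ε in 𝓝[>] 0, ∀ i, Function.Injective (q ε i) ∧ ∀ m, q ε i m ≠ (momentum M L ε i : ℂ) ∧
        q ε i m ^ M * (1 - q ε i m) =
          (momentum M L ε i : ℂ) ^ M * (1 - (momentum M L ε i : ℂ)) ∧ ‖q ε i m‖ < 1 / 2) ∧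
      ∀ i, MomentFamily (fun ε => q ε i) (fun ε => α ε i) (fun j => K i - partialContent ℓ i j)
        (fun j => solitonExponent N i * j) := by
  -- Stated as an implication so that `choose` yields functions of all `ε`. Where `p` is not close
  -- enough to 1 the value 0 is taken, which has no influence on the limit.
  have hq : ∀ ε i, ∃ q : Fin M → ℂ, ((1 + (M : ℝ)⁻¹)⁻¹ < momentum M L ε i ∧
      (1 - momentum M L ε i) * M < (1 / 2) ^ M) → Function.Injective q ∧ ∀ m,
        q m ≠ (momentum M L ε i : ℂ) ∧ q m ^ M * (1 - q m) =
          (momentum M L ε i : ℂ) ^ M * (1 - (momentum M L ε i : ℂ)) := by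
    intro ε i
    by_cases h : (1 + (M : ℝ)⁻¹)⁻¹ < momentum M L ε i ∧ (1 - momentum M L ε i) * M < (1 / 2) ^ M
    · obtain ⟨q, hq⟩ := exists_dual_momenta h.1 (momentum_lt_one L ε i) h.2
      exact ⟨q, fun _ => hq⟩
    · exact ⟨0, fun h' => absurd h' h⟩
  choose q hq using hq
  have hα : ∀ ε i, ∃ α : Fin M → ℂ, Function.Injective (q ε i) → ∀ k < M,
      ∑ m, α m * q ε i m ^ k =
        (scale (K i - partialContent ℓ i k) (solitonExponent N i * k) ε : ℂ) := by
    intro ε i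
    by_cases h : Function.Injective (q ε i)
    · obtain ⟨α, hα⟩ := exists_weights_of_moments h fun k =>
        (scale (K i - partialContent ℓ i k) (solitonExponent N i * (k : ℕ)) ε : ℂ)
      exact ⟨α, fun _ k hk => hα ⟨k, hk⟩⟩
    · exact ⟨0, fun h' => absurd h' h⟩
  choose α hα using hα
  have hev : ∀ᶠ ε in 𝓝[>] 0, ∀ i, Function.Injective (q ε i) ∧ ∀ m,
      q ε i m ≠ (momentum M L ε i : ℂ) ∧ q ε i m ^ M * (1 - q ε i m) =
          (momentum M L ε i : ℂ) ^ M * (1 - (momentum M L ε i : ℂ)) ∧ ‖q ε i m‖ < 1 / 2 := by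
    filter_upwards [eventually_momentum_bounds (M := M) L] with ε h i
    obtain ⟨h1, h2, h3⟩ := h i
    obtain ⟨h4, h5⟩ := hq ε i ⟨h2, h3⟩
    exact ⟨h4, fun m => ⟨(h5 m).1, (h5 m).2, norm_lt_half_of_root (by linarith)
      (momentum_lt_one L ε i) h3 (h5 m).1 (h5 m).2⟩⟩
  refine ⟨q, α, hev, fun i => momentFamily_of_initial ℓ i (solitonExponent_pos i)
    (p := fun ε => momentum M L ε i) (fun ε => ?_) ?_ ?_⟩
  · rw [one_sub_momentum, hL]
  · filter_upwards [hev] with ε h m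
    exact pow_eq_of_root ((h i).2 m).1 ((h i).2 m).2.1
  · filter_upwards [hev] with ε h k hk
    exact hα ε i (h i).1 k hk

theorem capParam_ne_of_norm_lt {X : ℕ} {ε : ℝ} {x : ℂ} (hx : ‖x‖ < 1) :
    (capParam X ε : ℂ) - x ≠ 0 := by
  intro h
  have h1 := one_lt_capParam X ε
  rw [← sub_eq_zero.mp h, Complex.norm_real, Real.norm_of_nonneg (by linarith)] at hx
  linarith

theorem offParams_of_norm_lt {θ κ : ℤ → ℕ} {ε : ℝ} {x : ℂ} (hx : ‖x‖ < 1) (hx0 : x ≠ 0) :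
    OffParams (expParam κ ε) (expParam θ ε) (cParam M) x := by
  refine ⟨fun k => capParam_ne_of_norm_lt hx, fun k => capParam_ne_of_norm_lt hx, fun k => ?_⟩
  rcases cParam_eq_zero_or_one M k with h | h
  · rw [h, zero_sub]; exact neg_ne_zero.mpr hx0
  · rw [h]
    intro h'
    rw [← sub_eq_zero.mp h'] at hx
    simp at hx

theorem capParam_sub_cParam_ne_zero (X : ℕ) (ε : ℝ) (j : ℤ) :
    (capParam X ε : ℂ) - cParam M j ≠ 0 := by
  have h1 := one_lt_capParam X ε
  rcases cParam_eq_zero_or_one M j with h | h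
  · rw [h, sub_zero]; exact_mod_cast (by linarith : capParam X ε ≠ 0)
  · rw [h, sub_ne_zero]; exact_mod_cast h1.ne'

/-- Over one period the weight gains the factor `(1 - q) / (1 - p) * (q / p) ^ M`, from one
parameter 1 and `M` parameters 0; the equation for `q` says that this is 1. -/
theorem solitonTau_periodic {ι : Type} [Fintype ι] [DecidableEq ι] {a b : ℤ → ℂ} {α p q : ι → ℂ}
    (hp : ∀ k, OffParams a b (cParam M) (p k)) (hq : ∀ k, OffParams a b (cParam M) (q k))
    (hpq : ∀ k, q k ^ M * (1 - q k) = p k ^ M * (1 - p k)) (t n j : ℤ) :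
    solitonTau a b (cParam M) α p q t n (j + M + 1) = solitonTau a b (cParam M) α p q t n j := by
  rw [solitonTau_eq_cauchyTau, solitonTau_eq_cauchyTau]
  congr 1
  ext k
  refine periodic_of_prod_eq_one (g := fun j => solitonWeight a b (cParam M) α p q t n j k)
    (h := fun j => (cParam M j - q k) / (cParam M j - p k)) (fun j => ?_) (fun j => ?_) ?_ j
  · exact congrFun (solitonWeight_succ_j hp hq t n j) k
  · simp only [cParam_add_period]
  · rw [Finset.prod_range_succ']
    have h1 : ∀ i ∈ Finset.range M, (cParam M (((i + 1 : ℕ) : ℤ) + 1) - q k) /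
        (cParam M (((i + 1 : ℕ) : ℤ) + 1) - p k) = q k / p k := by
      intro i hi
      have := Finset.mem_range.mp hi
      rw [cParam_eq_zero (by push_cast; omega) (by push_cast; omega), zero_sub, zero_sub,
        neg_div_neg_eq]
    rw [Finset.prod_congr rfl h1, Finset.prod_const, Finset.card_range]
    simp only [Nat.cast_zero, zero_add, cParam_one]
    have h2 := (hp k).hc 1
    have h3 := (hp k).hc 2
    rw [cParam_one] at h2
    rw [cParam_eq_zero le_rfl (by have := NeZero.pos M; omega), zero_sub, neg_ne_zero] at h3
    rw [div_pow]
    have h4 : p k ^ M ≠ 0 := pow_ne_zero _ h3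
    field_simp
    exact hpq k

/-- The value of a group of solitons in terms of the phases. -/
theorem phase_sum_eq (θ κ : ℤ → ℕ) (K₀ : Fin N → ℤ) (L : Fin N → ℕ) (ℓ : Fin N → Fin M → ℕ)
    (t n : ℤ) (j : ℕ) (S : Finset (Fin N)) :
    ((∑ i ∈ S, phaseK θ κ K₀ L ℓ i (t - 1) (n - 1) j - phaseA L ℓ S j : ℤ) : ℝ) =
      ∑ k : Fin S.card, ∑ l ∈ Finset.Ioi k, (-(L (S.orderEmbOfFin rfl l) : ℝ)) +
      ∑ l : Fin S.card,
        ((((L (S.orderEmbOfFin rfl l) -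
            dirSum (fun k => ((min (κ (k - 1)) (L (S.orderEmbOfFin rfl l)) : ℕ) : ℤ)) t +
            dirSum (fun k => ((min (θ (k - 1)) (L (S.orderEmbOfFin rfl l)) : ℕ) : ℤ)) n : ℤ) : ℝ) +
          ((K₀ (S.orderEmbOfFin rfl l) + min (κ 0) (L (S.orderEmbOfFin rfl l)) -
            min (θ 0) (L (S.orderEmbOfFin rfl l)) - L (S.orderEmbOfFin rfl l) : ℤ) : ℝ)) -
          partialContent ℓ (S.orderEmbOfFin rfl l) (j + l)) := by
  rw [phaseA, sum_orderEmbOfFin S, sum_orderEmbOfFin S, sum_orderEmbOfFin S, sum_sum_Ioi,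
    ← Finset.sum_add_distrib, ← Finset.sum_sub_distrib, ← Finset.sum_add_distrib]
  push_cast
  refine Finset.sum_congr rfl fun l _ => ?_
  rw [card_filter_lt_orderEmbOfFin]
  have h1 := fun X : ℤ → ℕ =>
    dirSum_pred fun k => ((min (X k) (L (S.orderEmbOfFin rfl l)) : ℕ) : ℤ)
  push_cast at h1
  rw [h1 κ, h1 θ]
  simp only [phaseK]
  push_cast
  ring

variable (θ κ : ℤ → ℕ) {L : Fin N → ℕ} {ℓ : Fin N → Fin M → ℕ}

/-- The τ-functions of a family with prescribed moments have the piecewise linear limit. -/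
theorem udLimit_familyTau (hL_anti : Antitone L)
    (hℓ : ∀ m, Antitone fun i => ℓ i m) (K₀ : Fin N → ℤ) {q α : ℝ → Fin N → Fin M → ℂ}
    (hq : ∀ᶠ ε in 𝓝[>] 0, ∀ i m, ‖q ε i m‖ < 1 / 2)
    (hα : ∀ i, MomentFamily (fun ε => q ε i) (fun ε => α ε i)
      (fun j => ((K₀ i + min (κ 0) (L i) - min (θ 0) (L i) - L i : ℤ) : ℝ) - partialContent ℓ i j)
      (fun j => solitonExponent N i * j)) (t n : ℤ) {j : ℕ} (hj : j ≤ M) :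
    ∃ T : ℝ → ℝ, UdLimit T (solitonMax θ κ K₀ L ℓ (t - 1) (n - 1) j) ∧
      ∀ᶠ ε in 𝓝[>] 0, familyTau θ κ ε (α ε) (momentum M L ε) (q ε) t n (j + 1) = (T ε : ℂ) := by
  choose w hA using fun i => asym_realWave (M := M) L θ κ i t n j
  have hmom : ∀ (S : Finset (Fin N)) (l : Fin S.card), _ := fun S l =>
    momentFamily_wave (hα (S.orderEmbOfFin rfl l)) (hq.mono fun ε h m => h _ m) θ κ t n j
      (P := fun ε k => momentum M L ε (S.orderEmbOfFin rfl k)) (fun k => tendsto_momentum L _)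
      (hA (S.orderEmbOfFin rfl l))
  choose s δ hδ hs has using hmom
  -- `T S` is the contribution of the soliton groups in `S`. The Vandermonde product supplies the
  -- amplitude part of `phaseA`, and the diagonal of the moment determinant supplies the contents
  -- `X(j + k - 1)`.
  let T : Finset (Fin N) → ℝ → ℝ := fun S ε =>
    (∏ k : Fin S.card, ∏ l ∈ Finset.Ioi k, (momentum M L ε (S.orderEmbOfFin rfl k) -
      momentum M L ε (S.orderEmbOfFin rfl l))) *
      (Matrix.of fun k l : Fin S.card => s S l ε k).det
  have hT : ∀ S, UdLimit (T S)
      ((∑ i ∈ S, phaseK θ κ K₀ L ℓ i (t - 1) (n - 1) j - phaseA L ℓ S j : ℤ) : ℝ) := by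
    intro S
    rw [phase_sum_eq]
    have h1 : Asym (fun ε => ∏ k : Fin S.card, ∏ l ∈ Finset.Ioi k,
        (momentum M L ε (S.orderEmbOfFin rfl k) - momentum M L ε (S.orderEmbOfFin rfl l)))
        (∑ k : Fin S.card, ∑ l ∈ Finset.Ioi k, (-(L (S.orderEmbOfFin rfl l) : ℝ)))
        (∑ k : Fin S.card, ∑ l ∈ Finset.Ioi k,
          (M * solitonExponent N (S.orderEmbOfFin rfl l))) :=
      Asym.prod _ fun k _ => Asym.prod _ fun l hl => asym_momentum_sub hL_anti
        ((S.orderEmbOfFin rfl).lt_iff_lt.mpr (Finset.mem_Ioi.mp hl))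
    have h2 := asym_moment_det ℓ hℓ (S.orderEmbOfFin rfl).strictMono j
      (solitonExponent_strictAnti N) (F := fun k l ε => s S l ε k)
      (C := fun l => ((L (S.orderEmbOfFin rfl l) -
            dirSum (fun k => ((min (κ (k - 1)) (L (S.orderEmbOfFin rfl l)) : ℕ) : ℤ)) t +
            dirSum (fun k => ((min (θ (k - 1)) (L (S.orderEmbOfFin rfl l)) : ℕ) : ℤ)) n : ℤ) : ℝ) +
          ((K₀ (S.orderEmbOfFin rfl l) + min (κ 0) (L (S.orderEmbOfFin rfl l)) -
            min (θ 0) (L (S.orderEmbOfFin rfl l)) - L (S.orderEmbOfFin rfl l) : ℤ) : ℝ))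
      (Ω := fun l => w (S.orderEmbOfFin rfl l)) fun k l =>
        (has S l k).cast (add_sub_assoc _ _ _).symm rfl
    exact (h1.mul h2).udLimit
  refine ⟨fun ε => ∑ S, T S ε, ?_, ?_⟩
  · have h := UdLimit.sum Finset.univ ⟨∅, Finset.mem_univ ∅⟩ fun S _ => hT S
    have e : ((solitonMax θ κ K₀ L ℓ (t - 1) (n - 1) j : ℤ) : ℝ) =
        (Finset.univ : Finset (Finset (Fin N))).sup' ⟨∅, Finset.mem_univ ∅⟩ fun S =>
          ((∑ i ∈ S, phaseK θ κ K₀ L ℓ i (t - 1) (n - 1) j - phaseA L ℓ S j : ℤ) : ℝ) :=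
      Finset.apply_sup'_eq_sup'_comp _ (fun x : ℤ => (x : ℝ)) fun x y => Int.cast_max
    rw [e]; exact h
  · have hall : ∀ᶠ ε : ℝ in 𝓝[>] 0, ∀ (S : Finset (Fin N)) (l : Fin S.card), _ :=
      eventually_all.mpr fun S => eventually_all.mpr fun l => hs S l
    filter_upwards [hall, hq, eventually_strictAnti_momentum (M := M) hL_anti,
      eventually_momentum_bounds (M := M) L] with ε h1 h2 h3 h4
    have hinj : Function.Injective fun i => (momentum M L ε i : ℂ) :=
      Complex.ofReal_injective.comp h3.injective
    have hne : ∀ i l m, (momentum M L ε i : ℂ) - q ε l m ≠ 0 := by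
      intro i l m h
      have h5 := h2 l m
      rw [← sub_eq_zero.mp h, Complex.norm_real,
        Real.norm_of_nonneg (by linarith [(h4 i).1])] at h5
      linarith [(h4 i).1]
    rw [familyTau, solitonTau_eq_cauchyTau]
    refine (cauchyTau_prod_eq_sum (fun i m => α ε i m *
      (planeWave (expParam κ ε) (expParam θ ε) (cParam M) (momentum M L ε i) t n (j + 1) /
        planeWave (expParam κ ε) (expParam θ ε) (cParam M) (q ε i m) t n (j + 1))) (q ε)
      (fun i => (momentum M L ε i : ℂ)) hinj hne).trans ?_
    rw [Complex.ofReal_sum]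
    refine Finset.sum_congr rfl fun S _ => ?_
    simp only [T]
    rw [Complex.ofReal_mul]
    congr 1
    · push_cast; rfl
    · rw [← Complex.ofRealHom_eq_coe, RingHom.map_det]
      congr 1
      ext k l
      simp only [Matrix.of_apply, RingHom.mapMatrix_apply, Matrix.map_apply,
        Complex.ofRealHom_eq_coe]
      rw [← (h1 S l).1 k]
      refine Finset.sum_congr rfl fun m _ => ?_
      rw [planeWave_div_planeWave θ κ ε _ _ t n hj]

theorem isUltradiscreteSolitonLimit (hL : ∀ i, L i = ∑ m, ℓ i m) (hL_anti : Antitone L)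
    (hℓ : ∀ m, Antitone fun i => ℓ i m) (K₀ : Fin N → ℤ) (Y : ℤ → ℤ → ℤ → ℤ)
    (hY : ∀ t n : ℤ, ∀ j : ℕ, j ≤ M →
      Y (t + 1) (n + 1) ((j : ℤ) + 1) = solitonMax θ κ K₀ L ℓ t n j) :
    IsUltradiscreteSolitonLimit M N θ κ L Y := by
  -- The correction of `K₀` undoes the normalization of the plane wave: `-L i` cancels the factor
  -- `(1 - p)⁻¹` due to the parameter `c_1 = 1`, and the two minima cancel the boundary terms of
  -- `dirSum_pred`.
  obtain ⟨q, α, hq, hα⟩ := exists_dual_family L ℓ hL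
    fun i => ((K₀ i + min (κ 0) (L i) - min (θ 0) (L i) - L i : ℤ) : ℝ)
  refine ⟨α, momentum M L, q, ?_, fun i => (asym_one_sub_momentum (M := M) L i).tendsto_mul_log,
    fun t n j hj hj' => ?_⟩
  · filter_upwards [hq, eventually_strictAnti_momentum (M := M) hL_anti,
      eventually_momentum_bounds (M := M) L] with ε h1 h2 h3
    have hM0 : M ≠ 0 := NeZero.ne M
    have hpnorm : ∀ i, ‖(momentum M L ε i : ℂ)‖ = momentum M L ε i := fun i => by
      rw [Complex.norm_real, Real.norm_of_nonneg (by linarith [(h3 i).1])]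
    have hp0 : ∀ i, (momentum M L ε i : ℂ) ≠ 0 := fun i => by
      exact_mod_cast (by linarith [(h3 i).1] : momentum M L ε i ≠ 0)
    have hp : ∀ i, OffParams (expParam κ ε) (expParam θ ε) (cParam M) (momentum M L ε i) :=
      fun i => offParams_of_norm_lt (by rw [hpnorm]; exact momentum_lt_one L ε i) (hp0 i)
    have hqoff : ∀ i m, OffParams (expParam κ ε) (expParam θ ε) (cParam M) (q ε i m) := by
      intro i m
      refine offParams_of_norm_lt (by linarith [((h1 i).2 m).2.2]) fun h => ?_
      have h4 := ((h1 i).2 m).2.1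
      rw [h, zero_pow hM0, zero_mul] at h4
      refine mul_ne_zero (pow_ne_zero _ (hp0 i)) ?_ h4.symm
      rw [sub_ne_zero]; exact_mod_cast (momentum_lt_one L ε i).ne'
    have hne : ∀ i l m, (momentum M L ε i : ℂ) - q ε l m ≠ 0 := by
      intro i l m h
      have h5 := ((h1 l).2 m).2.2
      rw [← sub_eq_zero.mp h, hpnorm] at h5
      linarith [(h3 i).1]
    refine ⟨⟨fun i => (h3 i).2.1, momentum_lt_one L ε, h2, fun i m => ((h1 i).2 m).1,
      fun i m => ((h1 i).2 m).2.1, fun i => (h1 i).1⟩, ?_, ?_⟩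
    · refine ndKP_solitonTau (fun k => hp k.1) (fun k => hqoff k.1 k.2) (fun k l => hne _ _ _)
        (fun t j => capParam_sub_cParam_ne_zero _ ε j) fun n j => ?_
      rw [← neg_sub]
      exact neg_ne_zero.mpr (capParam_sub_cParam_ne_zero _ ε j)
    · exact solitonTau_periodic (fun k => hp k.1) (fun k => hqoff k.1 k.2)
        fun k => ((h1 k.1).2 k.2).2.1
  · obtain ⟨i, rfl⟩ : ∃ i : ℕ, j = (i : ℤ) + 1 := ⟨(j - 1).toNat, by omega⟩
    have hi : i ≤ M := by omega
    obtain ⟨T, hT, hτ⟩ := udLimit_familyTau θ κ hL_anti hℓ K₀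
      (hq.mono fun ε h i m => ((h i).2 m).2.2) hα t n hi
    have hY' := hY (t - 1) (n - 1) i hi
    rw [sub_add_cancel, sub_add_cancel] at hY'
    rw [hY']
    refine ⟨?_, (hT.congr' ?_).2⟩
    · filter_upwards [hτ, hT.1] with ε h1 h2
      rw [h1]; exact ⟨by simpa using h2, Complex.ofReal_im _⟩
    · filter_upwards [hτ] with ε h1
      rw [h1, Complex.ofReal_re]

end family

/-! ### The combinatorial R matrix -/

section Rmatrix

variable {M : ℕ}

/-- One content moves from position `i` to position `i - 1`. -/
def IsShift (i : Fin (M + 1)) (f g : Fin (M + 1) → ℕ) : Prop :=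
  g i + 1 = f i ∧ g (i - 1) = f (i - 1) + 1 ∧ ∀ l, l ≠ i → l ≠ i - 1 → g l = f l

theorem sub_one_ne_self [NeZero M] (i : Fin (M + 1)) : i - 1 ≠ i := by
  intro h
  have h1 : (1 : Fin (M + 1)) = 0 := by
    have := sub_eq_self.mp h; exact this
  have h2 := congrArg Fin.val h1
  obtain ⟨m, rfl⟩ : ∃ m, M = m + 1 := ⟨M - 1, (Nat.sub_add_cancel (NeZero.pos M)).symm⟩
  simp at h2

theorem crystal_ext {k : ℕ} {b c : Crystal M k} (h : ∀ l, b.1 l = c.1 l) : b = c :=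
  Subtype.ext (funext h)

theorem move_eq_some_iff {k : ℕ} {i j : Fin (M + 1)} (hij : j ≠ i) {b c : Crystal M k} :
    move i j b = some c ↔ c.1 i + 1 = b.1 i ∧ c.1 j = b.1 j + 1 ∧
      ∀ l, l ≠ i → l ≠ j → c.1 l = b.1 l := by
  unfold move
  split_ifs with h
  · refine Option.some_inj.trans ?_
    constructor
    · rintro rfl
      refine ⟨?_, ?_, fun l h1 h2 => ?_⟩
      · simp only [Pi.single_eq_same, Pi.single_eq_of_ne hij.symm]; omega
      · simp [Pi.single_eq_of_ne hij]
      · simp [Pi.single_eq_of_ne h1, Pi.single_eq_of_ne h2]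
    · rintro ⟨h1, h2, h3⟩
      refine crystal_ext fun l => ?_
      by_cases hl : l = i
      · subst hl; simp only [Pi.single_eq_same, Pi.single_eq_of_ne hij.symm]; omega
      · by_cases hl' : l = j
        · subst hl'; simp only [Pi.single_eq_same, Pi.single_eq_of_ne hij]; omega
        · simp only [Pi.single_eq_of_ne hl, Pi.single_eq_of_ne hl']
          have := h3 l hl hl'
          omega
  · simp only [false_iff]
    rintro ⟨h1, -⟩
    omega

variable [NeZero M]

theorem eOp_eq_some_iff {k : ℕ} {i : Fin (M + 1)} {b c : Crystal M k} :
    eOp i b = some c ↔ IsShift i b.1 c.1 :=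
  move_eq_some_iff (sub_one_ne_self i)

theorem fOp_eq_some_iff {k : ℕ} {i : Fin (M + 1)} {b c : Crystal M k} :
    fOp i b = some c ↔ IsShift i c.1 b.1 := by
  rw [fOp, move_eq_some_iff (sub_one_ne_self i).symm]
  constructor
  · rintro ⟨h1, h2, h3⟩
    exact ⟨h2.symm, h1.symm, fun l hl hl' => (h3 l hl' hl).symm⟩
  · rintro ⟨h1, h2, h3⟩
    exact ⟨h2.symm, h1.symm, fun l hl hl' => (h3 l hl' hl).symm⟩

theorem eOp_eq_none_iff {k : ℕ} {i : Fin (M + 1)} {b : Crystal M k} :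
    eOp i b = none ↔ b.1 i = 0 := by
  unfold eOp move
  split_ifs with h
  · simp only [false_iff]; omega
  · simp only [true_iff]; omega

theorem tensorE_eq_some_iff {k l : ℕ} {i : Fin (M + 1)} {a b : Crystal M k × Crystal M l} :
    tensorE i a = some b ↔
      (a.2.1 i ≤ a.1.1 (i - 1) ∧ IsShift i a.1.1 b.1.1 ∧ b.2 = a.2) ∨
      (a.1.1 (i - 1) < a.2.1 i ∧ b.1 = a.1 ∧ IsShift i a.2.1 b.2.1) := by
  obtain ⟨x, y⟩ := a
  obtain ⟨x', y'⟩ := b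
  unfold tensorE epsilon phi
  split_ifs with h
  · simp only [Option.map_eq_some_iff, eOp_eq_some_iff, Prod.mk.injEq, h, true_and, not_lt.mpr h,
      false_and, or_false]
    constructor
    · rintro ⟨z, hz, rfl, rfl⟩; exact ⟨hz, rfl⟩
    · rintro ⟨hz, rfl⟩; exact ⟨x', hz, rfl, rfl⟩
  · simp only [Option.map_eq_some_iff, eOp_eq_some_iff, Prod.mk.injEq, h, false_and, false_or,
      not_le.mp h, true_and]
    constructor
    · rintro ⟨z, hz, rfl, rfl⟩; exact ⟨rfl, hz⟩
    · rintro ⟨rfl, hz⟩; exact ⟨y', hz, rfl, rfl⟩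

theorem tensorF_eq_some_iff {k l : ℕ} {i : Fin (M + 1)} {a b : Crystal M k × Crystal M l} :
    tensorF i a = some b ↔
      (a.2.1 i < a.1.1 (i - 1) ∧ IsShift i b.1.1 a.1.1 ∧ b.2 = a.2) ∨
      (a.1.1 (i - 1) ≤ a.2.1 i ∧ b.1 = a.1 ∧ IsShift i b.2.1 a.2.1) := by
  obtain ⟨x, y⟩ := a
  obtain ⟨x', y'⟩ := b
  unfold tensorF epsilon phi
  split_ifs with h
  · simp only [Option.map_eq_some_iff, fOp_eq_some_iff, Prod.mk.injEq, h, true_and, not_le.mpr h,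
      false_and, or_false]
    constructor
    · rintro ⟨z, hz, rfl, rfl⟩; exact ⟨hz, rfl⟩
    · rintro ⟨hz, rfl⟩; exact ⟨x', hz, rfl, rfl⟩
  · simp only [Option.map_eq_some_iff, fOp_eq_some_iff, Prod.mk.injEq, h, false_and, false_or,
      not_lt.mp h, true_and]
    constructor
    · rintro ⟨z, hz, rfl, rfl⟩; exact ⟨rfl, hz⟩
    · rintro ⟨rfl, hz⟩; exact ⟨y', hz, rfl, rfl⟩

theorem tensorE_eq_none_iff {k l : ℕ} {i : Fin (M + 1)} {a : Crystal M k × Crystal M l} :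
    tensorE i a = none ↔ a.2.1 i ≤ a.1.1 (i - 1) ∧ a.1.1 i = 0 := by
  unfold tensorE epsilon phi
  split_ifs with h
  · simp [eOp_eq_none_iff, h]
  · simp only [Option.map_eq_none_iff, eOp_eq_none_iff, h, false_and, iff_false]
    omega

/-- On tensor products, too, the operators `f̃_i` and `ẽ_i` are inverse to each other. -/
theorem tensorF_eq_some_iff_tensorE {k l : ℕ} {i : Fin (M + 1)} {a b : Crystal M k × Crystal M l} :
    tensorF i a = some b ↔ tensorE i b = some a := by
  rw [tensorF_eq_some_iff, tensorE_eq_some_iff]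
  constructor
  · rintro (⟨h1, h2, h3⟩ | ⟨h1, h2, h3⟩)
    · refine Or.inl ⟨?_, h2, h3.symm⟩
      rw [h3]; have := h2.2.1; omega
    · refine Or.inr ⟨?_, h2.symm, h3⟩
      rw [h2]; have := h3.1; omega
  · rintro (⟨h1, h2, h3⟩ | ⟨h1, h2, h3⟩)
    · refine Or.inl ⟨?_, h2, h3.symm⟩
      rw [h3]; have := h2.2.1; omega
    · refine Or.inr ⟨?_, h2.symm, h3⟩
      rw [h2]; have := h3.1; omega

/-- As `f̃_i` is the partial inverse of `ẽ_i` and `R` is a bijection, commuting with all `ẽ_i`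
suffices. -/
theorem isCombinatorialR_of_tensorE {k l : ℕ}
    {R : (Crystal M k × Crystal M l) ≃ (Crystal M l × Crystal M k)}
    (h : ∀ i x, (tensorE i x).map R = tensorE i (R x)) : IsCombinatorialR R := by
  refine fun i x => ⟨h i x, Option.ext fun b => ?_⟩
  rw [Option.map_eq_some_iff, tensorF_eq_some_iff_tensorE]
  have key : tensorE i b = some (R x) ↔ tensorE i (R.symm b) = some x := by
    have h1 := h i (R.symm b)
    rw [Equiv.apply_symm_apply] at h1
    rw [← h1, Option.map_eq_some_iff]
    constructor
    · rintro ⟨c, hc, hcx⟩; rw [hc, R.injective hcx]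
    · intro hc; exact ⟨x, hc, rfl⟩
  rw [key]
  constructor
  · rintro ⟨c, hc, rfl⟩
    rw [Equiv.symm_apply_apply]; exact tensorF_eq_some_iff_tensorE.mp hc
  · intro hc
    exact ⟨R.symm b, tensorF_eq_some_iff_tensorE.mpr hc, R.apply_symm_apply b⟩

theorem IsCombinatorialR.symm {k l : ℕ}
    {R : (Crystal M k × Crystal M l) ≃ (Crystal M l × Crystal M k)} (h : IsCombinatorialR R) :
    IsCombinatorialR R.symm := by
  refine isCombinatorialR_of_tensorE fun i x => ?_
  have h1 := (h i (R.symm x)).1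
  rw [Equiv.apply_symm_apply] at h1
  rw [← h1, Option.map_map]
  simp

/-! ### Loads -/

/-- The load of a carrier with free places `x` passing the boxes `y` around the circle. -/
def IsLoad (x y H : Fin (M + 1) → ℕ) : Prop := ∀ p, H (p - 1) = y p + (H p - x p)

/-- The load of a carrier which starts with the load `h`. -/
def loadIter (x y : Fin (M + 1) → ℕ) (h : ℕ) : ℕ → ℕ
  | 0 => h
  | m + 1 => y (-Fin.ofNat (M + 1) m) + (loadIter x y h m - x (-Fin.ofNat (M + 1) m))

/-- One step is `h ↦ max (h + y - x) y`, an affine map in the max-plus sense, and such maps are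
closed under composition. -/
theorem exists_loadIter_eq_max (x y : Fin (M + 1) → ℕ) (m : ℕ) : ∃ c : ℕ, ∀ h : ℕ,
    (loadIter x y h m : ℤ) = max (h + (∑ i ∈ Finset.range m, (y (-Fin.ofNat (M + 1) i) : ℤ) -
      ∑ i ∈ Finset.range m, (x (-Fin.ofNat (M + 1) i) : ℤ))) c := by
  induction m with
  | zero => exact ⟨0, fun h => by simp [loadIter]⟩
  | succ m ih =>
    obtain ⟨c, hc⟩ := ih
    refine ⟨y (-Fin.ofNat (M + 1) m) + (c - x (-Fin.ofNat (M + 1) m)), fun h => ?_⟩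
    have := hc h
    simp only [loadIter, Finset.sum_range_succ]
    omega

theorem sum_range_neg_ofNat (f : Fin (M + 1) → ℕ) :
    ∑ i ∈ Finset.range (M + 1), (f (-Fin.ofNat (M + 1) i) : ℤ) = ((∑ p, f p : ℕ) : ℤ) := by
  rw [Finset.sum_range]
  push_cast
  rw [← Equiv.sum_comp (Equiv.neg (Fin (M + 1))) fun p => (f p : ℤ)]
  refine Finset.sum_congr rfl fun p _ => ?_
  have : Fin.ofNat (M + 1) (p : ℕ) = p := Fin.ext (Nat.mod_eq_of_lt p.2)
  rw [this]; rfl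

theorem exists_loadIter_period (x y : Fin (M + 1) → ℕ) : ∃ c : ℕ, ∀ h : ℕ,
    (loadIter x y h (M + 1) : ℤ) = max (h + (((∑ p, y p : ℕ) : ℤ) - ((∑ p, x p : ℕ) : ℤ))) c := by
  obtain ⟨c, hc⟩ := exists_loadIter_eq_max x y (M + 1)
  refine ⟨c, fun h => ?_⟩
  rw [hc, sum_range_neg_ofNat, sum_range_neg_ofNat]

theorem ofNat_succ_eq (m : ℕ) : Fin.ofNat (M + 1) (m + 1) = Fin.ofNat (M + 1) m + 1 := by
  ext; simp [Fin.val_add]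

theorem ofNat_period : Fin.ofNat (M + 1) (M + 1) = 0 := by
  ext; simp

theorem IsLoad.apply_neg_ofNat {x y H : Fin (M + 1) → ℕ} (h : IsLoad x y H) (m : ℕ) :
    H (-Fin.ofNat (M + 1) m) = loadIter x y (H 0) m := by
  induction m with
  | zero => simp [loadIter]
  | succ m ih =>
    rw [ofNat_succ_eq, neg_add, ← sub_eq_add_neg, h, ih, loadIter]

/-- A load is a fixed point of the trip once around the circle, `h ↦ max (h + ∑ y - ∑ x) c`. If `∑ y
≤ ∑ x`, then `c` is one. Positions decrease along the trip, so the load at `p` is the iterate with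
index `-p`. -/
theorem exists_isLoad (x y : Fin (M + 1) → ℕ) (hxy : ∑ p, y p ≤ ∑ p, x p) :
    ∃ H, IsLoad x y H := by
  obtain ⟨c, hc⟩ := exists_loadIter_period x y
  have hfix : loadIter x y c (M + 1) = c := by
    have := hc c
    omega
  refine ⟨fun p => loadIter x y c ((-p : Fin (M + 1)) : ℕ), fun p => ?_⟩
  have e : loadIter x y c ((-(p - 1) : Fin (M + 1)) : ℕ) =
      loadIter x y c (((-p : Fin (M + 1)) : ℕ) + 1) := by
    rw [neg_sub, sub_eq_neg_add, Fin.val_add_one]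
    split_ifs with h
    · rw [h, Fin.val_last, hfix]; rfl
    · rfl
  simp only [e, loadIter]
  have : Fin.ofNat (M + 1) ((-p : Fin (M + 1)) : ℕ) = -p := Fin.ext (Nat.mod_eq_of_lt (-p).2)
  rw [this, neg_neg]

/-- With `∑ y < ∑ x` the affine branch strictly decreases, so `c` is the only fixed point, and the
load at position 0 determines all others. -/
theorem IsLoad.unique {x y H H' : Fin (M + 1) → ℕ} (hxy : ∑ p, y p < ∑ p, x p)
    (h : IsLoad x y H) (h' : IsLoad x y H') : H = H' := by
  obtain ⟨c, hc⟩ := exists_loadIter_period x y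
  have h0 : ∀ {H}, IsLoad x y H → H 0 = c := by
    intro H h
    have h1 := h.apply_neg_ofNat (M + 1)
    rw [ofNat_period, neg_zero] at h1
    have h2 := hc (H 0)
    rw [← h1] at h2
    omega
  have hall : ∀ {H}, IsLoad x y H → ∀ p, H p = loadIter x y c ((-p : Fin (M + 1)) : ℕ) := by
    intro H h p
    have h1 := h.apply_neg_ofNat ((-p : Fin (M + 1)) : ℕ)
    rw [h0 h] at h1
    rw [← h1]
    congr 1
    have : Fin.ofNat (M + 1) ((-p : Fin (M + 1)) : ℕ) = -p := Fin.ext (Nat.mod_eq_of_lt (-p).2)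
    rw [this, neg_neg]
  ext p
  rw [hall h, hall h']

theorem sum_sub_one (f : Fin (M + 1) → ℕ) : ∑ p, f (p - 1) = ∑ p, f p :=
  Equiv.sum_comp (Equiv.subRight 1) f

theorem IsLoad.sum_min {x y H : Fin (M + 1) → ℕ} (h : IsLoad x y H) :
    ∑ p, min (x p) (H p) = ∑ p, y p := by
  have h1 : ∑ p, (H (p - 1) + min (x p) (H p)) = ∑ p, (y p + H p) :=
    Finset.sum_congr rfl fun p _ => by have := h p; omega
  rw [Finset.sum_add_distrib, Finset.sum_add_distrib, sum_sub_one] at h1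
  omega

theorem IsLoad.sum_rest {x y H : Fin (M + 1) → ℕ} (h : IsLoad x y H) :
    ∑ p, (y p + (x p - H p)) = ∑ p, x p := by
  have h1 : ∑ p, ((y p + (x p - H p)) + min (x p) (H p)) = ∑ p, (x p + y p) :=
    Finset.sum_congr rfl fun p _ => by omega
  have h2 : ∑ p, (x p + y p) = ∑ p, x p + ∑ p, y p := Finset.sum_add_distrib
  rw [h2, Finset.sum_add_distrib, h.sum_min] at h1
  omega

/-- A load can be recovered from the outcome. -/
theorem IsLoad.reverse {x y H : Fin (M + 1) → ℕ} (h : IsLoad x y H) :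
    IsLoad (fun p => y (-p) + (x (-p) - H (-p))) (fun p => min (x (-p)) (H (-p)))
      (fun p => H (-p - 1)) := by
  intro p
  have h1 := h (-p)
  have h2 : -(p - 1) - 1 = -p := by rw [neg_sub, sub_sub_cancel_left]
  simp only [h2]
  omega

/-! ### The R matrix for `l < k`, built from loads. -/

section outcome

variable {k l : ℕ}

/-- The outcome of a carrier `a.1` with free places passing the boxes `a.2`. -/
def loadOutcome (a : Crystal M k × Crystal M l) (H : Fin (M + 1) → ℕ) (h : IsLoad a.1.1 a.2.1 H) :
    Crystal M l × Crystal M k :=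
  (⟨fun p => min (a.1.1 p) (H p), h.sum_min.trans a.2.2⟩,
    ⟨fun p => a.2.1 p + (a.1.1 p - H p), h.sum_rest.trans a.1.2⟩)

theorem Crystal.sum_lt (hkl : l < k) (a : Crystal M k × Crystal M l) :
    ∑ p, a.2.1 p < ∑ p, a.1.1 p := by
  rw [a.1.2, a.2.2]; exact hkl

/-- The combinatorial R matrix on `B_k ⊗ B_l` for `l < k`, as a map. -/
def crystalRFun (hkl : l < k) (a : Crystal M k × Crystal M l) : Crystal M l × Crystal M k :=
  loadOutcome a _ (exists_isLoad a.1.1 a.2.1 (Crystal.sum_lt hkl a).le).choose_spec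

theorem crystalRFun_eq (hkl : l < k) {a : Crystal M k × Crystal M l} {H : Fin (M + 1) → ℕ}
    (h : IsLoad a.1.1 a.2.1 H) : crystalRFun hkl a = loadOutcome a H h := by
  have := IsLoad.unique (Crystal.sum_lt hkl a) h
    (exists_isLoad a.1.1 a.2.1 (Crystal.sum_lt hkl a).le).choose_spec
  subst this
  rfl

/-- By `IsLoad.reverse` the outcome, read in the opposite direction around the circle, has the
reversed load as a load of its own. By uniqueness the outcome determines the load, and the two
together determine the input. -/
theorem crystalRFun_injective (hkl : l < k) :
    Function.Injective (crystalRFun (M := M) hkl) := by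
  intro a a' haa
  obtain ⟨H, h⟩ := exists_isLoad a.1.1 a.2.1 (Crystal.sum_lt hkl a).le
  obtain ⟨H', h'⟩ := exists_isLoad a'.1.1 a'.2.1 (Crystal.sum_lt hkl a').le
  rw [crystalRFun_eq hkl h, crystalRFun_eq hkl h'] at haa
  have e1 : ∀ p, min (a.1.1 p) (H p) = min (a'.1.1 p) (H' p) := fun p =>
    congrFun (congrArg (fun b => b.1.1) haa) p
  have e2 : ∀ p, a.2.1 p + (a.1.1 p - H p) = a'.2.1 p + (a'.1.1 p - H' p) := fun p =>
    congrFun (congrArg (fun b => b.2.1) haa) p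
  have hr := h.reverse
  have hr' := h'.reverse
  simp only [← e1, ← e2] at hr'
  have hsum : ∑ p, min (a.1.1 (-p)) (H (-p)) < ∑ p, (a.2.1 (-p) + (a.1.1 (-p) - H (-p))) := by
    refine ((Equiv.sum_comp (Equiv.neg (Fin (M + 1))) fun p => min (a.1.1 p) (H p)).trans
      h.sum_min).trans_lt ((Crystal.sum_lt hkl a).trans_eq ?_)
    exact ((Equiv.sum_comp (Equiv.neg (Fin (M + 1))) fun p =>
      a.2.1 p + (a.1.1 p - H p)).trans h.sum_rest).symm
  have hH := hr.unique hsum hr'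
  have hH' : ∀ p, H p = H' p := by
    intro p
    have := congrFun hH (-(p + 1))
    simpa using this
  refine Prod.ext (crystal_ext fun p => ?_) (crystal_ext fun p => ?_)
  · have := e1 p; have := e2 p; have := h p; have := h' p; have := hH' p; have := hH' (p - 1)
    omega
  · have := e1 p; have := e2 p; have := h p; have := h' p; have := hH' p; have := hH' (p - 1)
    omega

instance : Finite (Crystal M k) := by
  have hle : ∀ (b : Crystal M k) (p), b.1 p < k + 1 := fun b p => by
    have := Finset.single_le_sum (f := b.1) (fun _ _ => Nat.zero_le _) (Finset.mem_univ p)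
    have := b.2
    omega
  refine Finite.of_injective (fun (b : Crystal M k) (p : Fin (M + 1)) =>
    (⟨b.1 p, hle b p⟩ : Fin (k + 1))) fun b c h => crystal_ext fun p => ?_
  exact congrArg Fin.val (congrFun h p)

/-- Followed by `Prod.swap`, the map is an injective self-map of a finite set. -/
theorem crystalRFun_bijective (hkl : l < k) : Function.Bijective (crystalRFun (M := M) hkl) := by
  have h : Function.Bijective fun a => (crystalRFun (M := M) hkl a).swap :=
    Finite.injective_iff_bijective.mp (Prod.swap_injective.comp (crystalRFun_injective hkl))
  exact (Function.Bijective.of_comp_iff' Prod.swap_bijective _).mp h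

/-- The combinatorial R matrix on `B_k ⊗ B_l` for `l < k`. -/
def crystalR (hkl : l < k) : (Crystal M k × Crystal M l) ≃ (Crystal M l × Crystal M k) :=
  Equiv.ofBijective (crystalRFun hkl) (crystalRFun_bijective hkl)

theorem crystalR_eq (hkl : l < k) {a : Crystal M k × Crystal M l} {H : Fin (M + 1) → ℕ}
    (h : IsLoad a.1.1 a.2.1 H) : crystalR hkl a = loadOutcome a H h :=
  crystalRFun_eq hkl h

/-- The operator `ẽ_i` changes the load at most at `i - 1`. If it acts on the carrier and `x i ≤ H
i`, that load grows by one and `ẽ_i` acts on the first factor of the outcome; if `H i < x i`, the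
load stays and `ẽ_i` acts on the second. If it acts on the box, the load drops by one and again the
second factor is hit. -/
theorem tensorE_crystalR (hkl : l < k) (i : Fin (M + 1)) (a : Crystal M k × Crystal M l) :
    (tensorE i a).map (crystalR hkl) = tensorE i (crystalR hkl a) := by
  obtain ⟨H, h⟩ := exists_isLoad a.1.1 a.2.1 (Crystal.sum_lt hkl a).le
  have hi := sub_one_ne_self i
  have h1 := h i
  have h2 := h (i - 1)
  have hi2 : i - 1 - 1 ≠ i - 1 := sub_one_ne_self (i - 1)
  have hsub : ∀ p, p ≠ i → p - 1 ≠ i - 1 := fun p hp hp' => hp (sub_left_injective hp')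
  rw [crystalR_eq hkl h]
  rcases hE : tensorE i a with _ | b
  · rw [tensorE_eq_none_iff] at hE
    rw [Option.map_none, eq_comm, tensorE_eq_none_iff]
    simp only [loadOutcome]
    omega
  · rw [tensorE_eq_some_iff] at hE
    rw [Option.map_some, eq_comm]
    obtain ⟨x, y⟩ := a
    obtain ⟨x', y'⟩ := b
    simp only at h hE h1 h2
    rcases hE with ⟨h3, ⟨h4, h5, h6⟩, rfl⟩ | ⟨h3, rfl, h4, h5, h6⟩
    · by_cases hH : x.1 i ≤ H i
      · have hload : IsLoad x'.1 y'.1 (Function.update H (i - 1) (H (i - 1) + 1)) := by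
          intro p
          by_cases hp : p = i
          · subst hp
            rw [Function.update_self, Function.update_of_ne hi.symm]; omega
          · by_cases hp' : p = i - 1
            · subst hp'
              rw [Function.update_self, Function.update_of_ne hi2]; omega
            · rw [Function.update_of_ne hp', Function.update_of_ne (hsub p hp), h6 p hp hp']
              exact h p
        rw [crystalR_eq hkl hload, tensorE_eq_some_iff]
        refine Or.inl ⟨?_, ⟨?_, ?_, fun p hp hp' => ?_⟩, crystal_ext fun p => ?_⟩
        · simp only [loadOutcome]; omega
        · simp only [loadOutcome, Function.update_of_ne hi.symm]; omega
        · simp only [loadOutcome, Function.update_self]; omega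
        · simp only [loadOutcome, Function.update_of_ne hp', h6 p hp hp']
        · simp only [loadOutcome]
          by_cases hp : p = i
          · subst hp
            rw [Function.update_of_ne hi.symm]; omega
          · by_cases hp' : p = i - 1
            · subst hp'
              rw [Function.update_self]; omega
            · rw [Function.update_of_ne hp', h6 p hp hp']
      · have hload : IsLoad x'.1 y'.1 H := by
          intro p
          by_cases hp : p = i
          · subst hp; omega
          · by_cases hp' : p = i - 1
            · subst hp'; omega
            · rw [h6 p hp hp']
              exact h p
        rw [crystalR_eq hkl hload, tensorE_eq_some_iff]
        refine Or.inr ⟨?_, crystal_ext fun p => ?_, ?_, ?_, fun p hp hp' => ?_⟩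
        · simp only [loadOutcome]; omega
        · simp only [loadOutcome]
          by_cases hp : p = i
          · subst hp; omega
          · by_cases hp' : p = i - 1
            · subst hp'; omega
            · rw [h6 p hp hp']
        · simp only [loadOutcome]; omega
        · simp only [loadOutcome]; omega
        · simp only [loadOutcome, h6 p hp hp']
    · have hload : IsLoad x'.1 y'.1 (Function.update H (i - 1) (H (i - 1) - 1)) := by
        intro p
        by_cases hp : p = i
        · subst hp
          rw [Function.update_self, Function.update_of_ne hi.symm]; omega
        · by_cases hp' : p = i - 1
          · subst hp'
            rw [Function.update_self, Function.update_of_ne hi2]; omega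
          · rw [Function.update_of_ne hp', Function.update_of_ne (hsub p hp), h6 p hp hp']
            exact h p
      rw [crystalR_eq hkl hload, tensorE_eq_some_iff]
      refine Or.inr ⟨?_, crystal_ext fun p => ?_, ?_, ?_, fun p hp hp' => ?_⟩
      · simp only [loadOutcome]; omega
      · simp only [loadOutcome]
        by_cases hp' : p = i - 1
        · subst hp'
          rw [Function.update_self]; omega
        · rw [Function.update_of_ne hp']
      · simp only [loadOutcome, Function.update_of_ne hi.symm]; omega
      · simp only [loadOutcome, Function.update_self]; omega
      · simp only [loadOutcome, Function.update_of_ne hp', h6 p hp hp']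

theorem isCombinatorialR_crystalR (hkl : l < k) :
    IsCombinatorialR (crystalR (M := M) hkl) :=
  isCombinatorialR_of_tensorE (tensorE_crystalR hkl)

end outcome

end Rmatrix

/-! ### The ultradiscrete equations -/

theorem udLimit_capParam (X : ℕ) : UdLimit (capParam X) 0 := by
  obtain ⟨c, hc, h⟩ := exists_tendsto_capParam X
  exact (Asym.of_tendsto hc h).udLimit

theorem udLimit_capParam_sub_one (X : ℕ) : UdLimit (fun ε => capParam X ε - 1) (-(X : ℝ)) := by
  refine (Asym.scale (-(X : ℝ)) 0).udLimit.congr' (Eventually.of_forall fun ε => ?_)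
  simp [capParam, scale]

/-- The sign of `capParam K - capParam Θ` is not fixed, so this difference is split as `(capParam K
- 1) - (capParam Θ - 1)` and the negative terms are moved across: both sides are then sums of
positive terms. -/
theorem ud_bilinear_zero {K Θ : ℕ} {X W Z : ℝ → ℝ} {x w z : ℤ} (hX : UdLimit X x)
    (hW : UdLimit W w) (hZ : UdLimit Z z)
    (h : ∀ᶠ ε in 𝓝[>] 0, capParam Θ ε * X ε - capParam K ε * W ε +
      (capParam K ε - capParam Θ ε) * Z ε = 0) :
    max x (z - K) = max w (z - Θ) := by
  have h1 := ((udLimit_capParam Θ).mul hX).add ((udLimit_capParam_sub_one K).mul hZ)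
  have h2 := ((udLimit_capParam K).mul hW).add ((udLimit_capParam_sub_one Θ).mul hZ)
  have h3 := (h1.congr' (by filter_upwards [h] with ε hε; linarith)).unique h2
  rw [zero_add, zero_add, neg_add_eq_sub, neg_add_eq_sub] at h3
  exact_mod_cast h3

theorem ud_bilinear_one {K Θ : ℕ} {X W Z : ℝ → ℝ} {x w z : ℤ} (hX : UdLimit X x)
    (hW : UdLimit W w) (hZ : UdLimit Z z)
    (h : ∀ᶠ ε in 𝓝[>] 0, (capParam Θ ε - 1) * X ε + (1 - capParam K ε) * W ε +
      (capParam K ε - capParam Θ ε) * Z ε = 0) :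
    max (x - Θ) (z - K) = max (w - K) (z - Θ) := by
  have h1 := ((udLimit_capParam_sub_one Θ).mul hX).add ((udLimit_capParam_sub_one K).mul hZ)
  have h2 := ((udLimit_capParam_sub_one K).mul hW).add ((udLimit_capParam_sub_one Θ).mul hZ)
  have h3 := (h1.congr' (by filter_upwards [h] with ε hε; linarith)).unique h2
  rw [neg_add_eq_sub, neg_add_eq_sub, neg_add_eq_sub, neg_add_eq_sub] at h3
  exact_mod_cast h3

/-- The ultradiscrete limit of the nonautonomous discrete KP equation. -/
theorem IsUltradiscreteSolitonLimit.ultradiscreteKP {M N : ℕ} [NeZero M] {θ κ : ℤ → ℕ}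
    {L : Fin N → ℕ} {Y : ℤ → ℤ → ℤ → ℤ} (h : IsUltradiscreteSolitonLimit M N θ κ L Y) (t n : ℤ) :
    (∀ j : ℤ, 1 ≤ j → j ≤ M →
      max (Y t n j + Y (t + 1) (n + 1) (j + 1)) (Y t (n + 1) j + Y (t + 1) n (j + 1) - κ t) =
      max (Y (t + 1) (n + 1) j + Y t n (j + 1)) (Y t (n + 1) j + Y (t + 1) n (j + 1) - θ n)) ∧
    max (Y t n (M + 1) + Y (t + 1) (n + 1) 1 - θ n) (Y t (n + 1) (M + 1) + Y (t + 1) n 1 - κ t) =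
      max (Y (t + 1) (n + 1) (M + 1) + Y t n 1 - κ t)
        (Y t (n + 1) (M + 1) + Y (t + 1) n 1 - θ n) := by
  obtain ⟨α, p, q, hε, -, hlim⟩ := h
  have hM := NeZero.pos M
  have hud : ∀ t n j : ℤ, 1 ≤ j → j ≤ (M : ℤ) + 1 →
      UdLimit (fun ε => (familyTau θ κ ε (α ε) (p ε) (q ε) t n j).re) (Y t n j) := fun t n j h1 h2 =>
    ⟨(hlim t n j h1 h2).1.mono fun ε h => h.1, (hlim t n j h1 h2).2⟩
  have hre : ∀ t n j : ℤ, 1 ≤ j → j ≤ (M : ℤ) + 1 → ∀ᶠ ε in 𝓝[>] (0 : ℝ),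
      familyTau θ κ ε (α ε) (p ε) (q ε) t n j =
        ((familyTau θ κ ε (α ε) (p ε) (q ε) t n j).re : ℂ) := by
    intro t n j h1 h2
    filter_upwards [(hlim t n j h1 h2).1] with ε h
    exact Complex.ext (by simp) (by simpa using h.2)
  have hadd : ∀ {f g : ℝ → ℝ} {x y : ℤ}, UdLimit f x → UdLimit g y →
      UdLimit (fun ε => f ε * g ε) ((x + y : ℤ) : ℝ) := by
    intro f g x y hf hg
    rw [Int.cast_add]; exact hf.mul hg
  constructor
  · intro j h1 h2
    refine ud_bilinear_zero
      (hadd (hud t n j h1 (by omega)) (hud (t + 1) (n + 1) (j + 1) (by omega) (by omega)))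
      (hadd (hud (t + 1) (n + 1) j h1 (by omega)) (hud t n (j + 1) (by omega) (by omega)))
      (hadd (hud t (n + 1) j h1 (by omega)) (hud (t + 1) n (j + 1) (by omega) (by omega))) ?_
    filter_upwards [hε, hre t n j h1 (by omega),
      hre (t + 1) (n + 1) (j + 1) (by omega) (by omega), hre (t + 1) (n + 1) j h1 (by omega),
      hre t n (j + 1) (by omega) (by omega), hre t (n + 1) j h1 (by omega),
      hre (t + 1) n (j + 1) (by omega) (by omega)] with ε h3 e1 e2 e3 e4 e5 e6
    have h4 := h3.2.1 t n j
    rw [e1, e2, e3, e4, e5, e6, expParam_eq, expParam_eq, add_sub_cancel_right,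
      add_sub_cancel_right, cParam_eq_zero (by omega) (by omega)] at h4
    have h5 : (capParam (θ n) ε : ℂ) * ((familyTau θ κ ε (α ε) (p ε) (q ε) t n j).re *
        (familyTau θ κ ε (α ε) (p ε) (q ε) (t + 1) (n + 1) (j + 1)).re) -
        capParam (κ t) ε * ((familyTau θ κ ε (α ε) (p ε) (q ε) (t + 1) (n + 1) j).re *
        (familyTau θ κ ε (α ε) (p ε) (q ε) t n (j + 1)).re) +
        (capParam (κ t) ε - capParam (θ n) ε) *
        ((familyTau θ κ ε (α ε) (p ε) (q ε) t (n + 1) j).re *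
        (familyTau θ κ ε (α ε) (p ε) (q ε) (t + 1) n (j + 1)).re) = 0 := by
      linear_combination h4
    exact_mod_cast h5
  · refine ud_bilinear_one
      (hadd (hud t n (M + 1) (by omega) le_rfl) (hud (t + 1) (n + 1) 1 le_rfl (by omega)))
      (hadd (hud (t + 1) (n + 1) (M + 1) (by omega) le_rfl) (hud t n 1 le_rfl (by omega)))
      (hadd (hud t (n + 1) (M + 1) (by omega) le_rfl) (hud (t + 1) n 1 le_rfl (by omega))) ?_
    filter_upwards [hε, hre t n (M + 1) (by omega) le_rfl, hre (t + 1) (n + 1) 1 le_rfl (by omega),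
      hre (t + 1) (n + 1) (M + 1) (by omega) le_rfl, hre t n 1 le_rfl (by omega),
      hre t (n + 1) (M + 1) (by omega) le_rfl, hre (t + 1) n 1 le_rfl (by omega)]
      with ε h3 e1 e2 e3 e4 e5 e6
    have h4 := h3.2.1 t n (M + 1)
    -- At `j = M + 1` the next index is brought back to 1 by periodicity, and the parameter there is
    -- 1 instead of 0.
    have hper : ∀ t n : ℤ, familyTau θ κ ε (α ε) (p ε) (q ε) t n (M + 1 + 1) =
        familyTau θ κ ε (α ε) (p ε) (q ε) t n 1 := by
      intro t n
      rw [← h3.2.2 t n 1]; congr 1; ring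
    have hc : cParam M ((M : ℤ) + 1 + 1) = 1 := by
      rw [add_comm, cParam_add_period, cParam_one]
    rw [hper, hper, hper, e1, e2, e3, e4, e5, e6, expParam_eq, expParam_eq, add_sub_cancel_right,
      add_sub_cancel_right, hc] at h4
    have h5 : ((capParam (θ n) ε : ℂ) - 1) *
        ((familyTau θ κ ε (α ε) (p ε) (q ε) t n (M + 1)).re *
        (familyTau θ κ ε (α ε) (p ε) (q ε) (t + 1) (n + 1) 1).re) +
        (1 - capParam (κ t) ε) *
        ((familyTau θ κ ε (α ε) (p ε) (q ε) (t + 1) (n + 1) (M + 1)).re *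
        (familyTau θ κ ε (α ε) (p ε) (q ε) t n 1).re) +
        (capParam (κ t) ε - capParam (θ n) ε) *
        ((familyTau θ κ ε (α ε) (p ε) (q ε) t (n + 1) (M + 1)).re *
        (familyTau θ κ ε (α ε) (p ε) (q ε) (t + 1) n 1).re) = 0 := by
      linear_combination h4
    exact_mod_cast h5

/-! ### Contents of the boxes and carriers, indexed by the positions -/

section positions

variable {M : ℕ} [NeZero M]

/-- The index `j = M + 1 - p` of the letter at position `p`. -/
def letterIndex (p : Fin (M + 1)) : ℤ := (M : ℤ) + 1 - (p : ℕ)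

theorem letterIndex_zero : letterIndex (0 : Fin (M + 1)) = M + 1 := by simp [letterIndex]

theorem one_le_letterIndex (p : Fin (M + 1)) : 1 ≤ letterIndex p := by
  have := p.2; unfold letterIndex; omega

theorem letterIndex_zero_sub_one : letterIndex ((0 : Fin (M + 1)) - 1) = 1 := by
  have : (0 : Fin (M + 1)) - 1 = Fin.last M := by
    rw [sub_eq_iff_eq_add, Fin.last_add_one]
  rw [this]; simp [letterIndex]

theorem letterIndex_sub_one {p : Fin (M + 1)} (hp : p ≠ 0) :
    letterIndex (p - 1) = letterIndex p + 1 := by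
  obtain ⟨i, rfl⟩ := Fin.exists_succ_eq.mpr hp
  have : i.succ - 1 = i.castSucc := by
    rw [sub_eq_iff_eq_add, Fin.coeSucc_eq_succ]
  rw [this]; simp [letterIndex]; ring

variable (θ κ : ℤ → ℕ) (Y : ℤ → ℤ → ℤ → ℤ)

/-- The content of the box at position `p`. -/
def boxContent (t n : ℤ) (p : Fin (M + 1)) : ℤ :=
  (Y t (n + 1) (letterIndex p) - Y t n (letterIndex p)) -
    (Y t (n + 1) (letterIndex (p - 1)) - Y t n (letterIndex (p - 1))) + if p = 0 then (θ n : ℤ) else 0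

/-- The content of the carrier at position `p`. -/
def carrierContent (t n : ℤ) (p : Fin (M + 1)) : ℤ :=
  (Y t n (letterIndex p) - Y (t + 1) n (letterIndex p)) -
    (Y t n (letterIndex (p - 1)) - Y (t + 1) n (letterIndex (p - 1))) +
      if p = 0 then (κ t : ℤ) else 0

theorem sum_sub_shift (f : Fin (M + 1) → ℤ) (c : ℤ) :
    ∑ p, (f p - f (p - 1) + if p = 0 then c else 0) = c := by
  rw [Finset.sum_add_distrib, Finset.sum_sub_distrib,
    show ∑ p, f (p - 1) = ∑ p, f p from Equiv.sum_comp (Equiv.subRight 1) f]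
  simp

theorem sum_boxContent (t n : ℤ) : ∑ p : Fin (M + 1), boxContent θ Y t n p = θ n :=
  sum_sub_shift (fun p => Y t (n + 1) (letterIndex p) - Y t n (letterIndex p)) _

theorem sum_carrierContent (t n : ℤ) : ∑ p : Fin (M + 1), carrierContent κ Y t n p = κ t :=
  sum_sub_shift (fun p => Y t n (letterIndex p) - Y (t + 1) n (letterIndex p)) _

theorem letterIndex_succ (i : Fin M) : letterIndex i.succ = (M : ℤ) - (i : ℤ) := by
  simp [letterIndex]

theorem letterIndex_succ_sub_one (i : Fin M) :
    letterIndex (i.succ - 1) = (M : ℤ) - (i : ℤ) + 1 := by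
  rw [letterIndex_sub_one (Fin.succ_ne_zero i), letterIndex_succ]

theorem boxContent_succ (t n : ℤ) (i : Fin M) :
    boxContent θ Y t n i.succ = uOf Y t n ((M : ℤ) - (i : ℤ)) := by
  simp only [boxContent, letterIndex_succ, letterIndex_succ_sub_one, Fin.succ_ne_zero, if_false, uOf]
  ring

theorem carrierContent_succ (t n : ℤ) (i : Fin M) :
    carrierContent κ Y t n i.succ = vOf Y t n ((M : ℤ) - (i : ℤ)) := by
  simp only [carrierContent, letterIndex_succ, letterIndex_succ_sub_one, Fin.succ_ne_zero, if_false,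
    vOf]
  ring

/-- The element of the crystal with given nonnegative contents. -/
def crystalOf {k : ℕ} (f : Fin (M + 1) → ℤ) (h0 : ∀ p, 0 ≤ f p) (hk : ∑ p, f p = k) :
    Crystal M k :=
  ⟨fun p => (f p).toNat, by
    zify
    rw [← hk]
    exact Finset.sum_congr rfl fun p _ => Int.toNat_of_nonneg (h0 p)⟩

theorem crystalOf_apply {k : ℕ} {f : Fin (M + 1) → ℤ} (h0 : ∀ p, 0 ≤ f p) (hk : ∑ p, f p = k)
    (p : Fin (M + 1)) : ((crystalOf f h0 hk).1 p : ℤ) = f p :=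
  Int.toNat_of_nonneg (h0 p)

variable {θ κ Y} {N : ℕ} {L : Fin N → ℕ}

theorem IsUltradiscreteSolitonLimit.ultradiscreteKP_position
    (h : IsUltradiscreteSolitonLimit M N θ κ L Y) (t n : ℤ) (p : Fin (M + 1)) :
    max (Y t n (letterIndex p) + Y (t + 1) (n + 1) (letterIndex (p - 1)) -
          if p = 0 then (θ n : ℤ) else 0)
        (Y t (n + 1) (letterIndex p) + Y (t + 1) n (letterIndex (p - 1)) - κ t) =
      max (Y (t + 1) (n + 1) (letterIndex p) + Y t n (letterIndex (p - 1)) -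
          if p = 0 then (κ t : ℤ) else 0)
        (Y t (n + 1) (letterIndex p) + Y (t + 1) n (letterIndex (p - 1)) - θ n) := by
  obtain ⟨h1, h2⟩ := h.ultradiscreteKP t n
  by_cases hp : p = 0
  · subst hp
    simpa only [if_true, letterIndex_zero, letterIndex_zero_sub_one] using h2
  · simp only [hp, if_false, sub_zero, letterIndex_sub_one hp]
    refine h1 _ (one_le_letterIndex p) ?_
    have : (p : ℕ) ≠ 0 := fun h => hp (Fin.ext h)
    unfold letterIndex; omega

/-- The R matrix acts on the contents defined by a solution of the ultradiscrete equations. -/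
theorem exists_R_of_ultradiscreteKP (h : IsUltradiscreteSolitonLimit M N θ κ L Y) (t n : ℤ)
    (heq : κ t = θ n → ∀ p : Fin (M + 1),
      Y t n (letterIndex p) = Y (t + 1) (n + 1) (letterIndex p))
    {v v' : Crystal M (κ t)} {b b' : Crystal M (θ n)}
    (hv : ∀ p, (v.1 p : ℤ) = carrierContent κ Y t n p)
    (hv' : ∀ p, (v'.1 p : ℤ) = carrierContent κ Y t (n + 1) p)
    (hb : ∀ p, (b.1 p : ℤ) = boxContent θ Y t n p)
    (hb' : ∀ p, (b'.1 p : ℤ) = boxContent θ Y (t + 1) n p) :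
    ∃ R : (Crystal M (κ t) × Crystal M (θ n)) ≃ (Crystal M (θ n) × Crystal M (κ t)),
      IsCombinatorialR R ∧ R (v, b) = (b', v') := by
  -- All changes of contents are differences of `G` around the circle, and up to sign and a constant
  -- `G` is the load.
  let G : Fin (M + 1) → ℤ := fun p => Y t (n + 1) (letterIndex p) + Y (t + 1) n (letterIndex p) -
    Y t n (letterIndex p) - Y (t + 1) (n + 1) (letterIndex p)
  have hbb : ∀ p, (b'.1 p : ℤ) = b.1 p - G p + G (p - 1) := by
    intro p; rw [hb', hb]; simp only [boxContent, G]; ring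
  have hvv : ∀ p, (v'.1 p : ℤ) = v.1 p + G p - G (p - 1) := by
    intro p; rw [hv', hv]; simp only [carrierContent, G]; ring
  have hKP : ∀ p, max (-G (p - 1) - b.1 p) (-(κ t : ℤ)) = max (-G p - v.1 p) (-(θ n : ℤ)) := by
    intro p
    have := h.ultradiscreteKP_position t n p
    rw [hb, hv]
    simp only [boxContent, carrierContent, G]
    split_ifs at this ⊢ <;> omega
  have hshift : ∀ f : Fin (M + 1) → Prop, (∀ p, f (p - 1)) → ∀ p, f p := by
    intro f hf p
    have := hf (p + 1)
    rwa [add_sub_cancel_right] at this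
  rcases lt_trichotomy (θ n) (κ t) with hlt | hlt | hlt
  -- Put `H = θ - G`. The equation reads `max (H (p - 1) - b p) (θ - κ) = max (H p - v p) 0`; as `θ
  -- < κ`, the second entry on the left never attains the maximum, and the load recursion remains.
  · have hG : ∀ p, 0 ≤ θ n - G p := hshift _ fun p => by have := hKP p; omega
    have hload : IsLoad v.1 b.1 fun p => (θ n - G p).toNat := by
      intro p
      have := hKP p; have := hG p; have := hG (p - 1)
      simp only
      omega
    refine ⟨crystalR hlt, isCombinatorialR_crystalR hlt, ?_⟩
    refine (crystalR_eq hlt (a := (v, b)) hload).trans ?_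
    refine Prod.ext (crystal_ext fun p => ?_) (crystal_ext fun p => ?_)
    · have := hKP p; have := hG p; have := hG (p - 1); have := hbb p
      simp only [loadOutcome]; omega
    · have := hKP p; have := hG p; have := hG (p - 1); have := hvv p
      simp only [loadOutcome]; omega
  -- For equal capacities the equation does not determine the evolution. Invariance of `Y` along the
  -- diagonal shows instead that box and carrier exchange contents, which is the identity map of the
  -- tensor square.
  · have hG : ∀ p, b.1 p = v'.1 p ∧ b'.1 p = v.1 p := by
      intro p
      have e1 := heq hlt.symm p
      have e2 := heq hlt.symm (p - 1)
      have h1 := hv p; have h2 := hv' p; have h3 := hb p; have h4 := hb' p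
      simp only [boxContent, carrierContent, hlt] at h1 h2 h3 h4
      constructor <;> omega
    have key : ∀ {k l : ℕ} (hkl : l = k) (v v' : Crystal M k) (b b' : Crystal M l),
        (∀ p, b.1 p = v'.1 p ∧ b'.1 p = v.1 p) →
        ∃ R : (Crystal M k × Crystal M l) ≃ (Crystal M l × Crystal M k),
          IsCombinatorialR R ∧ R (v, b) = (b', v') := by
      intro k l hkl v v' b b' hG
      subst hkl
      refine ⟨Equiv.refl _, fun i x => ⟨?_, ?_⟩, ?_⟩
      · simp [Equiv.refl]
      · simp [Equiv.refl]
      · exact Prod.ext (crystal_ext fun p => (hG p).2.symm) (crystal_ext fun p => (hG p).1)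
    exact key hlt v v' b b' hG
  -- Here the roles are exchanged: `κ - G` is a load for the outcome `(b', v')`, and `R` is the
  -- inverse of the map for `κ < θ`.
  · have hG : ∀ p, 0 ≤ κ t - G p := by
      intro p
      have := hKP p; omega
    have hload : IsLoad b'.1 v'.1 fun p => (κ t - G p).toNat := by
      intro p
      have := hKP p; have := hG p; have := hG (p - 1); have := hbb p; have := hvv p
      simp only
      omega
    refine ⟨(crystalR hlt).symm, (isCombinatorialR_crystalR hlt).symm, ?_⟩
    rw [Equiv.symm_apply_eq, eq_comm]
    refine (crystalR_eq hlt (a := (b', v')) hload).trans ?_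
    refine Prod.ext (crystal_ext fun p => ?_) (crystal_ext fun p => ?_)
    · have := hKP p; have := hG p; have := hG (p - 1); have := hbb p; have := hvv p
      simp only [loadOutcome]; omega
    · have := hKP p; have := hG p; have := hG (p - 1); have := hbb p; have := hvv p
      simp only [loadOutcome]; omega

end positions

/-! ### Positivity and finiteness of the contents -/

section final

variable {M N : ℕ} [NeZero M] {θ κ : ℤ → ℕ} {L : Fin N → ℕ} {ℓ : Fin N → Fin M → ℕ}
  {K₀ : Fin N → ℤ} {Y : ℤ → ℤ → ℤ → ℤ}

theorem solitonMax_congr {θ' κ' : ℤ → ℕ} {K₀' : Fin N → ℤ} {t n t' n' : ℤ} {j : ℕ}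
    (h : ∀ i, phaseK θ κ K₀ L ℓ i t n j = phaseK θ' κ' K₀' L ℓ i t' n' j) :
    solitonMax θ κ K₀ L ℓ t n j = solitonMax θ' κ' K₀' L ℓ t' n' j := by
  simp only [solitonMax, h]

theorem dirSum_eq_pred (f : ℤ → ℤ) (n : ℤ) : dirSum f n = dirSum f (n - 1) + f n := by
  have := dirSum_succ f (n - 1)
  rwa [sub_add_cancel] at this

theorem solitonMax_diagonal {t n : ℤ} (h : κ t = θ n) (j : ℕ) :
    solitonMax θ κ K₀ L ℓ (t - 1) (n - 1) j = solitonMax θ κ K₀ L ℓ t n j := by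
  refine solitonMax_congr fun i => ?_
  simp only [phaseK]
  rw [dirSum_eq_pred _ t, dirSum_eq_pred _ n, h]
  ring

theorem dirSum_zero_capacity (X : ℕ) (n : ℤ) :
    dirSum (fun _ => ((min 0 X : ℕ) : ℤ)) n = 0 := by
  simp [dirSum]

/-- `Y` is given by the piecewise linear formula. -/
def IsSolitonMax (θ κ : ℤ → ℕ) (K₀ : Fin N → ℤ) (L : Fin N → ℕ) (ℓ : Fin N → Fin M → ℕ)
    (Y : ℤ → ℤ → ℤ → ℤ) : Prop :=
  ∀ t n : ℤ, ∀ j : ℕ, j ≤ M → Y (t + 1) (n + 1) ((j : ℤ) + 1) = solitonMax θ κ K₀ L ℓ t n j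

theorem IsSolitonMax.apply_letterIndex (hY : IsSolitonMax θ κ K₀ L ℓ Y) (t n : ℤ)
    (p : Fin (M + 1)) :
    Y t n (letterIndex p) = solitonMax θ κ K₀ L ℓ (t - 1) (n - 1) (M - p) := by
  have h := hY (t - 1) (n - 1) (M - p) (Nat.sub_le _ _)
  rw [sub_add_cancel, sub_add_cancel] at h
  rw [← h]
  congr 1
  have := p.2
  unfold letterIndex
  omega

/-- Freezing the time amounts to carriers without capacity. -/
theorem IsSolitonMax.freeze_t (hY : IsSolitonMax θ κ K₀ L ℓ Y) (t : ℤ) :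
    IsSolitonMax θ (fun _ => 0)
      (fun i => K₀ i - dirSum (fun t' => ((min (κ t') (L i) : ℕ) : ℤ)) (t - 1)) L ℓ
      (fun _ n j => Y t n j) := by
  intro t' n j hj
  have h := hY (t - 1) n j hj
  rw [sub_add_cancel] at h
  simp only [h]
  refine solitonMax_congr fun i => ?_
  simp only [phaseK, dirSum_zero_capacity]
  ring

/-- Freezing the position amounts to boxes without capacity. -/
theorem IsSolitonMax.freeze_n (hY : IsSolitonMax θ κ K₀ L ℓ Y) (n : ℤ) :
    IsSolitonMax (fun _ => 0) κ
      (fun i => K₀ i + dirSum (fun n' => ((min (θ n') (L i) : ℕ) : ℤ)) (n - 1)) L ℓ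
      (fun t _ j => Y t n j) := by
  intro t n' j hj
  have h := hY t (n - 1) j hj
  rw [sub_add_cancel] at h
  simp only [h]
  refine solitonMax_congr fun i => ?_
  simp only [phaseK, dirSum_zero_capacity]
  ring

theorem IsSolitonMax.isUltradiscreteSolitonLimit (hY : IsSolitonMax θ κ K₀ L ℓ Y)
    (hL : ∀ i, L i = ∑ m, ℓ i m) (hL_anti : Antitone L) (hℓ : ∀ m, Antitone fun i => ℓ i m) :
    IsUltradiscreteSolitonLimit M N θ κ L Y :=
  AMAutomaton.isUltradiscreteSolitonLimit θ κ hL hL_anti hℓ K₀ Y hY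

/-- With `Y` constant in time and carriers of capacity 0, the right side of the ultradiscrete
equation is `Y (n + 1) (p) + Y n (p - 1)`, and it bounds the first entry on the left. That bound
says that the content is nonnegative. -/
theorem IsSolitonMax.boxContent_nonneg (hY : IsSolitonMax θ κ K₀ L ℓ Y)
    (hL : ∀ i, L i = ∑ m, ℓ i m) (hL_anti : Antitone L) (hℓ : ∀ m, Antitone fun i => ℓ i m)
    (t n : ℤ) (p : Fin (M + 1)) : 0 ≤ boxContent θ Y t n p := by
  have h := ((hY.freeze_t t).isUltradiscreteSolitonLimit hL hL_anti hℓ).ultradiscreteKP_position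
    t n p
  simp only [boxContent]
  split_ifs at h ⊢ <;> simp only [Nat.cast_zero, sub_zero] at h <;> omega

theorem IsSolitonMax.carrierContent_nonneg (hY : IsSolitonMax θ κ K₀ L ℓ Y)
    (hL : ∀ i, L i = ∑ m, ℓ i m) (hL_anti : Antitone L) (hℓ : ∀ m, Antitone fun i => ℓ i m)
    (t n : ℤ) (p : Fin (M + 1)) : 0 ≤ carrierContent κ Y t n p := by
  have h := ((hY.freeze_n n).isUltradiscreteSolitonLimit hL hL_anti hℓ).ultradiscreteKP_position
    t n p
  simp only [carrierContent]
  split_ifs at h ⊢ <;> simp only [Nat.cast_zero, sub_zero] at h <;> omega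

/-- The dependence on `j` is bounded uniformly in `t` and `n`. -/
theorem exists_solitonMax_sub_le (θ κ : ℤ → ℕ) (K₀ : Fin N → ℤ) (L : Fin N → ℕ)
    (ℓ : Fin N → Fin M → ℕ) (j j' : ℕ) :
    ∃ C, ∀ t n, solitonMax θ κ K₀ L ℓ t n j ≤ solitonMax θ κ K₀ L ℓ t n j' + C := by
  -- Passing from `j'` to `j` changes the term of `S` by `D S`, which involves neither `t` nor `n`.
  let D : Finset (Fin N) → ℤ := fun S =>
    ∑ i ∈ S, ((partialContent ℓ i j' : ℤ) - partialContent ℓ i j) + phaseA L ℓ S j' - phaseA L ℓ S j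
  refine ⟨∑ S, |D S|, fun t n => Finset.sup'_le _ _ fun S _ => ?_⟩
  have h1 : ∑ i ∈ S, phaseK θ κ K₀ L ℓ i t n j - phaseA L ℓ S j =
      (∑ i ∈ S, phaseK θ κ K₀ L ℓ i t n j' - phaseA L ℓ S j') + D S := by
    have : ∑ i ∈ S, phaseK θ κ K₀ L ℓ i t n j = ∑ i ∈ S, phaseK θ κ K₀ L ℓ i t n j' +
        ∑ i ∈ S, ((partialContent ℓ i j' : ℤ) - partialContent ℓ i j) := by
      rw [← Finset.sum_add_distrib]
      refine Finset.sum_congr rfl fun i _ => ?_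
      simp only [phaseK]; ring
    rw [this]; simp only [D]; ring
  rw [h1]
  refine add_le_add ?_ ?_
  · exact Finset.le_sup' (fun S => ∑ i ∈ S, phaseK θ κ K₀ L ℓ i t n j' - phaseA L ℓ S j')
      (Finset.mem_univ S)
  · exact (le_abs_self _).trans
      (Finset.single_le_sum (f := fun S => |D S|) (fun _ _ => abs_nonneg _) (Finset.mem_univ S))

theorem IsSolitonMax.exists_bound (hY : IsSolitonMax θ κ K₀ L ℓ Y) (p p' : Fin (M + 1)) :
    ∃ C, ∀ t n, |Y t n (letterIndex p) - Y t n (letterIndex p')| ≤ C := by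
  obtain ⟨C, hC⟩ := exists_solitonMax_sub_le θ κ K₀ L ℓ (M - p) (M - p')
  obtain ⟨C', hC'⟩ := exists_solitonMax_sub_le θ κ K₀ L ℓ (M - p') (M - p)
  refine ⟨max C C', fun t n => ?_⟩
  have h1 := hC (t - 1) (n - 1)
  have h2 := hC' (t - 1) (n - 1)
  rw [← hY.apply_letterIndex, ← hY.apply_letterIndex] at h1 h2
  rw [abs_le]
  omega

/-- A bounded monotone sequence of integers is constant up to finitely many steps. -/
theorem finite_steps_of_monotone {D : ℤ → ℤ} (hD : Monotone D) {C : ℤ} (hC : ∀ n, |D n| ≤ C) :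
    {n | D (n + 1) ≠ D n}.Finite := by
  -- `D` is injective on the places where it jumps, and its values lie in a finite interval.
  refine Set.Finite.of_injOn (f := D) (t := Set.Icc (-C) C) (fun n _ => abs_le.mp (hC n)) ?_
    (Set.finite_Icc _ _)
  have key : ∀ n m, D (n + 1) ≠ D n → n < m → D n < D m := fun n m hn hnm =>
    (lt_of_le_of_ne (hD (by omega)) hn.symm).trans_le (hD (by omega : n + 1 ≤ m))
  intro n hn m hm hnm
  rcases lt_trichotomy n m with h | h | h
  · exact absurd hnm (key n m hn h).ne
  · exact h
  · exact absurd hnm (key m n hm h).ne'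

/-- For `p ≠ 0` the content is the increment in `n` of `Y n (p) - Y n (p - 1)`, a sequence that is
monotone because contents are nonnegative and bounded because the dependence on `j` is. -/
theorem IsSolitonMax.finite_boxContent (hY : IsSolitonMax θ κ K₀ L ℓ Y)
    (hL : ∀ i, L i = ∑ m, ℓ i m) (hL_anti : Antitone L) (hℓ : ∀ m, Antitone fun i => ℓ i m)
    (t : ℤ) {p : Fin (M + 1)} (hp : p ≠ 0) : {n | boxContent θ Y t n p ≠ 0}.Finite := by
  obtain ⟨C, hC⟩ := hY.exists_bound p (p - 1)
  have hnn := fun n => hY.boxContent_nonneg hL hL_anti hℓ t n p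
  simp only [boxContent, hp, if_false, add_zero] at hnn
  refine (finite_steps_of_monotone (D := fun n => Y t n (letterIndex p) -
    Y t n (letterIndex (p - 1))) (monotone_int_of_le_succ fun n => ?_) (hC t)).subset fun n hn => ?_
  · have := hnn n; omega
  · simp only [boxContent, hp, if_false, add_zero, Set.mem_ofPred_eq] at hn ⊢
    omega

theorem IsSolitonMax.finite_carrierContent (hY : IsSolitonMax θ κ K₀ L ℓ Y)
    (hL : ∀ i, L i = ∑ m, ℓ i m) (hL_anti : Antitone L) (hℓ : ∀ m, Antitone fun i => ℓ i m)
    (n : ℤ) {p : Fin (M + 1)} (hp : p ≠ 0) : {t | carrierContent κ Y t n p ≠ 0}.Finite := by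
  obtain ⟨C, hC⟩ := hY.exists_bound (p - 1) p
  have hnn := fun t => hY.carrierContent_nonneg hL hL_anti hℓ t n p
  simp only [carrierContent, hp, if_false, add_zero] at hnn
  refine (finite_steps_of_monotone (D := fun t => Y t n (letterIndex (p - 1)) -
    Y t n (letterIndex p)) (monotone_int_of_le_succ fun t => ?_) fun t => hC t n).subset
      fun t ht => ?_
  · have := hnn t; omega
  · simp only [carrierContent, hp, if_false, add_zero, Set.mem_ofPred_eq] at ht ⊢
    omega

theorem eq_highest_of_forall {k : ℕ} {b : Crystal M k} (h : ∀ p, p ≠ 0 → b.1 p = 0) :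
    b = highest M k := by
  refine crystal_ext fun p => ?_
  by_cases hp : p = 0
  · subst hp
    have := b.2
    rw [Finset.sum_eq_single 0 (fun q _ hq => h q hq) (by simp)] at this
    simpa [highest] using this
  · simpa [highest, Pi.single_eq_of_ne hp] using h p hp

theorem finite_ne_highest {X : ℤ → ℕ} {b : (n : ℤ) → Crystal M (X n)} {f : ℤ → Fin (M + 1) → ℤ}
    (hb : ∀ n p, ((b n).1 p : ℤ) = f n p) (hf : ∀ p, p ≠ 0 → {n | f n p ≠ 0}.Finite) :
    {n | b n ≠ highest M (X n)}.Finite := by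
  refine (Set.finite_iUnion fun p : {p : Fin (M + 1) // p ≠ 0} => hf p.1 p.2).subset
    fun n hn => ?_
  by_contra hcon
  refine hn (eq_highest_of_forall fun p hp => ?_)
  by_contra h0
  refine hcon (Set.mem_iUnion.mpr ⟨⟨p, hp⟩, ?_⟩)
  have := hb n p
  simp only [Set.mem_ofPred_eq]
  omega

theorem IsSolitonMax.isNSolitonSolution (hY : IsSolitonMax θ κ K₀ L ℓ Y)
    (hL : ∀ i, L i = ∑ m, ℓ i m) (hL_anti : Antitone L) (hℓ : ∀ m, Antitone fun i => ℓ i m) :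
    IsNSolitonSolution M N θ κ L Y := by
  have hlim := hY.isUltradiscreteSolitonLimit hL hL_anti hℓ
  let b : (t n : ℤ) → Crystal M (θ n) := fun t n =>
    crystalOf (boxContent θ Y t n) (hY.boxContent_nonneg hL hL_anti hℓ t n)
      (sum_boxContent θ Y t n)
  let v : (t n : ℤ) → Crystal M (κ t) := fun t n =>
    crystalOf (carrierContent κ Y t n) (hY.carrierContent_nonneg hL hL_anti hℓ t n)
      (sum_carrierContent κ Y t n)
  have hb : ∀ t n p, ((b t n).1 p : ℤ) = boxContent θ Y t n p := fun t n p =>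
    crystalOf_apply _ _ p
  have hv : ∀ t n p, ((v t n).1 p : ℤ) = carrierContent κ Y t n p := fun t n p =>
    crystalOf_apply _ _ p
  refine ⟨hlim, b, v, ⟨fun t n => ?_, fun t => ?_, fun n => ?_⟩, fun t n i => ⟨?_, ?_⟩⟩
  · refine exists_R_of_ultradiscreteKP hlim t n (fun h p => ?_) (hv t n) (hv t (n + 1)) (hb t n)
      (hb (t + 1) n)
    rw [hY.apply_letterIndex, hY.apply_letterIndex, add_sub_cancel_right, add_sub_cancel_right,
      solitonMax_diagonal h]
  · exact finite_ne_highest (fun n p => hb t n p) fun p hp =>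
      hY.finite_boxContent hL hL_anti hℓ t hp
  · exact finite_ne_highest (fun t p => hv t n p) fun p hp =>
      hY.finite_carrierContent hL hL_anti hℓ n hp
  · rw [hb, boxContent_succ]
  · rw [hv, carrierContent_succ]

end final

end AMAutomaton

end

theorem theorem4p5 (M N : ℕ) [NeZero M] (θ κ : ℤ → ℕ)
    (hθ : ∀ n, 0 < θ n) (hκ : ∀ t, 0 < κ t)
    (L : Fin N → ℕ) (ℓ : Fin N → Fin M → ℕ)
    (hL : ∀ i, L i = ∑ m, ℓ i m) (hL_anti : Antitone L)
    (hℓ_anti : ∀ m, Antitone (fun i => ℓ i m)) (K₀ : Fin N → ℤ)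
    (Y : ℤ → ℤ → ℤ → ℤ)
    (hY : ∀ t n : ℤ, ∀ j : ℕ, j ≤ M →
      Y (t + 1) (n + 1) ((j : ℤ) + 1) = AMAutomaton.solitonMax θ κ K₀ L ℓ t n j) :
    AMAutomaton.IsNSolitonSolution M N θ κ L Y :=
  AMAutomaton.IsSolitonMax.isNSolitonSolution (K₀ := K₀) hY hL hL_anti hℓ_anti
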